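/- **Definitions.** A *double category* $\mathcal D$ is a category internal to small categories: it has sets $Ob$ (objects), $Hor$ and $Ver$ (horizontal and vertical morphisms between objects) and $Sq$ (squares, each with left and right vertical sides, its horizontal source and target, and with top and bottom horizontal sides, its vertical source and target), with strictly unital and associative horizontal and vertical compositions of morphisms and of squares satisfying the interchange law. It is *stable* if each of the two maps sending a square to (left side, top side) and to (right side, bottom side) is a bijection, from $Sq$ onto the set of pairs in $Ver\times Hor$ with common source, respectively with common target. An *augmentation* of $\mathcal D$ is a set $A\subseteq Ob$ such that for every object $d$ there are a unique horizontal morphism to $d$ whose source is in $A$ and a unique vertical morphism from $d$ whose target is in $A$; augmented double functors are the double functors that map augmentation into augmentation. $\mathcal D$ is *pointed* if it is equipped with an object $*$ that is initial in the horizontal and terminal in the vertical category; pointed double functors preserve $*$. Pointed double categories are regarded as augmented ones with $A=\{*\}$. Write $\mathcal{DC}at^{st}_{aug}$ and $\mathcal{DC}at^{st}_*$ for the categories of augmented, respectively pointed, stable double categories and augmented, respectively pointed, double functors. A simplicial set $X$ is *2-Segal* if for every $n\ge 3$ and every triangulation $\mathcal T$ of the convex $(n+1)$-gon with vertices $0,\dots,n$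 the map from $X_n$ to the iterated fibre product $X_2\times_{X_1}\cdots\times_{X_1}X_2$ (one factor for each triangle of $\mathcal T$, glued along common edges) is a bijection. It is *unital* if for all $n\ge 2$ and $0\le i\le n-1$ the square with sides $X_{n-1}\to X_0$ (induced by $[0]\to[n-1]$, $0\mapsto i$), $s_i\colon X_{n-1}\to X_n$, $s_0\colon X_0\to X_1$ and $X_n\to X_1$ (induced by $[1]\to[n]$, $0\mapsto i$, $1\mapsto i+1$) is a pullback. It is *reduced* if $X_0$ has exactly one element. Write $\mathcal U2\mathcal Seg$ and $\mathcal U2\mathcal Seg_*$ for the full subcategories of simplicial sets on the unital, respectively reduced unital, 2-Segal sets. Let $\mathcal W_n$ be the double category with objects the pairs $ij$, $0\le i\le j\le n$, exactly one horizontal morphism $ij\to ik$ for $i\le j\le k$, exactly one vertical morphism $ij\to kj$ for $i\le k\le j$, and exactly one square with corners $ij, il, kj, kl$ for $i\le k\le j\le l$ (and no others), augmented by $\{ii\}$. For an augmented double category $\mathcal D$ let $S_n(\mathcal D)$ be the set of augmented double functors $\mathcal W_n\to\mathcal D$; these form a simplicial set $S_\bullet(\mathcal D)$, functorially in $\mathcal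 D$ (the generalized Waldhausen construction). For a unital 2-Segal set $X$ let $\mathcal P X$ be the augmented stable double category (path construction) with $Ob=X_1$, $Hor=Ver=X_2$, $Sq=X_3$ and augmentation $s_0X_0\subseteq X_1$, where * horizontal morphisms have source $d_2$, target $d_1$, identities $s_1$ and composition $X_2\times_{X_1}X_2\xleftarrow[\cong]{(d_3,d_1)}X_3\xrightarrow{d_2}X_2$; * vertical morphisms have source $d_1$, target $d_0$, identities $s_0$ and composition $X_2\times_{X_1}X_2\xleftarrow[\cong]{(d_2,d_0)}X_3\xrightarrow{d_1}X_2$; * squares have horizontal source $d_3$ and target $d_2$ (vertical morphisms), horizontal identities $s_2$ and horizontal composition $X_3\times_{X_2}X_3\xleftarrow[\cong]{(d_4,d_2)}X_4\xrightarrow{d_3}X_3$; and vertical source $d_1$ and target $d_0$ (horizontal morphisms), vertical identities $s_0$ and vertical composition $X_3\times_{X_2}X_3\xleftarrow[\cong]{(d_2,d_0)}X_4\xrightarrow{d_1}X_3$. A simplicial map $f$ induces $\mathcal P f=(f_1,f_2,f_2,f_3)$. If $X$ is reduced, $\mathcal P X$ is pointed by the unique element of $s_0X_0$. **Theorem.**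 If $\mathcal D$ is an augmented stable double category, then $S_\bullet(\mathcal D)$ is a unital 2-Segal set; if $\mathcal D$ is a pointed stable double category, then $S_\bullet(\mathcal D)$ is moreover reduced. The functors $S_\bullet$ and $\mathcal P$ are mutually inverse equivalences of categories $$S_\bullet\colon \mathcal{DC}at^{st}_{aug}\rightleftarrows \mathcal U2\mathcal Seg :\mathcal P ,$$ and they restrict, compatibly (up to natural isomorphism) with the functor $\mathcal{DC}at^{st}_*\to\mathcal{DC}at^{st}_{aug}$ given by $A=\{*\}$ and the inclusion $\mathcal U2\mathcal Seg_*\subseteq\mathcal U2\mathcal Seg$, to mutually inverse equivalences $$S_\bullet\colon \mathcal{DC}at^{st}_{*}\rightleftarrows \mathcal U2\mathcal Seg_* :\mathcal P .$$ -/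

import Mathlib

open CategoryTheory Simplicial Opposite

namespace TwoSegal

universe u v w

/-! ### Double categories -/

/-- A (single-sorted) category structure on a set `O` of objects and a set `M` of morphisms.
Composition is written in diagrammatic order: `comp f g h` is `f` followed by `g`. -/
structure CatOn (O : Type u) (M : Type u) where
  dom : M → O
  cod : M → O
  id : O → M
  comp : (f g : M) → cod f = dom g → M
  dom_id : ∀ x, dom (id x) = x
  cod_id : ∀ x, cod (id x) = x
  dom_comp : ∀ f g h, dom (comp f g h) = dom f
  cod_comp : ∀ f g h, cod (comp f g h) = cod g
  id_comp : ∀ f, comp (id (dom f)) f (cod_id _) = f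
  comp_id : ∀ f, comp f (id (cod f)) (dom_id _).symm = f
  assoc : ∀ f g k (h₁ : cod f = dom g) (h₂ : cod g = dom k),
    comp (comp f g h₁) k ((cod_comp f g h₁).trans h₂) =
      comp f (comp g k h₂) (h₁.trans (dom_comp g k h₂).symm)

/-- A functor, given by its maps on objects and on morphisms. -/
structure CatOn.IsFunctor {O M : Type u} {O' M' : Type v} (C : CatOn O M) (C' : CatOn O' M')
    (F : O → O') (G : M → M') : Prop where
  dom : ∀ f, C'.dom (G f) = F (C.dom f)
  cod : ∀ f, C'.cod (G f) = F (C.cod f)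
  id : ∀ x, G (C.id x) = C'.id (F x)
  comp : ∀ f g (h : C.cod f = C.dom g),
    G (C.comp f g h) = C'.comp (G f) (G g) ((cod f).trans ((congrArg F h).trans (dom g).symm))

/-- A small double category, i.e. a category internal to small categories: the category of
objects is `ver₀`, the category of morphisms is `ver₁` (vertical composition of squares), and the
internal source, target, identity and composition are given by `hor₀` on the level of objects and
by `hor₁` (horizontal composition of squares) on the level of morphisms; these four
have to be functors. For a square `α`, `hor₁.dom α` and `hor₁.cod α` are its
left and right vertical morphisms, `ver₁.dom α` and `ver₁.cod α` its top and bottom horizontal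
morphisms. -/
structure DblCat where
  Ob : Type u
  Hor : Type u
  Ver : Type u
  Sq : Type u
  hor₀ : CatOn Ob Hor
  ver₀ : CatOn Ob Ver
  hor₁ : CatOn Ver Sq
  ver₁ : CatOn Hor Sq
  dom_functor : ver₁.IsFunctor ver₀ hor₀.dom hor₁.dom
  cod_functor : ver₁.IsFunctor ver₀ hor₀.cod hor₁.cod
  id_functor : ver₀.IsFunctor ver₁ hor₀.id hor₁.id
  comp_dom : ∀ α β (h : hor₁.cod α = hor₁.dom β),
    ver₁.dom (hor₁.comp α β h) = hor₀.comp (ver₁.dom α) (ver₁.dom β)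
      ((cod_functor.dom α).symm.trans ((congrArg ver₀.dom h).trans (dom_functor.dom β)))
  comp_cod : ∀ α β (h : hor₁.cod α = hor₁.dom β),
    ver₁.cod (hor₁.comp α β h) = hor₀.comp (ver₁.cod α) (ver₁.cod β)
      ((cod_functor.cod α).symm.trans ((congrArg ver₀.cod h).trans (dom_functor.cod β)))
  comp_id : ∀ f g (h : hor₀.cod f = hor₀.dom g),
    hor₁.comp (ver₁.id f) (ver₁.id g)
      ((cod_functor.id f).trans ((congrArg ver₀.id h).trans (dom_functor.id g).symm)) =
    ver₁.id (hor₀.comp f g h)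
  /-- The interchange law. -/
  interchange : ∀ α β γ δ (hαβ : hor₁.cod α = hor₁.dom β) (hγδ : hor₁.cod γ = hor₁.dom δ)
    (hαγ : ver₁.cod α = ver₁.dom γ) (hβδ : ver₁.cod β = ver₁.dom δ)
    (h₁ : hor₁.cod (ver₁.comp α γ hαγ) = hor₁.dom (ver₁.comp β δ hβδ))
    (h₂ : ver₁.cod (hor₁.comp α β hαβ) = ver₁.dom (hor₁.comp γ δ hγδ)),
    hor₁.comp (ver₁.comp α γ hαγ) (ver₁.comp β δ hβδ) h₁ =
      ver₁.comp (hor₁.comp α β hαβ) (hor₁.comp γ δ hγδ) h₂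

/-- A double functor, i.e. an internal functor. The two double categories may live in different
universes. -/
@[ext]
structure DblFunctor (C : DblCat.{u}) (D : DblCat.{v}) where
  ob : C.Ob → D.Ob
  hor : C.Hor → D.Hor
  ver : C.Ver → D.Ver
  sq : C.Sq → D.Sq
  isFunctor_hor₀ : C.hor₀.IsFunctor D.hor₀ ob hor
  isFunctor_ver₀ : C.ver₀.IsFunctor D.ver₀ ob ver
  isFunctor_hor₁ : C.hor₁.IsFunctor D.hor₁ ver sq
  isFunctor_ver₁ : C.ver₁.IsFunctor D.ver₁ hor sq

theorem CatOn.IsFunctor.refl {O M : Type u} (C : CatOn O M) :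
    C.IsFunctor C (fun x => x) (fun f => f) :=
  ⟨fun _ => rfl, fun _ => rfl, fun _ => rfl, fun _ _ _ => rfl⟩

theorem CatOn.IsFunctor.trans {O M : Type u} {O' M' : Type v} {O'' M'' : Type w}
    {C : CatOn O M} {C' : CatOn O' M'} {C'' : CatOn O'' M''} {F : O → O'} {G : M → M'}
    {F' : O' → O''} {G' : M' → M''} (h : C.IsFunctor C' F G) (h' : C'.IsFunctor C'' F' G') :
    C.IsFunctor C'' (fun x => F' (F x)) (fun f => G' (G f)) where
  dom f := by rw [h'.dom, h.dom]
  cod f := by rw [h'.cod, h.cod]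
  id x := by rw [h.id, h'.id]
  comp f g e := by rw [h.comp, h'.comp]

/-- The identity double functor. -/
def DblFunctor.refl (C : DblCat.{u}) : DblFunctor C C where
  ob x := x
  hor x := x
  ver x := x
  sq x := x
  isFunctor_hor₀ := .refl _
  isFunctor_ver₀ := .refl _
  isFunctor_hor₁ := .refl _
  isFunctor_ver₁ := .refl _

/-- Composition of double functors (first `F`, then `G`). -/
def DblFunctor.trans {C : DblCat.{u}} {D : DblCat.{v}} {E : DblCat.{w}} (F : DblFunctor C D)
    (G : DblFunctor D E) : DblFunctor C E where
  ob x := G.ob (F.ob x)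
  hor x := G.hor (F.hor x)
  ver x := G.ver (F.ver x)
  sq x := G.sq (F.sq x)
  isFunctor_hor₀ := F.isFunctor_hor₀.trans G.isFunctor_hor₀
  isFunctor_ver₀ := F.isFunctor_ver₀.trans G.isFunctor_ver₀
  isFunctor_hor₁ := F.isFunctor_hor₁.trans G.isFunctor_hor₁
  isFunctor_ver₁ := F.isFunctor_ver₁.trans G.isFunctor_ver₁

/-- Stability: every square is uniquely determined by its span of sources and, independently, by
its cospan of targets, and every span and every cospan arises in this way. -/
structure DblCat.IsStable (D : DblCat.{u}) : Prop where
  span : Function.Bijective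
    (fun α : D.Sq => (⟨(D.hor₁.dom α, D.ver₁.dom α), D.dom_functor.dom α⟩ :
      {p : D.Ver × D.Hor // D.ver₀.dom p.1 = D.hor₀.dom p.2}))
  cospan : Function.Bijective
    (fun α : D.Sq => (⟨(D.hor₁.cod α, D.ver₁.cod α), D.cod_functor.cod α⟩ :
      {p : D.Ver × D.Hor // D.ver₀.cod p.1 = D.hor₀.cod p.2}))

/-- A set `A` of objects is an augmentation if for every object `d` there are a unique horizontal
morphism to `d` with source in `A` and a unique vertical morphism from `d` with target in `A`. -/
structure DblCat.IsAugmentation (D : DblCat.{u}) (A : Set D.Ob) : Prop where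
  hor : ∀ d, ∃! f, D.hor₀.cod f = d ∧ D.hor₀.dom f ∈ A
  ver : ∀ d, ∃! g, D.ver₀.dom g = d ∧ D.ver₀.cod g ∈ A

/-- An augmented double category. -/
structure AugDblCat where
  toDbl : DblCat.{u}
  aug : Set toDbl.Ob
  isAugmentation : toDbl.IsAugmentation aug

/-- An augmented double functor. -/
@[ext]
structure AugDblFunctor (C : AugDblCat.{u}) (D : AugDblCat.{v}) where
  toFunctor : DblFunctor C.toDbl D.toDbl
  map_aug : ∀ a ∈ C.aug, toFunctor.ob a ∈ D.aug

/-- Composition of augmented double functors (first `F`, then `G`). -/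
def AugDblFunctor.trans {C : AugDblCat.{u}} {D : AugDblCat.{v}} {E : AugDblCat.{w}}
    (F : AugDblFunctor C D) (G : AugDblFunctor D E) : AugDblFunctor C E where
  toFunctor := F.toFunctor.trans G.toFunctor
  map_aug a ha := G.map_aug _ (F.map_aug a ha)

/-- The category of augmented double categories and augmented double functors. -/
instance : Category AugDblCat.{u} where
  Hom C D := AugDblFunctor C D
  id C := ⟨.refl C.toDbl, fun _ h => h⟩
  comp F G := F.trans G

/-- A pointed double category: the distinguished object is initial in the horizontal category
and terminal in the vertical category. -/
structure PtDblCat where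
  toDbl : DblCat.{u}
  pt : toDbl.Ob
  initial : ∀ d, ∃! f, toDbl.hor₀.dom f = pt ∧ toDbl.hor₀.cod f = d
  terminal : ∀ d, ∃! g, toDbl.ver₀.dom g = d ∧ toDbl.ver₀.cod g = pt

/-- A pointed double functor. -/
@[ext]
structure PtDblFunctor (C : PtDblCat.{u}) (D : PtDblCat.{v}) where
  toFunctor : DblFunctor C.toDbl D.toDbl
  map_pt : toFunctor.ob C.pt = D.pt

/-- The category of pointed double categories and pointed double functors. -/
instance : Category PtDblCat.{u} where
  Hom C D := PtDblFunctor C D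
  id C := ⟨.refl C.toDbl, rfl⟩
  comp F G := ⟨F.toFunctor.trans G.toFunctor, (congrArg _ F.map_pt).trans G.map_pt⟩

/-- A pointed double category, regarded as an augmented double category whose augmentation is a
singleton. -/
def ptToAug : PtDblCat.{u} ⥤ AugDblCat.{u} where
  obj D :=
    { toDbl := D.toDbl
      aug := {D.pt}
      isAugmentation :=
        { hor := fun d => by
            obtain ⟨f, ⟨h₁, h₂⟩, h⟩ := D.initial d
            exact ⟨f, ⟨h₂, h₁⟩, fun y hy => h y ⟨hy.2, hy.1⟩⟩
          ver := D.terminal } }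
  map {C D} F := ⟨F.toFunctor, fun a ha => (congrArg F.toFunctor.ob ha).trans F.map_pt⟩

/-- The property of an augmented double category of being stable. -/
def augStable : ObjectProperty AugDblCat.{u} := fun D => D.toDbl.IsStable

/-- The property of a pointed double category of being stable. -/
def ptStable : ObjectProperty PtDblCat.{u} := fun D => D.toDbl.IsStable

/-- The category of augmented stable double categories. -/
abbrev AugStDblCat := augStable.{u}.FullSubcategory

/-- The category of pointed stable double categories. -/
abbrev PtStDblCat := ptStable.{u}.FullSubcategory

/-- A pointed stable double category, regarded as an augmented one. -/
def ptToAugSt : PtStDblCat.{u} ⥤ AugStDblCat.{u} :=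
  augStable.lift (ptStable.ι ⋙ ptToAug) fun D => D.property

/-! ### The double categories `𝒲_n` and the Waldhausen construction -/

/-- The objects `ij` of `𝒲_P`, for a poset `P`. -/
@[ext]
structure WOb (P : Type u) [PartialOrder P] where
  i : P
  j : P
  hij : i ≤ j

/-- The horizontal morphisms `ij → ik` of `𝒲_P`. -/
@[ext]
structure WHor (P : Type u) [PartialOrder P] where
  i : P
  j : P
  k : P
  hij : i ≤ j
  hjk : j ≤ k

/-- The vertical morphisms `ij → kj` of `𝒲_P`. -/
@[ext]
structure WVer (P : Type u) [PartialOrder P] where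
  i : P
  k : P
  j : P
  hik : i ≤ k
  hkj : k ≤ j

/-- The squares of `𝒲_P`, from the top horizontal morphism `ij → il` to the
bottom horizontal morphism `kj → kl`. -/
@[ext]
structure WSq (P : Type u) [PartialOrder P] where
  i : P
  k : P
  j : P
  l : P
  hik : i ≤ k
  hkj : k ≤ j
  hjl : j ≤ l

section W
variable (P : Type u) [PartialOrder P]

/-- The horizontal category of `𝒲_P`. -/
def wHor₀ : CatOn (WOb P) (WHor P) where
  dom f := ⟨f.i, f.j, f.hij⟩
  cod f := ⟨f.i, f.k, f.hij.trans f.hjk⟩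
  id x := ⟨x.i, x.j, x.j, x.hij, le_rfl⟩
  comp f g h := ⟨f.i, f.j, g.k, f.hij, f.hjk.trans ((congrArg WOb.j h).le.trans g.hjk)⟩
  dom_id _ := rfl
  cod_id _ := rfl
  dom_comp _ _ _ := rfl
  cod_comp _ _ h := WOb.ext (congrArg WOb.i h :) rfl
  id_comp _ := rfl
  comp_id _ := rfl
  assoc _ _ _ _ _ := rfl

/-- The vertical category of `𝒲_P`. -/
def wVer₀ : CatOn (WOb P) (WVer P) where
  dom f := ⟨f.i, f.j, f.hik.trans f.hkj⟩
  cod f := ⟨f.k, f.j, f.hkj⟩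
  id x := ⟨x.i, x.i, x.j, le_rfl, x.hij⟩
  comp f g h := ⟨f.i, g.k, g.j, f.hik.trans ((congrArg WOb.i h).le.trans g.hik), g.hkj⟩
  dom_id _ := rfl
  cod_id _ := rfl
  dom_comp _ _ h := WOb.ext rfl (congrArg WOb.j h :).symm
  cod_comp _ _ _ := rfl
  id_comp _ := rfl
  comp_id _ := rfl
  assoc _ _ _ _ _ := rfl

/-- The horizontal composition of squares in `𝒲_P`. -/
def wHor₁ : CatOn (WVer P) (WSq P) where
  dom α := ⟨α.i, α.k, α.j, α.hik, α.hkj⟩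
  cod α := ⟨α.i, α.k, α.l, α.hik, α.hkj.trans α.hjl⟩
  id f := ⟨f.i, f.k, f.j, f.j, f.hik, f.hkj, le_rfl⟩
  comp α β h := ⟨α.i, α.k, α.j, β.l, α.hik, α.hkj,
    α.hjl.trans ((congrArg WVer.j h).le.trans β.hjl)⟩
  dom_id _ := rfl
  cod_id _ := rfl
  dom_comp _ _ _ := rfl
  cod_comp _ _ h := WVer.ext (congrArg WVer.i h :) (congrArg WVer.k h :) rfl
  id_comp _ := rfl
  comp_id _ := rfl
  assoc _ _ _ _ _ := rfl

/-- The vertical composition of squares in `𝒲_P`. -/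
def wVer₁ : CatOn (WHor P) (WSq P) where
  dom α := ⟨α.i, α.j, α.l, α.hik.trans α.hkj, α.hjl⟩
  cod α := ⟨α.k, α.j, α.l, α.hkj, α.hjl⟩
  id f := ⟨f.i, f.i, f.j, f.k, le_rfl, f.hij, f.hjk⟩
  comp α β h := ⟨α.i, β.k, β.j, β.l, α.hik.trans ((congrArg WHor.i h).le.trans β.hik),
    β.hkj, β.hjl⟩
  dom_id _ := rfl
  cod_id _ := rfl
  dom_comp _ _ h := WHor.ext rfl (congrArg WHor.j h :).symm (congrArg WHor.k h :).symm
  cod_comp _ _ _ := rfl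
  id_comp _ := rfl
  comp_id _ := rfl
  assoc _ _ _ _ _ := rfl

/-- The double category `𝒲_P`; for `P = {0 < 1 < ⋯ < n}` this is `𝒲_n`. -/
def wDbl : DblCat.{u} where
  Ob := WOb P
  Hor := WHor P
  Ver := WVer P
  Sq := WSq P
  hor₀ := wHor₀ P
  ver₀ := wVer₀ P
  hor₁ := wHor₁ P
  ver₁ := wVer₁ P
  dom_functor := ⟨fun _ => rfl, fun _ => rfl, fun _ => rfl, fun _ _ _ => rfl⟩
  cod_functor := ⟨fun _ => rfl, fun _ => rfl, fun _ => rfl, fun _ _ _ => rfl⟩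
  id_functor := ⟨fun _ => rfl, fun _ => rfl, fun _ => rfl, fun _ _ _ => rfl⟩
  comp_dom _ _ _ := rfl
  comp_cod _ _ _ := rfl
  comp_id _ _ _ := rfl
  interchange _ _ _ _ _ _ _ _ _ _ := rfl

/-- `𝒲_P` with its augmentation, the diagonal `{ii}`. -/
def wAug : AugDblCat.{u} where
  toDbl := wDbl P
  aug := {x | WOb.i x = WOb.j x}
  isAugmentation :=
    { hor := fun d => by
        refine ⟨(⟨d.i, d.i, d.j, le_rfl, d.hij⟩ : WHor P), ⟨rfl, rfl⟩, ?_⟩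
        rintro ⟨i, j, k, hij, hjk⟩ ⟨rfl, h⟩
        exact WHor.ext rfl (Eq.symm h) rfl
      ver := fun d => by
        refine ⟨(⟨d.i, d.j, d.j, d.hij, le_rfl⟩ : WVer P), ⟨rfl, rfl⟩, ?_⟩
        rintro ⟨i, k, j, hij, hjk⟩ ⟨rfl, h⟩
        exact WVer.ext rfl h rfl }

end W

/-- The functoriality of `𝒲_P` in `P`. -/
def wMap {P : Type u} {Q : Type v} [PartialOrder P] [PartialOrder Q] (f : P →o Q) :
    AugDblFunctor (wAug P) (wAug Q) where
  toFunctor :=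
    { ob := fun x => (⟨f x.i, f x.j, f.monotone x.hij⟩ : WOb Q)
      hor := fun x => (⟨f x.i, f x.j, f x.k, f.monotone x.hij, f.monotone x.hjk⟩ : WHor Q)
      ver := fun x => (⟨f x.i, f x.k, f x.j, f.monotone x.hik, f.monotone x.hkj⟩ : WVer Q)
      sq := fun x => (⟨f x.i, f x.k, f x.j, f x.l, f.monotone x.hik, f.monotone x.hkj,
        f.monotone x.hjl⟩ : WSq Q)
      isFunctor_hor₀ := ⟨fun _ => rfl, fun _ => rfl, fun _ => rfl, fun _ _ _ => rfl⟩
      isFunctor_ver₀ := ⟨fun _ => rfl, fun _ => rfl, fun _ => rfl, fun _ _ _ => rfl⟩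
      isFunctor_hor₁ := ⟨fun _ => rfl, fun _ => rfl, fun _ => rfl, fun _ _ _ => rfl⟩
      isFunctor_ver₁ := ⟨fun _ => rfl, fun _ => rfl, fun _ => rfl, fun _ _ _ => rfl⟩ }
  map_aug _ h := congrArg f h

/-- The simplicial set `S_n(D) = Hom(𝒲_n, D)` of augmented double functors. -/
def sDotObj (D : AugDblCat.{u}) : SSet.{u} where
  obj n := AugDblFunctor (wAug (Fin (n.unop.len + 1))) D
  map f := TypeCat.ofHom fun F => (wMap f.unop.toOrderHom).trans F

/-- The generalized Waldhausen construction, as a functor from augmented double categories to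
simplicial sets. -/
def sDot : AugDblCat.{u} ⥤ SSet.{u} where
  obj D := sDotObj D
  map G := { app := fun _ => TypeCat.ofHom fun F => F.trans G }


/-! ### Unital 2-Segal sets -/

/-- A triangulation of the regular `(n+1)`-gon with vertices `0, …, n`: a maximal set of pairwise
non-crossing segments between distinct vertices. The segment with endpoints `i < j` is recorded
as `seg i j`. (The sides of the polygon cross no segment, so they are in the set by
maximality.) -/
structure Triangulation (n : ℕ) where
  seg : Fin (n + 1) → Fin (n + 1) → Prop
  lt : ∀ i j, seg i j → i < j
  noncrossing : ∀ i j k l, seg i j → seg k l → ¬ (i < k ∧ k < j ∧ j < l)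
  maximal : ∀ i j, i < j →
    (∀ k l, seg k l → ¬ (i < k ∧ k < j ∧ j < l) ∧ ¬ (k < i ∧ i < l ∧ l < j)) → seg i j

/-- The map `⦋2⦌ ⟶ ⦋n⦌` with image `{i < j < k}` is a triangle of the triangulation if its
three sides are in the triangulation. -/
def Triangulation.IsTriangle {n : ℕ} (T : Triangulation n) (τ : ⦋2⦌ ⟶ ⦋n⦌) : Prop :=
  T.seg (τ.toOrderHom 0) (τ.toOrderHom 1) ∧ T.seg (τ.toOrderHom 1) (τ.toOrderHom 2) ∧
    T.seg (τ.toOrderHom 0) (τ.toOrderHom 2)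

/-- The iterated fibre product `X₂ ×_{X₁} ⋯ ×_{X₁} X₂` determined by a triangulation: families of
2-simplices indexed by its triangles which agree along common edges. -/
def Triangulation.Glue {n : ℕ} (T : Triangulation n) (X : SSet.{u}) : Type u :=
  {x : {τ : ⦋2⦌ ⟶ ⦋n⦌ // T.IsTriangle τ} → X _⦋2⦌ //
    ∀ t t' (a b : Fin 3), SimplexCategory.δ a ≫ t.1 = SimplexCategory.δ b ≫ t'.1 →
      X.δ a (x t) = X.δ b (x t')}

/-- The Segal map of a triangulation. -/
def Triangulation.segalMap {n : ℕ} (T : Triangulation n) (X : SSet.{u}) (x : X _⦋n⦌) :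
    T.Glue X :=
  ⟨fun t => X.map t.1.op x, fun t t' a b h => by
    change (X.map t.1.op ≫ X.map (SimplexCategory.δ a).op) x =
      (X.map t'.1.op ≫ X.map (SimplexCategory.δ b).op) x
    rw [← X.map_comp, ← X.map_comp, ← op_comp, ← op_comp, h]⟩

/-- 2-Segal sets. -/
def IsTwoSegal (X : SSet.{u}) : Prop :=
  ∀ n, 3 ≤ n → ∀ T : Triangulation n, Function.Bijective (T.segalMap X)

/-- Unitality: for all `n = m + 1 ≥ 2` and `0 ≤ i ≤ n - 1` the square formed by
`s_i : X_{n-1} → X_n`, `s_0 : X_0 → X_1` and the maps induced by `⦋0⦌ → ⦋n-1⦌, 0 ↦ i` and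
`⦋1⦌ → ⦋n⦌, 0 ↦ i, 1 ↦ i + 1` is a pullback. -/
def IsUnital (X : SSet.{u}) : Prop :=
  ∀ m : ℕ, 1 ≤ m → ∀ i : Fin (m + 1),
    IsPullback (X.map (SimplexCategory.const ⦋0⦌ ⦋m⦌ i).op) (X.σ i) (X.σ (0 : Fin 1))
      (X.map (SimplexCategory.mkOfSucc i).op)

/-- The property of a simplicial set of being a unital 2-Segal set. -/
def unitalTwoSegal : ObjectProperty SSet.{u} := fun X => IsTwoSegal X ∧ IsUnital X

/-- The property of a simplicial set of being a reduced unital 2-Segal set; reduced means that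
there is exactly one 0-simplex. -/
def redUnitalTwoSegal : ObjectProperty SSet.{u} := fun X =>
  unitalTwoSegal X ∧ Nonempty (Unique (X _⦋0⦌))

/-- The category of unital 2-Segal sets. -/
abbrev UnitalTwoSegalSet := unitalTwoSegal.{u}.FullSubcategory

/-- The category of reduced unital 2-Segal sets. -/
abbrev RedUnitalTwoSegalSet := redUnitalTwoSegal.{u}.FullSubcategory

/-- The inclusion of the reduced unital 2-Segal sets. -/
abbrev redInclusion : RedUnitalTwoSegalSet.{u} ⥤ UnitalTwoSegalSet.{u} :=
  ObjectProperty.ιOfLE fun _ h => h.1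


/-! ### The path construction -/

section Path

/-- The triangulation given by an explicit finite set of segments. -/
def Triangulation.ofFinset {n : ℕ} (S : Finset (Fin (n + 1) × Fin (n + 1)))
    (h₁ : ∀ p ∈ S, p.1 < p.2)
    (h₂ : ∀ p ∈ S, ∀ q ∈ S, ¬ (p.1 < q.1 ∧ q.1 < p.2 ∧ p.2 < q.2))
    (h₃ : ∀ i j : Fin (n + 1), i < j → (∀ q ∈ S, ¬ (i < q.1 ∧ q.1 < j ∧ j < q.2) ∧
      ¬ (q.1 < i ∧ i < q.2 ∧ q.2 < j)) → (i, j) ∈ S) : Triangulation n where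
  seg i j := (i, j) ∈ S
  lt _ _ h := h₁ _ h
  noncrossing _ _ _ _ h h' := h₂ _ h _ h'
  maximal i j h h' := h₃ i j h fun q hq => h' q.1 q.2 hq

variable {X : SSet.{u}}

/-- Gluing 2-simplices along a triangulation `S` whose triangles are listed as `τ 0, τ 1, …`
with vertices `V`, and whose common edges are listed in `E`. -/
theorem exists_glue (hX : IsTwoSegal X) {n m : ℕ} (hn : 3 ≤ n)
    {S : Finset (Fin (n + 1) × Fin (n + 1))} (h₁ : ∀ p ∈ S, p.1 < p.2)
    (h₂ : ∀ p ∈ S, ∀ q ∈ S, ¬ (p.1 < q.1 ∧ q.1 < p.2 ∧ p.2 < q.2))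
    (h₃ : ∀ i j : Fin (n + 1), i < j → (∀ q ∈ S, ¬ (i < q.1 ∧ q.1 < j ∧ j < q.2) ∧
      ¬ (q.1 < i ∧ i < q.2 ∧ q.2 < j)) → (i, j) ∈ S)
    (τ : Fin m → (⦋2⦌ ⟶ ⦋n⦌)) (V : Fin m → Fin 3 → Fin (n + 1))
    (hV : ∀ k i, (τ k).toOrderHom i = V k i)
    (hS : ∀ k, (V k 0, V k 1) ∈ S ∧ (V k 1, V k 2) ∈ S ∧ (V k 0, V k 2) ∈ S)
    (hT : ∀ a b c, (a, b) ∈ S → (b, c) ∈ S → (a, c) ∈ S →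
      ∃ k, a = V k 0 ∧ b = V k 1 ∧ c = V k 2)
    (hinj : ∀ k l, V k 0 = V l 0 → V k 1 = V l 1 → V k 2 = V l 2 → k = l)
    (E : List (Fin m × Fin 3 × Fin m × Fin 3))
    (hE : ∀ k l a b, V k (a.succAbove (0 : Fin 2)) = V l (b.succAbove (0 : Fin 2)) →
      V k (a.succAbove (1 : Fin 2)) = V l (b.succAbove (1 : Fin 2)) →
      (k = l ∧ a = b) ∨ (k, a, l, b) ∈ E ∨ (l, b, k, a) ∈ E) :
    (∀ x : Fin m → X _⦋2⦌, (∀ e ∈ E, X.δ e.2.1 (x e.1) = X.δ e.2.2.2 (x e.2.2.1)) →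
      ∃ w : X _⦋n⦌, ∀ k, X.map (τ k).op w = x k) ∧
    ∀ w w' : X _⦋n⦌, (∀ k, X.map (τ k).op w = X.map (τ k).op w') → w = w' := by
  let T := Triangulation.ofFinset S h₁ h₂ h₃
  have key : ∀ t : ⦋2⦌ ⟶ ⦋n⦌, T.IsTriangle t → ∃ k, t = τ k := by
    intro t ht
    obtain ⟨k, h0, h1, h2⟩ := hT _ _ _ ht.1 ht.2.1 ht.2.2
    refine ⟨k, ?_⟩
    ext i : 3
    rw [hV]
    change Fin 3 at i
    fin_cases i
    exacts [h0, h1, h2]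
  have hτ : ∀ k, T.IsTriangle (τ k) := fun k => by
    unfold Triangulation.IsTriangle
    rw [hV k, hV k, hV k]
    exact hS k
  constructor
  · intro x hx
    choose c hc using key
    have hc' : ∀ k, c (τ k) (hτ k) = k := fun k => by
      have h := hc (τ k) (hτ k)
      apply hinj <;> rw [← hV, ← hV, ← h]
    obtain ⟨w, hw⟩ := (hX n hn T).2 ⟨fun t => x (c t.1 t.2), fun t t' a b h => by
      rw [hc t.1 t.2, hc t'.1 t'.2] at h
      have e : ∀ v : Fin 2, V (c t.1 t.2) (a.succAbove v) = V (c t'.1 t'.2) (b.succAbove v) := by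
        intro v
        rw [← hV, ← hV]
        exact congrArg (fun f => SimplexCategory.Hom.toOrderHom f v) h
      rcases hE _ _ a b (e 0) (e 1) with ⟨h', rfl⟩ | h' | h'
      · exact congrArg (fun k => X.δ a (x k)) h'
      · exact hx _ h'
      · exact (hx _ h').symm⟩
    refine ⟨w, fun k => ?_⟩
    have := congrFun (congrArg Subtype.val hw) ⟨τ k, hτ k⟩
    exact this.trans (congrArg x (hc' k))
  · intro w w' h
    apply (hX n hn T).1
    apply Subtype.ext
    funext t
    obtain ⟨k, hk⟩ := key t.1 t.2
    change X.map t.1.op w = X.map t.1.op w'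
    rw [hk]
    exact h k

theorem map_δδ {n : ℕ} (a : Fin (n + 2)) (b : Fin (n + 3)) (w : X _⦋n + 2⦌) :
    X.map (SimplexCategory.δ a ≫ SimplexCategory.δ b).op w = X.δ a (X.δ b w) := by
  rw [op_comp, X.map_comp]; rfl

/-- `(d₃, d₁) : X₃ → X₂ ×_{X₁} X₂` is a bijection. -/
theorem glue31 (hX : IsTwoSegal X) :
    (∀ x y : X _⦋2⦌, X.δ 1 x = X.δ 2 y → ∃ w : X _⦋3⦌, X.δ 3 w = x ∧ X.δ 1 w = y) ∧
    ∀ w w' : X _⦋3⦌, X.δ 3 w = X.δ 3 w' → X.δ 1 w = X.δ 1 w' → w = w' := by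
  have := exists_glue hX (n := 3) (m := 2) le_rfl (S := {(0,1), (1,2), (2,3), (0,3), (0,2)})
    (h₁ := by decide) (h₂ := by decide) (h₃ := by decide)
    ![SimplexCategory.δ 3, SimplexCategory.δ 1] ![![0, 1, 2], ![0, 2, 3]]
    (by decide) (by decide) (by decide) (by decide) [(0, 1, 1, 2)] (by decide)
  constructor
  · intro x y h
    obtain ⟨w, hw⟩ := this.1 ![x, y] (by simpa using h)
    exact ⟨w, hw 0, hw 1⟩
  · intro w w' h h'
    exact this.2 w w' (Fin.forall_fin_two.2 ⟨h, h'⟩)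

/-- `(d₂, d₀) : X₃ → X₂ ×_{X₁} X₂` is a bijection. -/
theorem glue20 (hX : IsTwoSegal X) :
    (∀ x y : X _⦋2⦌, X.δ 0 x = X.δ 1 y → ∃ w : X _⦋3⦌, X.δ 2 w = x ∧ X.δ 0 w = y) ∧
    ∀ w w' : X _⦋3⦌, X.δ 2 w = X.δ 2 w' → X.δ 0 w = X.δ 0 w' → w = w' := by
  have := exists_glue hX (n := 3) (m := 2) le_rfl (S := {(0,1), (1,2), (2,3), (0,3), (1,3)})
    (h₁ := by decide) (h₂ := by decide) (h₃ := by decide)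
    ![SimplexCategory.δ 2, SimplexCategory.δ 0] ![![0, 1, 3], ![1, 2, 3]]
    (by decide) (by decide) (by decide) (by decide) [(0, 0, 1, 1)] (by decide)
  constructor
  · intro x y h
    obtain ⟨w, hw⟩ := this.1 ![x, y] (by simpa using h)
    exact ⟨w, hw 0, hw 1⟩
  · intro w w' h h'
    exact this.2 w w' (Fin.forall_fin_two.2 ⟨h, h'⟩)

theorem glueFan0 (hX : IsTwoSegal X) (x y z : X _⦋2⦌) (h : X.δ 1 x = X.δ 2 y)
    (h' : X.δ 1 y = X.δ 2 z) :
    ∃ w : X _⦋4⦌, X.δ 3 (X.δ 4 w) = x ∧ X.δ 1 (X.δ 4 w) = y ∧ X.δ 1 (X.δ 2 w) = z := by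
  have := exists_glue hX (n := 4) (m := 3) (by decide)
    (S := {(0,1), (1,2), (2,3), (3,4), (0,4), (0,2), (0,3)})
    (h₁ := by decide) (h₂ := by decide) (h₃ := by decide)
    ![SimplexCategory.δ 3 ≫ SimplexCategory.δ 4, SimplexCategory.δ 1 ≫ SimplexCategory.δ 4,
      SimplexCategory.δ 1 ≫ SimplexCategory.δ 2] ![![0, 1, 2], ![0, 2, 3], ![0, 3, 4]]
    (by decide) (by decide) (by decide) (by decide) [(0, 1, 1, 2), (1, 1, 2, 2)] (by decide)
  obtain ⟨w, hw⟩ := this.1 ![x, y, z] (by simpa using ⟨h, h'⟩)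
  exact ⟨w, (map_δδ _ _ w).symm.trans (hw 0), (map_δδ _ _ w).symm.trans (hw 1),
    (map_δδ _ _ w).symm.trans (hw 2)⟩

theorem glueFan4 (hX : IsTwoSegal X) (x y z : X _⦋2⦌) (h : X.δ 0 x = X.δ 1 y)
    (h' : X.δ 0 y = X.δ 1 z) :
    ∃ w : X _⦋4⦌, X.δ 2 (X.δ 3 w) = x ∧ X.δ 0 (X.δ 3 w) = y ∧ X.δ 0 (X.δ 0 w) = z := by
  have := exists_glue hX (n := 4) (m := 3) (by decide)
    (S := {(0,1), (1,2), (2,3), (3,4), (0,4), (1,4), (2,4)})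
    (h₁ := by decide) (h₂ := by decide) (h₃ := by decide)
    ![SimplexCategory.δ 2 ≫ SimplexCategory.δ 3, SimplexCategory.δ 0 ≫ SimplexCategory.δ 3,
      SimplexCategory.δ 0 ≫ SimplexCategory.δ 0] ![![0, 1, 4], ![1, 2, 4], ![2, 3, 4]]
    (by decide) (by decide) (by decide) (by decide) [(0, 0, 1, 1), (1, 0, 2, 1)] (by decide)
  obtain ⟨w, hw⟩ := this.1 ![x, y, z] (by simpa using ⟨h, h'⟩)
  exact ⟨w, (map_δδ _ _ w).symm.trans (hw 0), (map_δδ _ _ w).symm.trans (hw 1),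
    (map_δδ _ _ w).symm.trans (hw 2)⟩

/-- The simplicial identities, with the underlying identity of maps checked by evaluation. -/
theorem face_face {n : ℕ} {a c : Fin (n + 2)} {b d : Fin (n + 3)} {w : X _⦋n + 2⦌}
    (h : ∀ v : Fin (n + 1), b.succAbove (a.succAbove v) = d.succAbove (c.succAbove v) := by
      decide) : X.δ a (X.δ b w) = X.δ c (X.δ d w) := by
  rw [← map_δδ, ← map_δδ]
  congr 4
  ext v : 3
  exact h v

theorem face_deg {n : ℕ} {a : Fin (n + 2)} {b : Fin (n + 1)} {w : X _⦋n⦌}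
    (h : ∀ v : Fin (n + 1), b.predAbove (a.succAbove v) = v := by decide) :
    X.δ a (X.σ b w) = w := by
  change (X.map _ ≫ X.map _) w = w
  rw [← X.map_comp, ← op_comp]
  have : SimplexCategory.δ a ≫ SimplexCategory.σ b = 𝟙 _ := by
    ext v : 3
    exact h v
  rw [this]
  simp

theorem face_deg' {n : ℕ} {a : Fin (n + 3)} {b : Fin (n + 2)} {c : Fin (n + 1)} {d : Fin (n + 2)}
    {w : X _⦋n + 1⦌}
    (h : ∀ v : Fin (n + 2), b.predAbove (a.succAbove v) = d.succAbove (c.predAbove v) := by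
      decide) :
    X.δ a (X.σ b w) = X.σ c (X.δ d w) := by
  change (X.map _ ≫ X.map _) w = (X.map _ ≫ X.map _) w
  rw [← X.map_comp, ← op_comp, ← X.map_comp, ← op_comp]
  congr 4
  ext v : 3
  exact h v

theorem deg_deg {n : ℕ} {a c : Fin (n + 2)} {b d : Fin (n + 1)} {w : X _⦋n⦌}
    (h : ∀ v : Fin (n + 3), b.predAbove (a.predAbove v) = d.predAbove (c.predAbove v) := by
      decide) :
    X.σ a (X.σ b w) = X.σ c (X.σ d w) := by
  change (X.map _ ≫ X.map _) w = (X.map _ ≫ X.map _) w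
  rw [← X.map_comp, ← op_comp, ← X.map_comp, ← op_comp]
  congr 4
  ext v : 3
  exact h v

/-- `(d₄, d₂) : X₄ → X₃ ×_{X₂} X₃` is surjective. -/
theorem glue42 (hX : IsTwoSegal X) (α β : X _⦋3⦌) (h : X.δ 2 α = X.δ 3 β) :
    ∃ w : X _⦋4⦌, X.δ 4 w = α ∧ X.δ 2 w = β := by
  have := exists_glue hX (n := 4) (m := 3) (by decide)
    (S := {(0,1), (1,2), (2,3), (3,4), (0,4), (0,3), (1,3)})
    (h₁ := by decide) (h₂ := by decide) (h₃ := by decide)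
    ![SimplexCategory.δ 2 ≫ SimplexCategory.δ 4, SimplexCategory.δ 0 ≫ SimplexCategory.δ 4,
      SimplexCategory.δ 1 ≫ SimplexCategory.δ 2] ![![0, 1, 3], ![1, 2, 3], ![0, 3, 4]]
    (by decide) (by decide) (by decide) (by decide) [(0, 0, 1, 1), (0, 1, 2, 2)] (by decide)
  obtain ⟨w, hw⟩ := this.1 ![X.δ 2 α, X.δ 0 α, X.δ 1 β] (by
    have e₁ : X.δ 0 (X.δ 2 α) = X.δ 1 (X.δ 0 α) := face_face
    have e₂ : X.δ 1 (X.δ 2 α) = X.δ 2 (X.δ 1 β) := by rw [h]; exact face_face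
    simpa using ⟨e₁, e₂⟩)
  have h0 : X.δ 2 (X.δ 4 w) = X.δ 2 α := (map_δδ _ _ w).symm.trans (hw 0)
  have h1 : X.δ 0 (X.δ 4 w) = X.δ 0 α := (map_δδ _ _ w).symm.trans (hw 1)
  have h2 : X.δ 1 (X.δ 2 w) = X.δ 1 β := (map_δδ _ _ w).symm.trans (hw 2)
  exact ⟨w, (glue20 hX).2 _ _ h0 h1, (glue31 hX).2 _ _ (Eq.trans face_face (h0.trans h)) h2⟩

/-- `(d₂, d₀) : X₄ → X₃ ×_{X₂} X₃` is surjective. -/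
theorem glue20' (hX : IsTwoSegal X) (α β : X _⦋3⦌) (h : X.δ 0 α = X.δ 1 β) :
    ∃ w : X _⦋4⦌, X.δ 2 w = α ∧ X.δ 0 w = β := by
  have := exists_glue hX (n := 4) (m := 3) (by decide)
    (S := {(0,1), (1,2), (2,3), (3,4), (0,4), (1,3), (1,4)})
    (h₁ := by decide) (h₂ := by decide) (h₃ := by decide)
    ![SimplexCategory.δ 0 ≫ SimplexCategory.δ 2, SimplexCategory.δ 0 ≫ SimplexCategory.δ 4,
      SimplexCategory.δ 2 ≫ SimplexCategory.δ 2] ![![1, 3, 4], ![1, 2, 3], ![0, 1, 4]]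
    (by decide) (by decide) (by decide) (by decide) [(0, 2, 1, 1), (0, 1, 2, 0)] (by decide)
  obtain ⟨w, hw⟩ := this.1 ![X.δ 0 α, X.δ 3 β, X.δ 2 α] (by
    have e₁ : X.δ 2 (X.δ 0 α) = X.δ 1 (X.δ 3 β) := by rw [h]; exact face_face
    have e₂ : X.δ 1 (X.δ 0 α) = X.δ 0 (X.δ 2 α) := face_face
    simpa using ⟨e₁, e₂⟩)
  have h0 : X.δ 0 (X.δ 2 w) = X.δ 0 α := (map_δδ _ _ w).symm.trans (hw 0)
  have h1 : X.δ 0 (X.δ 4 w) = X.δ 3 β := (map_δδ _ _ w).symm.trans (hw 1)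
  have h2 : X.δ 2 (X.δ 2 w) = X.δ 2 α := (map_δδ _ _ w).symm.trans (hw 2)
  exact ⟨w, (glue20 hX).2 _ _ h2 h0,
    (glue31 hX).2 _ _ (Eq.trans face_face h1) (Eq.trans face_face (h0.trans h))⟩

variable (hX : IsTwoSegal X)

/-- Composition of horizontal morphisms,
`X₂ ×_{X₁} X₂ ≅ X₃ → X₂`, where the bijection is `(d₃, d₁)⁻¹` and the map is `d₂`. -/
noncomputable def horComp (f g : X _⦋2⦌) (h : X.δ 1 f = X.δ 2 g) : X _⦋2⦌ :=
  X.δ 2 ((glue31 hX).1 f g h).choose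

theorem horComp_eq {f g : X _⦋2⦌} (h : X.δ 1 f = X.δ 2 g) (y : X _⦋3⦌) (h₁ : X.δ 3 y = f)
    (h₂ : X.δ 1 y = g) : horComp hX f g h = X.δ 2 y := by
  have e := ((glue31 hX).1 f g h).choose_spec
  exact congrArg (X.δ 2) ((glue31 hX).2 _ _ (e.1.trans h₁.symm) (e.2.trans h₂.symm))

/-- Composition of vertical morphisms,
`X₂ ×_{X₁} X₂ ≅ X₃ → X₂`, where the bijection is `(d₂, d₀)⁻¹` and the map is `d₁`. -/
noncomputable def verComp (f g : X _⦋2⦌) (h : X.δ 0 f = X.δ 1 g) : X _⦋2⦌ :=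
  X.δ 1 ((glue20 hX).1 f g h).choose

theorem verComp_eq {f g : X _⦋2⦌} (h : X.δ 0 f = X.δ 1 g) (y : X _⦋3⦌) (h₁ : X.δ 2 y = f)
    (h₂ : X.δ 0 y = g) : verComp hX f g h = X.δ 1 y := by
  have e := ((glue20 hX).1 f g h).choose_spec
  exact congrArg (X.δ 1) ((glue20 hX).2 _ _ (e.1.trans h₁.symm) (e.2.trans h₂.symm))

/-- Horizontal composition of squares,
`X₃ ×_{X₂} X₃ ≅ X₄ → X₃`, where the bijection is `(d₄, d₂)⁻¹` and the map is `d₃`. -/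
noncomputable def sqHorComp (α β : X _⦋3⦌) (h : X.δ 2 α = X.δ 3 β) : X _⦋3⦌ :=
  X.δ 3 (glue42 hX α β h).choose

/-- Vertical composition of squares,
`X₃ ×_{X₂} X₃ ≅ X₄ → X₃`, where the bijection is `(d₂, d₀)⁻¹` and the map is `d₁`. -/
noncomputable def sqVerComp (α β : X _⦋3⦌) (h : X.δ 0 α = X.δ 1 β) : X _⦋3⦌ :=
  X.δ 1 (glue20' hX α β h).choose

theorem sqHorComp_faces (α β : X _⦋3⦌) (h : X.δ 2 α = X.δ 3 β) :
    X.δ 3 (sqHorComp hX α β h) = X.δ 3 α ∧ X.δ 2 (sqHorComp hX α β h) = X.δ 2 β ∧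
    (∀ e, X.δ 1 (sqHorComp hX α β h) = horComp hX (X.δ 1 α) (X.δ 1 β) e) ∧
    (∀ e, X.δ 0 (sqHorComp hX α β h) = horComp hX (X.δ 0 α) (X.δ 0 β) e) := by
  unfold sqHorComp
  obtain ⟨h₁, h₂⟩ := (glue42 hX α β h).choose_spec
  generalize (glue42 hX α β h).choose = w at h₁ h₂
  subst h₁ h₂
  refine ⟨face_face, face_face, fun e => ?_, fun e => ?_⟩
  · rw [horComp_eq hX e (X.δ 1 w) face_face face_face]
    exact face_face
  · rw [horComp_eq hX e (X.δ 0 w) face_face face_face]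
    exact face_face

theorem sqVerComp_faces (α β : X _⦋3⦌) (h : X.δ 0 α = X.δ 1 β) :
    X.δ 1 (sqVerComp hX α β h) = X.δ 1 α ∧ X.δ 0 (sqVerComp hX α β h) = X.δ 0 β ∧
    (∀ e, X.δ 3 (sqVerComp hX α β h) = verComp hX (X.δ 3 α) (X.δ 3 β) e) ∧
    (∀ e, X.δ 2 (sqVerComp hX α β h) = verComp hX (X.δ 2 α) (X.δ 2 β) e) := by
  unfold sqVerComp
  obtain ⟨h₁, h₂⟩ := (glue20' hX α β h).choose_spec
  generalize (glue20' hX α β h).choose = w at h₁ h₂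
  subst h₁ h₂
  refine ⟨face_face, face_face, fun e => ?_, fun e => ?_⟩
  · rw [verComp_eq hX e (X.δ 4 w) face_face face_face]
    exact face_face
  · rw [verComp_eq hX e (X.δ 3 w) face_face face_face]
    exact face_face

/-- The horizontal category of `𝒫 X`. -/
noncomputable def pathHor₀ : CatOn (X _⦋1⦌) (X _⦋2⦌) where
  dom f := X.δ 2 f
  cod f := X.δ 1 f
  id x := X.σ 1 x
  comp := horComp hX
  dom_id _ := face_deg
  cod_id _ := face_deg
  dom_comp f g h := by
    obtain ⟨h₁, _⟩ := ((glue31 hX).1 f g h).choose_spec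
    exact Eq.trans face_face (congrArg (X.δ 2) h₁)
  cod_comp f g h := by
    obtain ⟨_, h₂⟩ := ((glue31 hX).1 f g h).choose_spec
    exact Eq.trans face_face (congrArg (X.δ 1) h₂)
  id_comp f := by
    rw [horComp_eq hX _ (X.σ 1 f) face_deg' face_deg]
    exact face_deg
  comp_id f := by
    rw [horComp_eq hX _ (X.σ 2 f) face_deg face_deg']
    exact face_deg
  assoc f g k h₁ h₂ := by
    obtain ⟨w, rfl, rfl, rfl⟩ := glueFan0 hX f g k h₁ h₂
    rw [horComp_eq hX _ (X.δ 2 w) (Eq.trans face_face (horComp_eq hX h₁ (X.δ 4 w) rfl rfl).symm) rfl,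
      horComp_eq hX _ (X.δ 3 w) face_face
        (Eq.trans face_face (horComp_eq hX h₂ (X.δ 1 w) face_face face_face).symm)]
    exact face_face

/-- The vertical category of `𝒫 X`. -/
noncomputable def pathVer₀ : CatOn (X _⦋1⦌) (X _⦋2⦌) where
  dom f := X.δ 1 f
  cod f := X.δ 0 f
  id x := X.σ 0 x
  comp := verComp hX
  dom_id _ := face_deg
  cod_id _ := face_deg
  dom_comp f g h := by
    obtain ⟨h₁, _⟩ := ((glue20 hX).1 f g h).choose_spec
    exact Eq.trans face_face (congrArg (X.δ 1) h₁)
  cod_comp f g h := by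
    obtain ⟨_, h₂⟩ := ((glue20 hX).1 f g h).choose_spec
    exact Eq.trans face_face (congrArg (X.δ 0) h₂)
  id_comp f := by
    rw [verComp_eq hX _ (X.σ 0 f) face_deg' face_deg]
    exact face_deg
  comp_id f := by
    rw [verComp_eq hX _ (X.σ 1 f) face_deg face_deg']
    exact face_deg
  assoc f g k h₁ h₂ := by
    obtain ⟨w, rfl, rfl, rfl⟩ := glueFan4 hX f g k h₁ h₂
    rw [verComp_eq hX _ (X.δ 1 w) (Eq.trans face_face (verComp_eq hX h₁ (X.δ 3 w) rfl rfl).symm)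
        face_face,
      verComp_eq hX _ (X.δ 2 w) face_face
        (Eq.trans face_face (verComp_eq hX h₂ (X.δ 0 w) face_face rfl).symm)]
    exact face_face

theorem horComp_congr {f g f' g' : X _⦋2⦌} (hf : f = f') (hg : g = g') (h : X.δ 1 f = X.δ 2 g) :
    horComp hX f g h = horComp hX f' g' (by rw [← hf, ← hg]; exact h) := by
  subst hf hg; rfl

theorem verComp_congr {f g f' g' : X _⦋2⦌} (hf : f = f') (hg : g = g') (h : X.δ 0 f = X.δ 1 g) :
    verComp hX f g h = verComp hX f' g' (by rw [← hf, ← hg]; exact h) := by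
  subst hf hg; rfl

theorem hor_aux {α β : X _⦋3⦌} (h : X.δ 2 α = X.δ 3 β) :
    X.δ 1 (X.δ 1 α) = X.δ 2 (X.δ 1 β) ∧ X.δ 1 (X.δ 0 α) = X.δ 2 (X.δ 0 β) :=
  ⟨Eq.trans face_face ((congrArg (X.δ 1) h).trans face_face),
    Eq.trans face_face ((congrArg (X.δ 0) h).trans face_face)⟩

theorem ver_aux {α β : X _⦋3⦌} (h : X.δ 0 α = X.δ 1 β) :
    X.δ 0 (X.δ 3 α) = X.δ 1 (X.δ 3 β) ∧ X.δ 0 (X.δ 2 α) = X.δ 1 (X.δ 2 β) :=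
  ⟨Eq.trans face_face ((congrArg (X.δ 2) h).trans face_face),
    Eq.trans face_face ((congrArg (X.δ 1) h).trans face_face)⟩

/-- Horizontal composition of squares of `𝒫 X`. -/
noncomputable def pathHor₁ : CatOn (X _⦋2⦌) (X _⦋3⦌) where
  dom α := X.δ 3 α
  cod α := X.δ 2 α
  id f := X.σ 2 f
  comp := sqHorComp hX
  dom_id _ := face_deg
  cod_id _ := face_deg
  dom_comp α β h := (sqHorComp_faces hX α β h).1
  cod_comp α β h := (sqHorComp_faces hX α β h).2.1
  id_comp α := by
    refine (glue31 hX).2 _ _ ((sqHorComp_faces hX _ _ _).1.trans face_deg) ?_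
    have h : X.δ 2 (X.σ 2 (X.δ 3 α)) = X.δ 3 α := face_deg
    refine ((sqHorComp_faces hX _ _ _).2.2.1 (hor_aux h).1).trans ?_
    refine Eq.trans ?_ ((pathHor₀ hX).id_comp (X.δ 1 α))
    exact horComp_congr hX ((face_deg' (c := 1) (d := 1)).trans (congrArg (X.σ 1) face_face)) rfl _
  comp_id α := by
    refine (glue31 hX).2 _ _ (sqHorComp_faces hX _ _ _).1 ?_
    have h : X.δ 2 α = X.δ 3 (X.σ 2 (X.δ 2 α)) := (Eq.symm face_deg)
    refine ((sqHorComp_faces hX _ _ _).2.2.1 (hor_aux h).1).trans ?_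
    refine Eq.trans ?_ ((pathHor₀ hX).comp_id (X.δ 1 α))
    exact horComp_congr hX rfl ((face_deg' (c := 1) (d := 1)).trans (congrArg (X.σ 1) face_face)) _
  assoc α β γ h₁ h₂ := by
    have e₁ := sqHorComp_faces hX α β h₁
    have e₂ := sqHorComp_faces hX β γ h₂
    have h₃ := e₁.2.1.trans h₂
    have h₄ := h₁.trans e₂.1.symm
    have e₃ := sqHorComp_faces hX _ γ h₃
    have e₄ := sqHorComp_faces hX α _ h₄
    refine (glue31 hX).2 _ _ ((e₃.1.trans e₁.1).trans e₄.1.symm) ?_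
    refine (e₃.2.2.1 (hor_aux h₃).1).trans (Eq.trans ?_ (e₄.2.2.1 (hor_aux h₄).1).symm)
    exact (horComp_congr hX (e₁.2.2.1 (hor_aux h₁).1) rfl (hor_aux h₃).1).trans
      (((pathHor₀ hX).assoc _ _ _ (hor_aux h₁).1 (hor_aux h₂).1).trans
      (horComp_congr hX rfl (e₂.2.2.1 (hor_aux h₂).1) (hor_aux h₄).1).symm)

/-- Vertical composition of squares of `𝒫 X`. -/
noncomputable def pathVer₁ : CatOn (X _⦋2⦌) (X _⦋3⦌) where
  dom α := X.δ 1 α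
  cod α := X.δ 0 α
  id f := X.σ 0 f
  comp := sqVerComp hX
  dom_id _ := face_deg
  cod_id _ := face_deg
  dom_comp α β h := (sqVerComp_faces hX α β h).1
  cod_comp α β h := (sqVerComp_faces hX α β h).2.1
  id_comp α := by
    refine (glue31 hX).2 _ _ ?_ ((sqVerComp_faces hX _ _ _).1.trans face_deg)
    have h : X.δ 0 (X.σ 0 (X.δ 1 α)) = X.δ 1 α := face_deg
    refine ((sqVerComp_faces hX _ _ _).2.2.1 (ver_aux h).1).trans ?_
    refine Eq.trans ?_ ((pathVer₀ hX).id_comp (X.δ 3 α))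
    exact verComp_congr hX ((face_deg' (c := 0) (d := 2)).trans (congrArg (X.σ 0) face_face)) rfl _
  comp_id α := by
    refine (glue31 hX).2 _ _ ?_ (sqVerComp_faces hX _ _ _).1
    have h : X.δ 0 α = X.δ 1 (X.σ 0 (X.δ 0 α)) := (Eq.symm face_deg)
    refine ((sqVerComp_faces hX _ _ _).2.2.1 (ver_aux h).1).trans ?_
    refine Eq.trans ?_ ((pathVer₀ hX).comp_id (X.δ 3 α))
    exact verComp_congr hX rfl ((face_deg' (c := 0) (d := 2)).trans (congrArg (X.σ 0) face_face)) _
  assoc α β γ h₁ h₂ := by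
    have e₁ := sqVerComp_faces hX α β h₁
    have e₂ := sqVerComp_faces hX β γ h₂
    have h₃ := e₁.2.1.trans h₂
    have h₄ := h₁.trans e₂.1.symm
    have e₃ := sqVerComp_faces hX _ γ h₃
    have e₄ := sqVerComp_faces hX α _ h₄
    refine (glue31 hX).2 _ _ ?_ ((e₃.1.trans e₁.1).trans e₄.1.symm)
    refine (e₃.2.2.1 (ver_aux h₃).1).trans (Eq.trans ?_ (e₄.2.2.1 (ver_aux h₄).1).symm)
    exact (verComp_congr hX (e₁.2.2.1 (ver_aux h₁).1) rfl (ver_aux h₃).1).trans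
      (((pathVer₀ hX).assoc _ _ _ (ver_aux h₁).1 (ver_aux h₂).1).trans
      (verComp_congr hX rfl (e₂.2.2.1 (ver_aux h₂).1) (ver_aux h₄).1).symm)

/-- The double category `𝒫 X` of a 2-Segal set. -/
noncomputable def pathDbl : DblCat.{u} where
  Ob := X _⦋1⦌
  Hor := X _⦋2⦌
  Ver := X _⦋2⦌
  Sq := X _⦋3⦌
  hor₀ := pathHor₀ hX
  ver₀ := pathVer₀ hX
  hor₁ := pathHor₁ hX
  ver₁ := pathVer₁ hX
  dom_functor := ⟨fun _ => face_face, fun _ => face_face, fun _ => face_deg',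
    fun α β h => (sqVerComp_faces hX α β h).2.2.1 (ver_aux h).1⟩
  cod_functor := ⟨fun _ => face_face, fun _ => face_face, fun _ => face_deg',
    fun α β h => (sqVerComp_faces hX α β h).2.2.2 (ver_aux h).2⟩
  id_functor := by
    refine ⟨fun _ => face_deg', fun _ => face_deg', fun _ => deg_deg, fun f g h => ?_⟩
    have h' : X.δ 0 (X.σ 2 f) = X.δ 1 (X.σ 2 g) :=
      Eq.trans face_deg' ((congrArg (X.σ 1) h).trans (Eq.symm face_deg'))
    refine (glue31 hX).2 _ _ ?_ ?_
    · refine Eq.trans ?_ ((sqVerComp_faces hX _ _ h').2.2.1 (ver_aux h').1).symm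
      exact Eq.trans face_deg (verComp_congr hX face_deg face_deg (ver_aux h').1).symm
    · refine Eq.trans ?_ (sqVerComp_faces hX _ _ h').1.symm
      exact Eq.trans face_deg' ((congrArg (X.σ 1) ((pathVer₀ hX).dom_comp f g h)).trans
        (Eq.symm face_deg'))
  comp_dom α β h := (sqHorComp_faces hX α β h).2.2.1 (hor_aux h).1
  comp_cod α β h := (sqHorComp_faces hX α β h).2.2.2 (hor_aux h).2
  comp_id f g h := by
    have h' : X.δ 2 (X.σ 0 f) = X.δ 3 (X.σ 0 g) :=
      Eq.trans face_deg' ((congrArg (X.σ 0) h).trans (Eq.symm face_deg'))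
    refine (glue31 hX).2 _ _ ?_ ?_
    · refine Eq.trans (sqHorComp_faces hX _ _ h').1 ?_
      exact Eq.trans face_deg' ((congrArg (X.σ 0) ((pathHor₀ hX).dom_comp f g h).symm).trans
        (Eq.symm face_deg'))
    · refine Eq.trans ((sqHorComp_faces hX _ _ h').2.2.1 (hor_aux h').1) ?_
      exact (horComp_congr hX face_deg face_deg _).trans (Eq.symm face_deg)
  interchange α β γ δ hαβ hγδ hαγ hβδ h₁ h₂ := by
    have e₁ := sqHorComp_faces hX _ _ h₁
    have e₂ := sqVerComp_faces hX _ _ h₂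
    have e₃ := sqVerComp_faces hX _ _ hαγ
    have e₄ := sqVerComp_faces hX _ _ hβδ
    have e₅ := sqHorComp_faces hX _ _ hαβ
    have e₆ := sqHorComp_faces hX _ _ hγδ
    refine (glue31 hX).2 _ _ ?_ ?_
    · refine e₁.1.trans ((e₃.2.2.1 (ver_aux hαγ).1).trans ?_)
      refine Eq.trans ?_ (e₂.2.2.1 (ver_aux h₂).1).symm
      exact verComp_congr hX e₅.1.symm e₆.1.symm _
    · refine (e₁.2.2.1 (hor_aux h₁).1).trans ?_
      refine Eq.trans ?_ (e₂.1.trans (e₅.2.2.1 (hor_aux hαβ).1)).symm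
      exact horComp_congr hX e₃.1 e₄.1 _

theorem pathDbl_isStable : (pathDbl hX).IsStable where
  span := by
    refine ⟨fun (α β : X _⦋3⦌) h => ?_, fun p => ?_⟩
    · have := congrArg Subtype.val h
      exact (glue31 hX).2 α β (congrArg Prod.fst this) (congrArg Prod.snd this)
    · obtain ⟨⟨e, m⟩, h⟩ := p
      change X _⦋2⦌ at e m
      obtain ⟨w, h₁, h₂⟩ := (glue31 hX).1 e m h
      exact ⟨(w : X _⦋3⦌), Subtype.ext (Prod.ext h₁ h₂)⟩
  cospan := by
    refine ⟨fun (α β : X _⦋3⦌) h => ?_, fun p => ?_⟩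
    · have := congrArg Subtype.val h
      exact (glue20 hX).2 α β (congrArg Prod.fst this) (congrArg Prod.snd this)
    · obtain ⟨⟨e, m⟩, h⟩ := p
      change X _⦋2⦌ at e m
      obtain ⟨w, h₁, h₂⟩ := (glue20 hX).1 e m h
      exact ⟨(w : X _⦋3⦌), Subtype.ext (Prod.ext h₁ h₂)⟩

variable (X) in
/-- The augmentation `s₀ X₀ ⊆ X₁` of `𝒫 X`. -/
def pathAug : Set (X _⦋1⦌) := Set.range fun a : X _⦋0⦌ => X.σ (0 : Fin 1) a

theorem pathDbl_isAugmentation (hU : IsUnital X) :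
    (pathDbl hX).IsAugmentation (pathAug X) where
  hor (d : X _⦋1⦌) := by
    refine ⟨(X.σ (0 : Fin 2) d : X _⦋2⦌), ⟨face_deg, X.δ (1 : Fin 2) d, Eq.symm face_deg'⟩, ?_⟩
    rintro (f : X _⦋2⦌) ⟨rfl, a, ha⟩
    obtain ⟨y, -, hy⟩ := Limits.Types.exists_of_isPullback (hU 1 le_rfl 0) a f (by
      rw [show SimplexCategory.mkOfSucc (0 : Fin 2) = SimplexCategory.δ 2 from
        SimplexCategory.mkOfSucc_zero_eq_δ]
      exact ha)
    have e : X.δ (1 : Fin 3) f = y := by rw [← hy]; exact face_deg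
    exact hy.symm.trans (congrArg (X.σ (0 : Fin 2)) e.symm)
  ver (d : X _⦋1⦌) := by
    refine ⟨(X.σ (1 : Fin 2) d : X _⦋2⦌), ⟨face_deg, X.δ (0 : Fin 2) d, Eq.symm face_deg'⟩, ?_⟩
    rintro (f : X _⦋2⦌) ⟨rfl, a, ha⟩
    obtain ⟨y, -, hy⟩ := Limits.Types.exists_of_isPullback (hU 1 le_rfl 1) a f (by
      rw [show SimplexCategory.mkOfSucc (1 : Fin 2) = SimplexCategory.δ 0 from
        SimplexCategory.mkOfSucc_one_eq_δ]
      exact ha)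
    have e : X.δ (1 : Fin 3) f = y := by rw [← hy]; exact face_deg
    exact hy.symm.trans (congrArg (X.σ (1 : Fin 2)) e.symm)

end Path

section PathFunctor

variable {X Y : SSet.{u}}

theorem naturality_δ (f : X ⟶ Y) {n : ℕ} (i : Fin (n + 2)) (x : X _⦋n + 1⦌) :
    Y.δ i (f.app (op ⦋n + 1⦌) x) = f.app (op ⦋n⦌) (X.δ i x) :=
  (SSet.δ_naturality_apply f i x).symm

theorem map_adj (f : X ⟶ Y) {n : ℕ} {i j : Fin (n + 2)} {a b : X _⦋n + 1⦌}
    (h : X.δ i a = X.δ j b) :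
    Y.δ i (f.app (op ⦋n + 1⦌) a) = Y.δ j (f.app (op ⦋n + 1⦌) b) := by
  rw [naturality_δ, naturality_δ, h]

theorem map_horComp (hX : IsTwoSegal X) (hY : IsTwoSegal Y) (f : X ⟶ Y) (a b : X _⦋2⦌)
    (h : X.δ 1 a = X.δ 2 b)
    (e : Y.δ 1 (f.app (op ⦋2⦌) a : Y _⦋2⦌) = Y.δ 2 (f.app (op ⦋2⦌) b : Y _⦋2⦌)) :
    f.app (op ⦋2⦌) (horComp hX a b h) = horComp hY (f.app (op ⦋2⦌) a) (f.app (op ⦋2⦌) b) e := by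
  obtain ⟨w, rfl, rfl⟩ := (glue31 hX).1 a b h
  rw [horComp_eq hX h w rfl rfl,
    horComp_eq hY e (f.app (op ⦋3⦌) w) (naturality_δ f _ _) (naturality_δ f _ _)]
  exact (naturality_δ f _ _).symm

theorem map_verComp (hX : IsTwoSegal X) (hY : IsTwoSegal Y) (f : X ⟶ Y) (a b : X _⦋2⦌)
    (h : X.δ 0 a = X.δ 1 b)
    (e : Y.δ 0 (f.app (op ⦋2⦌) a : Y _⦋2⦌) = Y.δ 1 (f.app (op ⦋2⦌) b : Y _⦋2⦌)) :
    f.app (op ⦋2⦌) (verComp hX a b h) = verComp hY (f.app (op ⦋2⦌) a) (f.app (op ⦋2⦌) b) e := by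
  obtain ⟨w, rfl, rfl⟩ := (glue20 hX).1 a b h
  rw [verComp_eq hX h w rfl rfl,
    verComp_eq hY e (f.app (op ⦋3⦌) w) (naturality_δ f _ _) (naturality_δ f _ _)]
  exact (naturality_δ f _ _).symm

theorem map_sqHorComp (hX : IsTwoSegal X) (hY : IsTwoSegal Y) (f : X ⟶ Y) (a b : X _⦋3⦌)
    (h : X.δ 2 a = X.δ 3 b)
    (e : Y.δ 2 (f.app (op ⦋3⦌) a : Y _⦋3⦌) = Y.δ 3 (f.app (op ⦋3⦌) b : Y _⦋3⦌)) :
    f.app (op ⦋3⦌) (sqHorComp hX a b h) =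
      sqHorComp hY (f.app (op ⦋3⦌) a) (f.app (op ⦋3⦌) b) e := by
  have k := sqHorComp_faces hX a b h
  have k' := sqHorComp_faces hY _ _ e
  refine (glue31 hY).2 _ _ ?_ ?_
  · rw [naturality_δ, k.1, k'.1, naturality_δ]
  · rw [naturality_δ, k.2.2.1 (hor_aux h).1, k'.2.2.1 (hor_aux e).1]
    rw [map_horComp hX hY f _ _ _ (map_adj f (hor_aux h).1)]
    exact horComp_congr hY (naturality_δ f _ _).symm (naturality_δ f _ _).symm _

theorem map_sqVerComp (hX : IsTwoSegal X) (hY : IsTwoSegal Y) (f : X ⟶ Y) (a b : X _⦋3⦌)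
    (h : X.δ 0 a = X.δ 1 b)
    (e : Y.δ 0 (f.app (op ⦋3⦌) a : Y _⦋3⦌) = Y.δ 1 (f.app (op ⦋3⦌) b : Y _⦋3⦌)) :
    f.app (op ⦋3⦌) (sqVerComp hX a b h) =
      sqVerComp hY (f.app (op ⦋3⦌) a) (f.app (op ⦋3⦌) b) e := by
  have k := sqVerComp_faces hX a b h
  have k' := sqVerComp_faces hY _ _ e
  refine (glue31 hY).2 _ _ ?_ ?_
  · rw [naturality_δ, k.2.2.1 (ver_aux h).1, k'.2.2.1 (ver_aux e).1]
    rw [map_verComp hX hY f _ _ _ (map_adj f (ver_aux h).1)]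
    exact verComp_congr hY (naturality_δ f _ _).symm (naturality_δ f _ _).symm _
  · rw [naturality_δ, k.1, k'.1, naturality_δ]

/-- The double functor `𝒫 f`, given by the components `f₁, f₂, f₂, f₃`. -/
noncomputable def pathMap (hX : IsTwoSegal X) (hY : IsTwoSegal Y) (f : X ⟶ Y) :
    DblFunctor (pathDbl hX) (pathDbl hY) where
  ob (x : X _⦋1⦌) := (f.app (op ⦋1⦌) x : Y _⦋1⦌)
  hor (x : X _⦋2⦌) := (f.app (op ⦋2⦌) x : Y _⦋2⦌)
  ver (x : X _⦋2⦌) := (f.app (op ⦋2⦌) x : Y _⦋2⦌)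
  sq (x : X _⦋3⦌) := (f.app (op ⦋3⦌) x : Y _⦋3⦌)
  isFunctor_hor₀ := ⟨fun _ => naturality_δ f _ _, fun _ => naturality_δ f _ _,
    fun _ => SSet.σ_naturality_apply f _ _, fun a b h => map_horComp hX hY f a b h (map_adj f h)⟩
  isFunctor_ver₀ := ⟨fun _ => naturality_δ f _ _, fun _ => naturality_δ f _ _,
    fun _ => SSet.σ_naturality_apply f _ _, fun a b h => map_verComp hX hY f a b h (map_adj f h)⟩
  isFunctor_hor₁ := ⟨fun _ => naturality_δ f _ _, fun _ => naturality_δ f _ _,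
    fun _ => SSet.σ_naturality_apply f _ _, fun a b h => map_sqHorComp hX hY f a b h (map_adj f h)⟩
  isFunctor_ver₁ := ⟨fun _ => naturality_δ f _ _, fun _ => naturality_δ f _ _,
    fun _ => SSet.σ_naturality_apply f _ _, fun a b h => map_sqVerComp hX hY f a b h (map_adj f h)⟩

/-- The augmented double category `𝒫 X` of a unital 2-Segal set `X`. -/
noncomputable def pathAugObj (X : UnitalTwoSegalSet.{u}) : AugDblCat.{u} where
  toDbl := pathDbl X.property.1
  aug := pathAug X.obj
  isAugmentation := pathDbl_isAugmentation X.property.1 X.property.2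

/-- The path construction, as a functor from unital 2-Segal sets to augmented stable double
categories. -/
noncomputable def pathFunctor : UnitalTwoSegalSet.{u} ⥤ AugStDblCat.{u} where
  obj X := ⟨pathAugObj X, pathDbl_isStable X.property.1⟩
  map {X Y} f := ObjectProperty.homMk
    { toFunctor := pathMap X.property.1 Y.property.1 f.hom
      map_aug := by
        rintro _ ⟨a, rfl⟩
        exact ⟨f.hom.app (op ⦋0⦌) a, (SSet.σ_naturality_apply f.hom (0 : Fin 1) a).symm⟩ }

/-- The unique 0-simplex of a reduced simplicial set. -/
noncomputable def redVertex (X : RedUnitalTwoSegalSet.{u}) : X.obj _⦋0⦌ :=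
  X.property.2.some.default

theorem eq_redVertex (X : RedUnitalTwoSegalSet.{u}) (a : X.obj _⦋0⦌) : a = redVertex X :=
  X.property.2.some.uniq a

theorem mem_pathAug_red (X : RedUnitalTwoSegalSet.{u}) (x : X.obj _⦋1⦌) :
    x ∈ pathAug X.obj ↔ x = X.obj.σ (0 : Fin 1) (redVertex X) := by
  constructor
  · rintro ⟨a, rfl⟩
    exact congrArg (X.obj.σ (0 : Fin 1)) (eq_redVertex X a)
  · rintro rfl
    exact ⟨_, rfl⟩

/-- The pointed double category `𝒫 X` of a reduced unital 2-Segal set `X`; the distinguished object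
is the degenerate 1-simplex. -/
noncomputable def pathPtObj (X : RedUnitalTwoSegalSet.{u}) : PtDblCat.{u} where
  toDbl := pathDbl X.property.1.1
  pt := (X.obj.σ (0 : Fin 1) (redVertex X) : X.obj _⦋1⦌)
  initial d := by
    obtain ⟨f, ⟨h₁, h₂⟩, h⟩ := (pathDbl_isAugmentation X.property.1.1 X.property.1.2).hor d
    exact ⟨f, ⟨(mem_pathAug_red X _).1 h₂, h₁⟩,
      fun g hg => h g ⟨hg.2, (mem_pathAug_red X _).2 hg.1⟩⟩
  terminal d := by
    obtain ⟨f, ⟨h₁, h₂⟩, h⟩ := (pathDbl_isAugmentation X.property.1.1 X.property.1.2).ver d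
    exact ⟨f, ⟨h₁, (mem_pathAug_red X _).1 h₂⟩,
      fun g hg => h g ⟨hg.1, (mem_pathAug_red X _).2 hg.2⟩⟩

/-- The path construction, as a functor from reduced unital 2-Segal sets to pointed stable double
categories. -/
noncomputable def pathPtFunctor : RedUnitalTwoSegalSet.{u} ⥤ PtStDblCat.{u} where
  obj X := ⟨pathPtObj X, pathDbl_isStable X.property.1.1⟩
  map {X Y} f := ObjectProperty.homMk
    { toFunctor := pathMap X.property.1.1 Y.property.1.1 f.hom
      map_pt := (SSet.σ_naturality_apply f.hom (0 : Fin 1) (redVertex X)).trans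
        (congrArg (Y.obj.σ (0 : Fin 1)) (eq_redVertex Y _)) }

end PathFunctor


end TwoSegal

universe u

namespace TwoSegal

universe v w

/-! ### Relational calculus in stable double categories -/

section Comp

variable {O M : Type u} {O' M' : Type v} {C : CatOn O M} {C' : CatOn O' M'}

/-! Over a stable double category, an augmented double functor on `𝒲_n` is the same thing as its top
row, a chain of `n` horizontal morphisms starting in the augmentation (`ext_row`, `exists_row`). The
augmentation provides a vertical morphism from every object into `A`; completing spans to squares
then fills in the lower rows, and uniqueness of the square on a span forces functoriality. The first
arrow of a chain is determined by its target, so `S₀`, `S₁`, `S₂` are identified with `A`, `Ob`,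
`Hor`, and through cospans `S₂` is identified with `Ver` as well.

Every triangulation has an ear with tip different from `0` and `n`, so induction on the number of
triangles reduces the 2-Segal condition to gluing on a single triangle
(`isTwoSegal_of_hasEarGluing`). For `S_•(D)` an ear with tip `i + 1` is a factorization in row `i`.
The cospan half of stability lifts it uniquely to a factorization in the top row, where an object
can be inserted (`exists_insert`, `sDotObj_hasEarGluing`). Unitality follows similarly: a square
with identity bottom has identity top, so an identity edge in row `i` comes from an identity in the
top row (`degenerate_of_edge`).

The comparison `𝒫 S D → D` evaluates at the maximal cells. It is bijective on objects and morphisms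
by the identifications above, and on squares because these are spans on both sides (`evalIso`). The
comparison `X → S 𝒫 X` sends a simplex to its faces of dimension at most three. It is inverted by
evaluation in degrees 1 and 2, is bijective in degree 0 because `A = s₀ X₀`, and in higher degrees
because both sides are 2-Segal (`facesMap_bijective`). The pointed case follows since both
inclusions are fully faithful.

The relations `IsComp` and `IsSq` express composites and boundaries of squares without composability
proofs inside the terms. -/

/-- The relation that `f` followed by `g` is defined and equal to `k`. -/
def CatOn.IsComp (C : CatOn O M) (f g k : M) : Prop := ∃ h, C.comp f g h = k

namespace CatOn.IsComp

theorem of_comp {f g : M} (h : C.cod f = C.dom g) : C.IsComp f g (C.comp f g h) := ⟨h, rfl⟩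

theorem dom_eq {f g k : M} (h : C.IsComp f g k) : C.dom k = C.dom f := by
  obtain ⟨h, rfl⟩ := h; exact C.dom_comp _ _ _

theorem cod_eq {f g k : M} (h : C.IsComp f g k) : C.cod k = C.cod g := by
  obtain ⟨h, rfl⟩ := h; exact C.cod_comp _ _ _

theorem adj {f g k : M} (h : C.IsComp f g k) : C.cod f = C.dom g := h.1

theorem unique {f g k k' : M} (h : C.IsComp f g k) (h' : C.IsComp f g k') : k = k' := by
  obtain ⟨h, rfl⟩ := h; obtain ⟨h', rfl⟩ := h'; rfl

theorem id_left {f : M} {x : O} (h : C.dom f = x) : C.IsComp (C.id x) f f := by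
  subst h; exact ⟨_, C.id_comp f⟩

theorem id_right {f : M} {x : O} (h : C.cod f = x) : C.IsComp f (C.id x) f := by
  subst h; exact ⟨_, C.comp_id f⟩

theorem assoc {f g k fg gk l : M} (h₁ : C.IsComp f g fg) (h₂ : C.IsComp g k gk)
    (h₃ : C.IsComp fg k l) : C.IsComp f gk l := by
  obtain ⟨h₁, rfl⟩ := h₁; obtain ⟨h₂, rfl⟩ := h₂; obtain ⟨h₃, rfl⟩ := h₃
  exact ⟨_, (C.assoc f g k h₁ h₂).symm⟩

theorem assoc' {f g k fg gk l : M} (h₁ : C.IsComp f g fg) (h₂ : C.IsComp g k gk)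
    (h₃ : C.IsComp f gk l) : C.IsComp fg k l := by
  obtain ⟨h₁, rfl⟩ := h₁; obtain ⟨h₂, rfl⟩ := h₂; obtain ⟨h₃, rfl⟩ := h₃
  exact ⟨_, C.assoc f g k h₁ h₂⟩

theorem map {F : O → O'} {G : M → M'} (hF : C.IsFunctor C' F G) {f g k : M}
    (h : C.IsComp f g k) : C'.IsComp (G f) (G g) (G k) := by
  obtain ⟨h, rfl⟩ := h; exact ⟨_, (hF.comp f g h).symm⟩

end CatOn.IsComp

/-- In relational form a composable pair can be destructured, and its matching indices substituted,
before the images are compared. -/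
theorem CatOn.IsFunctor.of_isComp {F : O → O'} {G : M → M'}
    (dom : ∀ f, C'.dom (G f) = F (C.dom f)) (cod : ∀ f, C'.cod (G f) = F (C.cod f))
    (id : ∀ x, G (C.id x) = C'.id (F x))
    (comp : ∀ f g k, C.IsComp f g k → C'.IsComp (G f) (G g) (G k)) : C.IsFunctor C' F G :=
  ⟨dom, cod, id, fun _ _ h => (comp _ _ _ (.of_comp h)).2.symm⟩

end Comp

namespace DblCat

variable {D : DblCat.{u}}

/-- There is a square with left side `l`, top side `t`, right side `r` and bottom side `b`. -/
def IsSq (D : DblCat.{u}) (l : D.Ver) (t : D.Hor) (r : D.Ver) (b : D.Hor) : Prop :=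
  ∃ α, D.hor₁.dom α = l ∧ D.ver₁.dom α = t ∧ D.hor₁.cod α = r ∧ D.ver₁.cod α = b

namespace IsSq

variable {l l' l'' r r' r'' : D.Ver} {t t' t'' b b' b'' : D.Hor}

theorem span (h : D.IsSq l t r b) : D.ver₀.dom l = D.hor₀.dom t := by
  obtain ⟨α, rfl, rfl, rfl, rfl⟩ := h; exact D.dom_functor.dom α

theorem cospan (h : D.IsSq l t r b) : D.ver₀.cod r = D.hor₀.cod b := by
  obtain ⟨α, rfl, rfl, rfl, rfl⟩ := h; exact D.cod_functor.cod α

theorem cod_left (h : D.IsSq l t r b) : D.ver₀.cod l = D.hor₀.dom b := by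
  obtain ⟨α, rfl, rfl, rfl, rfl⟩ := h; exact D.dom_functor.cod α

theorem dom_right (h : D.IsSq l t r b) : D.ver₀.dom r = D.hor₀.cod t := by
  obtain ⟨α, rfl, rfl, rfl, rfl⟩ := h; exact D.cod_functor.dom α

theorem hcomp (h : D.IsSq l t r b) (h' : D.IsSq r t' r' b') (ht : D.hor₀.IsComp t t' t'')
    (hb : D.hor₀.IsComp b b' b'') : D.IsSq l t'' r' b'' := by
  obtain ⟨α, rfl, rfl, rfl, rfl⟩ := h
  obtain ⟨β, e, rfl, rfl, rfl⟩ := h'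
  exact ⟨D.hor₁.comp α β e.symm, D.hor₁.dom_comp _ _ _,
    CatOn.IsComp.unique ⟨_, (D.comp_dom α β e.symm).symm⟩ ht, D.hor₁.cod_comp _ _ _,
    CatOn.IsComp.unique ⟨_, (D.comp_cod α β e.symm).symm⟩ hb⟩

theorem vcomp (h : D.IsSq l t r b) (h' : D.IsSq l' b r' b') (hl : D.ver₀.IsComp l l' l'')
    (hr : D.ver₀.IsComp r r' r'') : D.IsSq l'' t r'' b' := by
  obtain ⟨α, rfl, rfl, rfl, rfl⟩ := h
  obtain ⟨β, rfl, e, rfl, rfl⟩ := h'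
  exact ⟨D.ver₁.comp α β e.symm,
    CatOn.IsComp.unique ⟨_, (D.dom_functor.comp α β e.symm).symm⟩ hl, D.ver₁.dom_comp _ _ _,
    CatOn.IsComp.unique ⟨_, (D.cod_functor.comp α β e.symm).symm⟩ hr, D.ver₁.cod_comp _ _ _⟩

theorem id_ver {x y : D.Ob} (h₁ : D.ver₀.dom l = x) (h₂ : D.ver₀.cod l = y) :
    D.IsSq l (D.hor₀.id x) l (D.hor₀.id y) := by
  subst h₁ h₂
  exact ⟨D.hor₁.id l, D.hor₁.dom_id _, D.id_functor.dom l, D.hor₁.cod_id _, D.id_functor.cod l⟩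

theorem id_hor {x y : D.Ob} (h₁ : D.hor₀.dom t = x) (h₂ : D.hor₀.cod t = y) :
    D.IsSq (D.ver₀.id x) t (D.ver₀.id y) t := by
  subst h₁ h₂
  exact ⟨D.ver₁.id t, D.dom_functor.id t, D.ver₁.dom_id _, D.cod_functor.id t, D.ver₁.cod_id _⟩

theorem map {C : DblCat.{v}} (F : DblFunctor C D) {l r : C.Ver} {t b : C.Hor}
    (h : C.IsSq l t r b) : D.IsSq (F.ver l) (F.hor t) (F.ver r) (F.hor b) := by
  obtain ⟨α, rfl, rfl, rfl, rfl⟩ := h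
  exact ⟨F.sq α, F.isFunctor_hor₁.dom α, F.isFunctor_ver₁.dom α, F.isFunctor_hor₁.cod α,
    F.isFunctor_ver₁.cod α⟩

end IsSq

namespace IsStable

variable (hD : D.IsStable)
include hD

theorem sq_ext {α β : D.Sq} (h₁ : D.hor₁.dom α = D.hor₁.dom β)
    (h₂ : D.ver₁.dom α = D.ver₁.dom β) : α = β :=
  hD.span.1 (Subtype.ext (Prod.ext h₁ h₂))

theorem exists_of_span {l : D.Ver} {t : D.Hor} (h : D.ver₀.dom l = D.hor₀.dom t) :
    ∃ r b, D.IsSq l t r b := by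
  obtain ⟨α, hα⟩ := hD.span.2 ⟨(l, t), h⟩
  have e := congrArg Subtype.val hα
  exact ⟨_, _, α, congrArg Prod.fst e, congrArg Prod.snd e, rfl, rfl⟩

theorem exists_of_cospan {r : D.Ver} {b : D.Hor} (h : D.ver₀.cod r = D.hor₀.cod b) :
    ∃ l t, D.IsSq l t r b := by
  obtain ⟨α, hα⟩ := hD.cospan.2 ⟨(r, b), h⟩
  have e := congrArg Subtype.val hα
  exact ⟨_, _, α, rfl, rfl, congrArg Prod.fst e, congrArg Prod.snd e⟩

theorem unique_of_span {l r r' : D.Ver} {t b b' : D.Hor} (h : D.IsSq l t r b)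
    (h' : D.IsSq l t r' b') : r = r' ∧ b = b' := by
  obtain ⟨α, h₁, h₂, rfl, rfl⟩ := h
  obtain ⟨β, h₁', h₂', rfl, rfl⟩ := h'
  rw [hD.sq_ext (h₁.trans h₁'.symm) (h₂.trans h₂'.symm)]
  exact ⟨rfl, rfl⟩

theorem unique_of_cospan {l l' r : D.Ver} {t t' b : D.Hor} (h : D.IsSq l t r b)
    (h' : D.IsSq l' t' r b) : l = l' ∧ t = t' := by
  obtain ⟨α, rfl, rfl, h₁, h₂⟩ := h
  obtain ⟨β, rfl, rfl, h₁', h₂'⟩ := h'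
  rw [hD.cospan.1 (Subtype.ext (Prod.ext (h₁.trans h₁'.symm) (h₂.trans h₂'.symm)))]
  exact ⟨rfl, rfl⟩

end IsStable

end DblCat

/-- A double functor to a stable double category is determined by compatible functors between the
horizontal and between the vertical categories which preserve boundaries of squares. -/
noncomputable def DblFunctor.ofIsSq {C : DblCat.{v}} {D : DblCat.{u}} (hD : D.IsStable)
    (ob : C.Ob → D.Ob) (hor : C.Hor → D.Hor) (ver : C.Ver → D.Ver)
    (hhor : C.hor₀.IsFunctor D.hor₀ ob hor) (hver : C.ver₀.IsFunctor D.ver₀ ob ver)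
    (hsq : ∀ α : C.Sq, D.IsSq (ver (C.hor₁.dom α)) (hor (C.ver₁.dom α)) (ver (C.hor₁.cod α))
      (hor (C.ver₁.cod α))) : DblFunctor C D where
  ob := ob
  hor := hor
  ver := ver
  sq α := (hsq α).choose
  isFunctor_hor₀ := hhor
  isFunctor_ver₀ := hver
  isFunctor_hor₁ := by
    have k := fun α => (hsq α).choose_spec
    -- A square of `D` is determined by its left and top sides, so identities and composites of the
    -- chosen squares are compared on these two sides only.
    refine ⟨fun α => (k α).1, fun α => (k α).2.2.1, fun v => hD.sq_ext ?_ ?_,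
      fun α β h => hD.sq_ext ?_ ?_⟩
    · rw [(k _).1, C.hor₁.dom_id, D.hor₁.dom_id]
    · rw [(k _).2.1, C.id_functor.dom, D.id_functor.dom, hver.dom, hhor.id]
    · rw [(k _).1, C.hor₁.dom_comp, D.hor₁.dom_comp, (k _).1]
    · rw [(k _).2.1, C.comp_dom, hhor.comp, D.comp_dom]
      congr 1
      exacts [(k _).2.1.symm, (k _).2.1.symm]
  isFunctor_ver₁ := by
    have k := fun α => (hsq α).choose_spec
    refine ⟨fun α => (k α).2.1, fun α => (k α).2.2.2, fun v => hD.sq_ext ?_ ?_,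
      fun α β h => hD.sq_ext ?_ ?_⟩
    · rw [(k _).1, C.dom_functor.id, D.dom_functor.id, hhor.dom, hver.id]
    · rw [(k _).2.1, C.ver₁.dom_id, D.ver₁.dom_id]
    · rw [(k _).1, C.dom_functor.comp, hver.comp, D.dom_functor.comp]
      congr 1
      exacts [(k _).1.symm, (k _).1.symm]
    · rw [(k _).2.1, C.ver₁.dom_comp, D.ver₁.dom_comp, (k _).2.1]

/-- Double functors to a stable double category are determined by their values on morphisms. -/
theorem DblFunctor.ext_of_isStable {C : DblCat.{v}} {D : DblCat.{u}} (hD : D.IsStable)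
    {F G : DblFunctor C D} (ho : ∀ x, F.ob x = G.ob x) (hh : ∀ f, F.hor f = G.hor f)
    (hv : ∀ g, F.ver g = G.ver g) : F = G :=
  DblFunctor.ext (funext ho) (funext hh) (funext hv) (funext fun α => hD.sq_ext
    (by rw [F.isFunctor_hor₁.dom, G.isFunctor_hor₁.dom, hv])
    (by rw [F.isFunctor_ver₁.dom, G.isFunctor_ver₁.dom, hh]))

namespace AugDblCat

variable {D : AugDblCat.{u}}

theorem hor_unique {f f' : D.toDbl.Hor} (h : D.toDbl.hor₀.cod f = D.toDbl.hor₀.cod f')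
    (hf : D.toDbl.hor₀.dom f ∈ D.aug) (hf' : D.toDbl.hor₀.dom f' ∈ D.aug) : f = f' :=
  (D.isAugmentation.hor _).unique ⟨h, hf⟩ ⟨rfl, hf'⟩

theorem ver_unique {f f' : D.toDbl.Ver} (h : D.toDbl.ver₀.dom f = D.toDbl.ver₀.dom f')
    (hf : D.toDbl.ver₀.cod f ∈ D.aug) (hf' : D.toDbl.ver₀.cod f' ∈ D.aug) : f = f' :=
  (D.isAugmentation.ver _).unique ⟨h, hf⟩ ⟨rfl, hf'⟩

end AugDblCat

/-! ### Functors on `𝒲_P` and their top rows -/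

section Row

variable {P : Type v} [PartialOrder P] {D : AugDblCat.{u}}

namespace AugDblFunctor

variable (F F' : AugDblFunctor (wAug P) D)

/-- The value of `F` at the object `ij`. -/
abbrev o (i j : P) (h : i ≤ j) : D.toDbl.Ob := F.toFunctor.ob (⟨i, j, h⟩ : WOb P)

/-- The value of `F` at the horizontal morphism `ij → ik`. -/
abbrev h (i j k : P) (hij : i ≤ j) (hjk : j ≤ k) : D.toDbl.Hor :=
  F.toFunctor.hor (⟨i, j, k, hij, hjk⟩ : WHor P)

/-- The value of `F` at the vertical morphism `ij → kj`. -/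
abbrev v (i k j : P) (hik : i ≤ k) (hkj : k ≤ j) : D.toDbl.Ver :=
  F.toFunctor.ver (⟨i, k, j, hik, hkj⟩ : WVer P)

theorem dom_h (i j k : P) (hij : i ≤ j) (hjk : j ≤ k) :
    D.toDbl.hor₀.dom (F.h i j k hij hjk) = F.o i j hij := F.toFunctor.isFunctor_hor₀.dom _

theorem cod_h (i j k : P) (hij : i ≤ j) (hjk : j ≤ k) :
    D.toDbl.hor₀.cod (F.h i j k hij hjk) = F.o i k (hij.trans hjk) :=
  F.toFunctor.isFunctor_hor₀.cod _

theorem dom_v (i k j : P) (hik : i ≤ k) (hkj : k ≤ j) :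
    D.toDbl.ver₀.dom (F.v i k j hik hkj) = F.o i j (hik.trans hkj) :=
  F.toFunctor.isFunctor_ver₀.dom _

theorem cod_v (i k j : P) (hik : i ≤ k) (hkj : k ≤ j) :
    D.toDbl.ver₀.cod (F.v i k j hik hkj) = F.o k j hkj := F.toFunctor.isFunctor_ver₀.cod _

theorem h_id (i j : P) (hij : i ≤ j) : F.h i j j hij le_rfl = D.toDbl.hor₀.id (F.o i j hij) :=
  F.toFunctor.isFunctor_hor₀.id (⟨i, j, hij⟩ : WOb P)

theorem v_id (i j : P) (hij : i ≤ j) : F.v i i j le_rfl hij = D.toDbl.ver₀.id (F.o i j hij) :=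
  F.toFunctor.isFunctor_ver₀.id (⟨i, j, hij⟩ : WOb P)

theorem h_comp (i j k l : P) (hij : i ≤ j) (hjk : j ≤ k) (hkl : k ≤ l) :
    D.toDbl.hor₀.IsComp (F.h i j k hij hjk) (F.h i k l (hij.trans hjk) hkl)
      (F.h i j l hij (hjk.trans hkl)) :=
  CatOn.IsComp.map F.toFunctor.isFunctor_hor₀ ⟨rfl, rfl⟩

theorem v_comp (i k l j : P) (hik : i ≤ k) (hkl : k ≤ l) (hlj : l ≤ j) :
    D.toDbl.ver₀.IsComp (F.v i k j hik (hkl.trans hlj)) (F.v k l j hkl hlj)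
      (F.v i l j (hik.trans hkl) hlj) :=
  CatOn.IsComp.map F.toFunctor.isFunctor_ver₀ ⟨rfl, rfl⟩

theorem isSq (i k j l : P) (hik : i ≤ k) (hkj : k ≤ j) (hjl : j ≤ l) :
    D.toDbl.IsSq (F.v i k j hik hkj) (F.h i j l (hik.trans hkj) hjl)
      (F.v i k l hik (hkj.trans hjl)) (F.h k j l hkj hjl) :=
  DblCat.IsSq.map F.toFunctor ⟨(⟨i, k, j, l, hik, hkj, hjl⟩ : WSq P), rfl, rfl, rfl, rfl⟩

theorem o_mem (i : P) : F.o i i le_rfl ∈ D.aug := F.map_aug _ rfl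

variable {F F'}

/-- An augmented double functor on `𝒲_P` is determined by its top row. -/
theorem ext_row [OrderBot P] (hD : D.toDbl.IsStable)
    (H : ∀ (j k : P) (hjk : j ≤ k), F.h ⊥ j k bot_le hjk = F'.h ⊥ j k bot_le hjk) : F = F' := by
  have h₀ (j : P) : F.o ⊥ j bot_le = F'.o ⊥ j bot_le := by
    rw [← dom_h F ⊥ j j bot_le le_rfl, ← dom_h F' ⊥ j j bot_le le_rfl, H]
  -- The vertical morphism `⊥j → jj` ends in the augmentation, so its source determines it; the same
  -- argument gives `h₅`.
  have h₁ (j : P) : F.v ⊥ j j bot_le le_rfl = F'.v ⊥ j j bot_le le_rfl := by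
    apply AugDblCat.ver_unique
    · rw [dom_v, dom_v, h₀]
    · rw [cod_v]; exact F.o_mem _
    · rw [cod_v]; exact F'.o_mem _
  -- In `h₂`, `h₃` and `h₆` the new value is the right or bottom side of a square whose left and top
  -- sides are already known to agree.
  have h₂ (i j : P) (hij : i ≤ j) : F.v ⊥ i j bot_le hij = F'.v ⊥ i j bot_le hij := by
    have a := F.isSq ⊥ i i j bot_le le_rfl hij
    have b := F'.isSq ⊥ i i j bot_le le_rfl hij
    rw [h₁, H] at a
    exact (hD.unique_of_span a b).1
  have h₃ (i j k : P) (hij : i ≤ j) (hjk : j ≤ k) : F.h i j k hij hjk = F'.h i j k hij hjk := by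
    have a := F.isSq ⊥ i j k bot_le hij hjk
    have b := F'.isSq ⊥ i j k bot_le hij hjk
    rw [h₂, H] at a
    exact (hD.unique_of_span a b).2
  have h₄ (i j : P) (hij : i ≤ j) : F.o i j hij = F'.o i j hij := by
    rw [← dom_h F i j j hij le_rfl, ← dom_h F' i j j hij le_rfl, h₃]
  have h₅ (i k : P) (hik : i ≤ k) : F.v i k k hik le_rfl = F'.v i k k hik le_rfl := by
    apply AugDblCat.ver_unique
    · rw [dom_v, dom_v, h₄]
    · rw [cod_v]; exact F.o_mem _
    · rw [cod_v]; exact F'.o_mem _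
  have h₆ (i k j : P) (hik : i ≤ k) (hkj : k ≤ j) : F.v i k j hik hkj = F'.v i k j hik hkj := by
    have a := F.isSq i k k j hik le_rfl hkj
    have b := F'.isSq i k k j hik le_rfl hkj
    rw [h₅, h₃] at a
    exact (hD.unique_of_span a b).1
  exact AugDblFunctor.ext (DblFunctor.ext_of_isStable hD (fun _ => h₄ _ _ _)
    (fun _ => h₃ _ _ _ _ _) (fun _ => h₆ _ _ _ _ _))

end AugDblFunctor

/-- Every functor from a poset with bottom element to the horizontal category which maps the bottom
element into the augmentation is the top row of an augmented double functor on `𝒲_P`. -/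
theorem exists_row [OrderBot P] (hD : D.toDbl.IsStable) (x : P → D.toDbl.Ob)
    (r : ∀ j k : P, j ≤ k → D.toDbl.Hor) (hx : x ⊥ ∈ D.aug)
    (hid : ∀ j, r j j le_rfl = D.toDbl.hor₀.id (x j))
    (hcomp : ∀ j k l hjk hkl, D.toDbl.hor₀.IsComp (r j k hjk) (r k l hkl) (r j l (hjk.trans hkl))) :
    ∃ F : AugDblFunctor (wAug P) D, ∀ j k hjk, F.h ⊥ j k bot_le hjk = r j k hjk := by
  have hdom (j k hjk) : D.toDbl.hor₀.dom (r j k hjk) = x j := by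
    have := (hcomp j j k le_rfl hjk).adj
    rw [hid, D.toDbl.hor₀.cod_id] at this
    exact this.symm
  have hcod (j k hjk) : D.toDbl.hor₀.cod (r j k hjk) = x k := by
    have := (hcomp j k k hjk le_rfl).adj
    rwa [hid, D.toDbl.hor₀.dom_id] at this
  -- `a d` is the unique vertical morphism from `d` into the augmentation.
  choose a ha using fun d => (D.isAugmentation.ver d).exists
  have ha_dom (d) := (ha d).1
  have ha_cod (d) := (ha d).2
  have ha_eq (f : D.toDbl.Ver) (h : D.toDbl.ver₀.cod f ∈ D.aug) : f = a (D.toDbl.ver₀.dom f) :=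
    D.ver_unique (ha_dom _).symm h (ha_cod _)
  have ha_id (d) (h : d ∈ D.aug) : a d = D.toDbl.ver₀.id d := by
    refine D.ver_unique ?_ (ha_cod _) ?_
    · rw [ha_dom, D.toDbl.ver₀.dom_id]
    · rwa [D.toDbl.ver₀.cod_id]
  have ex₁ (i j : P) (hij : i ≤ j) : ∃ V B, D.toDbl.IsSq (a (x i)) (r i j hij) V B :=
    hD.exists_of_span ((ha_dom _).trans (hdom _ _ _).symm)
  -- `V i j` will be the vertical morphism `⊥j → ij`: in the square with corners `⊥i, ⊥j, ii, ij`
  -- the left side can only be `a (x i)`.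
  choose V B hα using ex₁
  have hVdom (i j : P) (hij : i ≤ j) : D.toDbl.ver₀.dom (V i j hij) = x j :=
    (hα i j hij).dom_right.trans (hcod _ _ _)
  have ex₂ (i j k : P) (hij : i ≤ j) (hjk : j ≤ k) :
      ∃ V' H, D.toDbl.IsSq (V i j hij) (r j k hjk) V' H :=
    hD.exists_of_span ((hVdom _ _ _).trans (hdom _ _ _).symm)
  -- `H i j k` will be the horizontal morphism `ij → ik`, lying below `r j k`.
  choose V' H hβ' using ex₂
  -- The squares below `r i j` and `r j k` paste horizontally to the square defining `V i k`.
  have hV' (i j k : P) (hij : i ≤ j) (hjk : j ≤ k) : V' i j k hij hjk = V i k (hij.trans hjk) := by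
    have e := (hβ' i j k hij hjk).cod_left
    have e' := (hα i j hij).cospan
    exact (hD.unique_of_span ((hα i j hij).hcomp (hβ' i j k hij hjk) (hcomp _ _ _ _ _)
      (.of_comp (e'.symm.trans e))) (hα i k _)).1
  have hβ (i j k : P) (hij : i ≤ j) (hjk : j ≤ k) :
      D.toDbl.IsSq (V i j hij) (r j k hjk) (V i k (hij.trans hjk)) (H i j k hij hjk) := by
    rw [← hV' i j k hij hjk]; exact hβ' i j k hij hjk
  let y (i j : P) (hij : i ≤ j) : D.toDbl.Ob := D.toDbl.ver₀.cod (V i j hij)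
  have hHdom (i j k : P) (hij : i ≤ j) (hjk : j ≤ k) :
      D.toDbl.hor₀.dom (H i j k hij hjk) = y i j hij := (hβ i j k hij hjk).cod_left.symm
  have hHcod (i j k : P) (hij : i ≤ j) (hjk : j ≤ k) :
      D.toDbl.hor₀.cod (H i j k hij hjk) = y i k (hij.trans hjk) := (hβ i j k hij hjk).cospan.symm
  have hHid (i j : P) (hij : i ≤ j) : H i j j hij le_rfl = D.toDbl.hor₀.id (y i j hij) := by
    have h := hβ i j j hij le_rfl
    rw [hid] at h
    exact (hD.unique_of_span h (.id_ver (hVdom _ _ _) rfl)).2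
  have hHcomp (i j k l : P) (hij : i ≤ j) (hjk : j ≤ k) (hkl : k ≤ l) :
      D.toDbl.hor₀.IsComp (H i j k hij hjk) (H i k l (hij.trans hjk) hkl)
        (H i j l hij (hjk.trans hkl)) := by
    have e := CatOn.IsComp.of_comp ((hHcod i j k hij hjk).trans (hHdom i k l (hij.trans hjk) hkl).symm)
    have := (hD.unique_of_span (((hβ i j k hij hjk).hcomp (hβ i k l (hij.trans hjk) hkl)
      (hcomp _ _ _ _ _) e)) (hβ i j l hij (hjk.trans hkl))).2
    rwa [this] at e
  have hVid (i : P) : V i i le_rfl = a (x i) := by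
    have h := hα i i le_rfl
    rw [hid] at h
    exact (hD.unique_of_span h (.id_ver (ha_dom _) rfl)).1
  have hy (i : P) : y i i le_rfl ∈ D.aug := by
    change D.toDbl.ver₀.cod _ ∈ _
    rw [hVid]; exact ha_cod _
  have ex₃ (i k j : P) (hik : i ≤ k) (hkj : k ≤ j) :
      ∃ W B', D.toDbl.IsSq (a (y i k hik)) (H i k j hik hkj) W B' :=
    hD.exists_of_span ((ha_dom _).trans (hHdom _ _ _ _ _).symm)
  -- `W i k j` will be the vertical morphism `ij → kj`, the right side of the square with corners
  -- `ik, ij, kk, kj`.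
  choose W B' hγ' using ex₃
  have hWdom (i k j : P) (hik : i ≤ k) (hkj : k ≤ j) :
      D.toDbl.ver₀.dom (W i k j hik hkj) = y i j (hik.trans hkj) :=
    (hγ' i k j hik hkj).dom_right.trans (hHcod _ _ _ _ _)
  have hVa (i k : P) (hik : i ≤ k) :
      D.toDbl.ver₀.IsComp (V i k hik) (a (y i k hik)) (V k k le_rfl) := by
    have e := CatOn.IsComp.of_comp (C := D.toDbl.ver₀) (f := V i k hik) (ha_dom (y i k hik)).symm
    have := ha_eq _ (by rw [e.cod_eq]; exact ha_cod _)
    rw [e.dom_eq, hVdom] at this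
    rwa [hVid, ← this]
  -- Stacking the square below `r k j` in level `i` on the one defining `W i k j` yields left side
  -- `V k k` and top `r k j`, so it is the square defining `H k k j`.
  have hVW (i k j : P) (hik : i ≤ k) (hkj : k ≤ j) :
      D.toDbl.ver₀.IsComp (V i j (hik.trans hkj)) (W i k j hik hkj) (V k j hkj) ∧
        B' i k j hik hkj = H k k j le_rfl hkj := by
    have e := CatOn.IsComp.of_comp (C := D.toDbl.ver₀) (f := V i j (hik.trans hkj))
      (hWdom i k j hik hkj).symm
    have := hD.unique_of_span ((hβ i k j hik hkj).vcomp (hγ' i k j hik hkj) (hVa i k hik) e)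
      (hβ k k j le_rfl hkj)
    rw [this.1] at e
    exact ⟨e, this.2⟩
  have hWcod (i k j : P) (hik : i ≤ k) (hkj : k ≤ j) :
      D.toDbl.ver₀.cod (W i k j hik hkj) = y k j hkj := (hVW i k j hik hkj).1.cod_eq.symm
  have hγ (i k j : P) (hik : i ≤ k) (hkj : k ≤ j) :
      D.toDbl.IsSq (a (y i k hik)) (H i k j hik hkj) (W i k j hik hkj) (H k k j le_rfl hkj) := by
    rw [← (hVW i k j hik hkj).2]; exact hγ' i k j hik hkj
  -- Complete the span to a square. Pasting it to the right of `hγ i k j` identifies its right side,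
  -- pasting it below `hβ i j l` identifies its bottom.
  have hδ (i k j l : P) (hik : i ≤ k) (hkj : k ≤ j) (hjl : j ≤ l) :
      D.toDbl.IsSq (W i k j hik hkj) (H i j l (hik.trans hkj) hjl) (W i k l hik (hkj.trans hjl))
        (H k j l hkj hjl) := by
    obtain ⟨r', b', h⟩ := hD.exists_of_span
      ((hWdom i k j hik hkj).trans (hHdom i j l (hik.trans hkj) hjl).symm)
    have e₁ := (hD.unique_of_span ((hγ i k j hik hkj).hcomp h (hHcomp i k j l hik hkj hjl)
      (.of_comp ((hγ i k j hik hkj).cospan.symm.trans h.cod_left))) (hγ i k l hik _)).1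
    subst e₁
    have e₂ := (hD.unique_of_span ((hβ i j l (hik.trans hkj) hjl).vcomp h (hVW i k j hik hkj).1
      (hVW i k l hik _).1) (hβ k j l hkj hjl)).2
    subst e₂
    exact h
  have hWid (i j : P) (hij : i ≤ j) : W i i j le_rfl hij = D.toDbl.ver₀.id (y i j hij) := by
    have h := hγ i i j le_rfl hij
    rw [ha_id _ (hy i)] at h
    exact (hD.unique_of_span h (.id_hor (hHdom _ _ _ _ _) (hHcod _ _ _ _ _))).1
  have hWa (i k l : P) (hik : i ≤ k) (hkl : k ≤ l) :
      D.toDbl.ver₀.IsComp (W i k l hik hkl) (a (y k l hkl)) (a (y i l (hik.trans hkl))) := by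
    have e := CatOn.IsComp.of_comp (C := D.toDbl.ver₀) (f := W i k l hik hkl) (g := a (y k l hkl))
      ((hWcod _ _ _ _ _).trans (ha_dom _).symm)
    have := ha_eq _ (by rw [e.cod_eq]; exact ha_cod _)
    rw [e.dom_eq, hWdom] at this
    rwa [← this]
  -- The stack of `hδ i k l j` on `hγ k l j` has the span of `hγ i l j`, so their right sides agree.
  have hWcomp (i k l j : P) (hik : i ≤ k) (hkl : k ≤ l) (hlj : l ≤ j) :
      D.toDbl.ver₀.IsComp (W i k j hik (hkl.trans hlj)) (W k l j hkl hlj)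
        (W i l j (hik.trans hkl) hlj) := by
    have e := CatOn.IsComp.of_comp (C := D.toDbl.ver₀) (f := W i k j hik (hkl.trans hlj))
      (g := W k l j hkl hlj) ((hWcod _ _ _ _ _).trans (hWdom _ _ _ _ _).symm)
    have := (hD.unique_of_span ((hδ i k l j hik hkl hlj).vcomp (hγ k l j hkl hlj)
      (hWa i k l hik hkl) e) (hγ i l j (hik.trans hkl) hlj)).1
    rwa [this] at e
  refine ⟨⟨.ofIsSq (C := wDbl P) hD (fun z => y z.i z.j z.hij) (fun f => H f.i f.j f.k f.hij f.hjk)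
    (fun g => W g.i g.k g.j g.hik g.hkj) ?_ ?_
    (fun α => hδ α.i α.k α.j α.l α.hik α.hkj α.hjl), ?_⟩, ?_⟩
  · refine .of_isComp (fun f => hHdom _ _ _ _ _) (fun f => hHcod _ _ _ _ _)
      (fun f => hHid _ _ _) ?_
    rintro ⟨i, j, k, hij, hjk⟩ ⟨i', k', l, hij', hjk'⟩ _ ⟨e, rfl⟩
    obtain ⟨rfl, rfl⟩ := WOb.mk.inj e
    exact hHcomp _ _ _ _ _ _ _
  · refine .of_isComp (fun f => hWdom _ _ _ _ _) (fun f => hWcod _ _ _ _ _)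
      (fun f => hWid _ _ _) ?_
    rintro ⟨i, k, j, hij, hjk⟩ ⟨k', l, j', hij', hjk'⟩ _ ⟨e, rfl⟩
    obtain ⟨rfl, rfl⟩ := WOb.mk.inj e
    exact hWcomp _ _ _ _ _ _ _
  · rintro ⟨i, j, hij⟩ (h : i = j)
    subst h
    exact hy i
  · intro j k hjk
    have h := hβ ⊥ j k bot_le hjk
    -- Since `x ⊥` lies in the augmentation, `a (x ⊥)` is an identity, and so level `⊥` of the
    -- construction is the given row.
    have hV (j : P) : V ⊥ j bot_le = D.toDbl.ver₀.id (x j) := by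
      have := hα ⊥ j bot_le
      rw [ha_id _ hx] at this
      exact (hD.unique_of_span this (.id_hor (hdom _ _ _) (hcod _ _ _))).1
    rw [hV, hV] at h
    exact (hD.unique_of_span h (.id_hor (hdom _ _ _) (hcod _ _ _))).2

end Row

/-! ### Triangulations and ears -/

namespace Triangulation

variable {n : ℕ} (T : Triangulation n)

theorem seg_succ {i j : Fin (n + 1)} (h : (j : ℕ) = i + 1) : T.seg i j := by
  refine T.maximal i j (by omega) fun k l _ => ?_
  omega

theorem seg_last : 0 < n → T.seg 0 (Fin.last n) := by
  intro hn
  refine T.maximal _ _ (Fin.lt_def.2 (by simpa using hn)) fun k l _ => ?_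
  have := Fin.le_last l
  have := Fin.le_last k
  simp only [Fin.le_def, Fin.lt_def, Fin.val_last, Fin.val_zero] at *
  omega

/-- Take the largest `m < j` joined to `i`. A segment crossing `{m, j}` would cross `{i, j}` or `{i,
m}`, or would join `i` to a larger vertex below `j`; so `{m, j}` belongs to `T` by maximality. -/
theorem exists_mid {i j : Fin (n + 1)} (h : T.seg i j) (hij : (i : ℕ) + 2 ≤ j) :
    ∃ m, T.seg i m ∧ T.seg m j := by
  classical
  obtain ⟨m, hm, hmax⟩ := Finset.exists_max_image
    (Finset.univ.filter fun m : Fin (n + 1) => T.seg i m ∧ m < j) id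
    ⟨⟨i + 1, by omega⟩, by
      simp only [Finset.mem_filter, Finset.mem_univ, true_and]
      exact ⟨T.seg_succ rfl, Fin.lt_def.2 (by simp only; omega)⟩⟩
  simp only [Finset.mem_filter, Finset.mem_univ, true_and, id, and_imp] at hm hmax
  refine ⟨m, hm.1, T.maximal _ _ hm.2 fun k l hkl => ⟨fun hc => ?_, fun hc => ?_⟩⟩
  · exact T.noncrossing i j k l h hkl ⟨((T.lt _ _ hm.1).trans hc.1), hc.2.1, hc.2.2⟩
  · rcases lt_trichotomy k i with hk | rfl | hk
    · exact T.noncrossing k l i j hkl h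
        ⟨hk, (T.lt _ _ hm.1).trans hc.2.1, hc.2.2⟩
    · exact absurd (hmax l hkl hc.2.2) (not_le.2 hc.2.1)
    · exact T.noncrossing i m k l hm.1 hkl ⟨hk, hc.1, hc.2.1⟩

/-- The map `⦋2⦌ ⟶ ⦋n⦌` with values `a ≤ b ≤ c`. -/
def vertices {a b c : Fin (n + 1)} (hab : a ≤ b) (hbc : b ≤ c) : ⦋2⦌ ⟶ ⦋n⦌ :=
  SimplexCategory.mkHom ⟨![a, b, c], by
    rw [Fin.monotone_iff_le_succ]
    intro i
    fin_cases i
    exacts [hab, hbc]⟩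

/-- Every segment of a triangulation of a polygon is a side of one of the triangles. -/
theorem exists_side (hn : 2 ≤ n) {i j : Fin (n + 1)} (h : T.seg i j) :
    ∃ (τ : ⦋2⦌ ⟶ ⦋n⦌) (a : Fin 3), T.IsTriangle τ ∧
      τ.toOrderHom (a.succAbove (0 : Fin 2)) = i ∧ τ.toOrderHom (a.succAbove (1 : Fin 2)) = j := by
  by_cases hij : (i : ℕ) + 2 ≤ j
  · obtain ⟨m, h₁, h₂⟩ := T.exists_mid h hij
    exact ⟨vertices (T.lt _ _ h₁).le (T.lt _ _ h₂).le, 1, ⟨h₁, h₂, h⟩, rfl, rfl⟩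
  -- Now `j = i + 1`. Descend from `{0, n}`: no apex falls strictly between `i` and `j`, so one half
  -- of a segment spanning both still spans them, and it is `{i, j}` as soon as it has length one.
  have key : ∀ (d : ℕ) (k l : Fin (n + 1)), (l : ℕ) = k + d → k ≤ i → j ≤ l → 2 ≤ d →
      T.seg k l → ∃ (τ : ⦋2⦌ ⟶ ⦋n⦌) (a : Fin 3), T.IsTriangle τ ∧
        τ.toOrderHom (a.succAbove (0 : Fin 2)) = i ∧
        τ.toOrderHom (a.succAbove (1 : Fin 2)) = j := by
    intro d
    induction d using Nat.strong_induction_on with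
    | _ d ih =>
      intro k l hd hk hl h2 hkl
      have hlt := T.lt _ _ h
      obtain ⟨m, h₁, h₂⟩ := T.exists_mid hkl (by omega)
      have l₁ := T.lt _ _ h₁
      have l₂ := T.lt _ _ h₂
      rcases le_or_gt j m with hm | hm
      · by_cases hs : (k : ℕ) + 2 ≤ m
        · exact ih (m - k) (by omega) k m (by omega) hk hm (by omega) h₁
        · have e₁ : k = i := by omega
          have e₂ : m = j := by omega
          subst e₁ e₂
          exact ⟨vertices l₁.le l₂.le, 2, ⟨h₁, h₂, hkl⟩, rfl, rfl⟩
      · by_cases hs : (m : ℕ) + 2 ≤ l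
        · exact ih (l - m) (by omega) m l (by omega) (by omega) hl (by omega) h₂
        · have e₁ : m = i := by omega
          have e₂ : l = j := by omega
          subst e₁ e₂
          exact ⟨vertices l₁.le l₂.le, 0, ⟨h₁, h₂, hkl⟩, rfl, rfl⟩
  exact key n 0 (Fin.last n) (by simp) (Fin.zero_le _) (Fin.le_last _) hn (T.seg_last (by omega))

/-- Every triangulation of a polygon has an ear away from the side `{0, n}`. -/
theorem exists_ear (T : Triangulation (n + 1)) (hn : 1 ≤ n) :
    ∃ i : Fin n, T.seg i.castSucc.castSucc i.succ.succ := by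
  -- Descend into a side of length at least two until both sides at the apex have length one.
  have key : ∀ (d : ℕ) (k l : Fin (n + 2)), (l : ℕ) = k + d → 2 ≤ d → T.seg k l →
      ∃ i : Fin n, T.seg i.castSucc.castSucc i.succ.succ := by
    intro d
    induction d using Nat.strong_induction_on with
    | _ d ih =>
      intro k l hd h2 hkl
      obtain ⟨m, h₁, h₂⟩ := T.exists_mid hkl (by omega)
      have l₁ := T.lt _ _ h₁
      have l₂ := T.lt _ _ h₂
      by_cases hs : (k : ℕ) + 2 ≤ m
      · exact ih (m - k) (by omega) k m (by omega) (by omega) h₁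
      by_cases hs' : (m : ℕ) + 2 ≤ l
      · exact ih (l - m) (by omega) m l (by omega) (by omega) h₂
      have hkn : (k : ℕ) < n := by omega
      have e : (⟨k, hkn⟩ : Fin n).succ.succ = l := Fin.ext (by
        change (k : ℕ) + 1 + 1 = l
        omega)
      refine ⟨⟨k, hkn⟩, ?_⟩
      rw [e]
      exact hkl
  exact key (n + 1) 0 (Fin.last _) (by simp) (by omega) (T.seg_last (by omega))

end Triangulation

/-- The map `⦋2⦌ ⟶ ⦋n + 1⦌` with image `{i, i + 1, i + 2}`. -/
def earMap {n : ℕ} (i : Fin n) : ⦋2⦌ ⟶ ⦋n + 1⦌ :=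
  Triangulation.vertices (a := i.castSucc.castSucc) (b := i.succ.castSucc) (c := i.succ.succ)
    (Fin.le_def.2 (by simp)) (Fin.le_def.2 (by simp))

/-- This is the gluing edge: a side of the polygon left after deleting the vertex `i + 1`, and the
long edge of the ear. -/
theorem mkOfSucc_δ {n : ℕ} (i : Fin n) :
    SimplexCategory.mkOfSucc i ≫ SimplexCategory.δ i.succ.castSucc =
      SimplexCategory.δ 1 ≫ earMap i := by
  ext v : 3
  change Fin 2 at v
  fin_cases v
  · change i.succ.castSucc.succAbove i.castSucc = i.castSucc.castSucc
    exact Fin.succAbove_of_castSucc_lt _ _ (Fin.lt_def.2 (by simp))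
  · change i.succ.castSucc.succAbove i.succ = i.succ.succ
    exact Fin.succAbove_of_le_castSucc _ _ le_rfl

/-! ### Cutting off an ear -/

namespace Triangulation

variable {n : ℕ} (T : Triangulation (n + 1)) {i : Fin n}

/-- The chord `{i, i + 2}` separates the tip `i + 1` from all other vertices, so any further segment
at the tip would cross it. -/
theorem seg_ear_left (h : T.seg i.castSucc.castSucc i.succ.succ) {k : Fin (n + 2)}
    (hk : T.seg k i.succ.castSucc) : k = i.castSucc.castSucc := by
  have h₁ := T.lt _ _ hk
  have h₂ := T.noncrossing _ _ _ _ hk h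
  simp only [Fin.lt_def, Fin.val_succ, Fin.val_castSucc, Fin.ext_iff] at *
  omega

theorem seg_ear_right (h : T.seg i.castSucc.castSucc i.succ.succ) {k : Fin (n + 2)}
    (hk : T.seg i.succ.castSucc k) : k = i.succ.succ := by
  have h₁ := T.lt _ _ hk
  have h₂ := T.noncrossing _ _ _ _ h hk
  simp only [Fin.lt_def, Fin.val_succ, Fin.val_castSucc, Fin.ext_iff] at *
  omega

/-- The triangulation which remains after cutting off an ear. -/
def cut (h : T.seg i.castSucc.castSucc i.succ.succ) : Triangulation n where
  seg a b := T.seg (i.succ.castSucc.succAbove a) (i.succ.castSucc.succAbove b)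
  lt a b hab := (Fin.strictMono_succAbove _).lt_iff_lt.1 (T.lt _ _ hab)
  noncrossing a b c d h₁ h₂ h₃ := T.noncrossing _ _ _ _ h₁ h₂
    ⟨Fin.strictMono_succAbove _ h₃.1, Fin.strictMono_succAbove _ h₃.2.1,
      Fin.strictMono_succAbove _ h₃.2.2⟩
  maximal a b hab hc := by
    refine T.maximal _ _ (Fin.strictMono_succAbove _ hab) fun k l hkl => ?_
    -- Segments at the tip are sides of the polygon and cross nothing; all others belong to the cut
    -- triangulation.
    rcases Fin.eq_self_or_eq_succAbove i.succ.castSucc k with rfl | ⟨k, rfl⟩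
    · rw [T.seg_ear_right h hkl]
      simp only [Fin.lt_def, Fin.val_succ, Fin.val_castSucc]
      omega
    rcases Fin.eq_self_or_eq_succAbove i.succ.castSucc l with rfl | ⟨l, rfl⟩
    · rw [T.seg_ear_left h hkl]
      simp only [Fin.lt_def, Fin.val_succ, Fin.val_castSucc]
      omega
    simpa only [(Fin.strictMono_succAbove _).lt_iff_lt] using hc k l hkl

theorem isTriangle_earMap (h : T.seg i.castSucc.castSucc i.succ.succ) :
    T.IsTriangle (earMap i) :=
  ⟨T.seg_succ (i := i.castSucc.castSucc) (j := i.succ.castSucc) (by simp),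
    T.seg_succ (i := i.succ.castSucc) (j := i.succ.succ) (by simp), h⟩

theorem isTriangle_comp_δ (h : T.seg i.castSucc.castSucc i.succ.succ) {τ : ⦋2⦌ ⟶ ⦋n⦌}
    (hτ : (T.cut h).IsTriangle τ) : T.IsTriangle (τ ≫ SimplexCategory.δ i.succ.castSucc) := hτ

/-- With the tip as middle vertex the triangle is the ear. As first or last vertex the tip would
force the other two to coincide. A triangle avoiding the tip factors through the face. -/
theorem isTriangle_cases (h : T.seg i.castSucc.castSucc i.succ.succ) {τ : ⦋2⦌ ⟶ ⦋n + 1⦌}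
    (hτ : T.IsTriangle τ) : τ = earMap i ∨
      ∃ τ', (T.cut h).IsTriangle τ' ∧ τ = τ' ≫ SimplexCategory.δ i.succ.castSucc := by
  obtain ⟨h₁, h₂, h₃⟩ := hτ
  by_cases e : τ.toOrderHom 1 = i.succ.castSucc
  · left
    rw [e] at h₁ h₂
    ext v : 3
    change Fin 3 at v
    fin_cases v
    exacts [T.seg_ear_left h h₁, e, T.seg_ear_right h h₂]
  right
  rcases Fin.eq_self_or_eq_succAbove i.succ.castSucc (τ.toOrderHom 0) with e₀ | ⟨a, ha⟩
  · rw [e₀] at h₁ h₃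
    have := T.lt _ _ h₂
    rw [T.seg_ear_right h h₁, T.seg_ear_right h h₃] at this
    exact absurd this (lt_irrefl _)
  rcases Fin.eq_self_or_eq_succAbove i.succ.castSucc (τ.toOrderHom 2) with e₂ | ⟨c, hc⟩
  · rw [e₂] at h₂ h₃
    have := T.lt _ _ h₁
    rw [T.seg_ear_left h h₂, T.seg_ear_left h h₃] at this
    exact absurd this (lt_irrefl _)
  obtain ⟨b, hb⟩ := (Fin.eq_self_or_eq_succAbove i.succ.castSucc (τ.toOrderHom 1)).resolve_left e
  have hab : a < b := by
    have := T.lt _ _ h₁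
    rwa [ha, hb, (Fin.strictMono_succAbove _).lt_iff_lt] at this
  have hbc : b < c := by
    have := T.lt _ _ h₂
    rwa [hc, hb, (Fin.strictMono_succAbove _).lt_iff_lt] at this
  rw [ha, hb] at h₁
  rw [hb, hc] at h₂
  rw [ha, hc] at h₃
  refine ⟨vertices hab.le hbc.le, ⟨h₁, h₂, h₃⟩, ?_⟩
  ext v : 3
  change Fin 3 at v
  fin_cases v
  exacts [ha, hb, hc]

end Triangulation

/-! ### Reduction of the 2-Segal condition to gluing on one ear -/

variable {X : SSet.{u}}

theorem map_map {a b c : SimplexCategory} (f : a ⟶ b) (g : b ⟶ c) (x : X.obj (op c)) :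
    X.map f.op (X.map g.op x) = X.map (f ≫ g).op x := by
  rw [op_comp, X.map_comp]; rfl

/-- The 2-Segal conditions for cutting off a single triangle at a vertex different from the
extremal ones. -/
def HasEarGluing (X : SSet.{u}) : Prop :=
  ∀ n (i : Fin n), 2 ≤ n →
    (∀ w w' : X _⦋n + 1⦌, X.δ i.succ.castSucc w = X.δ i.succ.castSucc w' →
      X.map (earMap i).op w = X.map (earMap i).op w' → w = w') ∧
    ∀ (y : X _⦋n⦌) (z : X _⦋2⦌), X.map (SimplexCategory.mkOfSucc i).op y = X.δ 1 z →
      ∃ w : X _⦋n + 1⦌, X.δ i.succ.castSucc w = y ∧ X.map (earMap i).op w = z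

/-- The only triangle is the whole polygon. This is the base case of the induction, one dimension
below the range of `IsTwoSegal`. -/
theorem bijective_segalMap_two (X : SSet.{u}) (T : Triangulation 2) :
    Function.Bijective (T.segalMap X) := by
  have h₁ : T.IsTriangle (𝟙 ⦋2⦌) := ⟨T.seg_succ rfl, T.seg_succ rfl, T.seg_last (by decide)⟩
  have h₂ (τ : ⦋2⦌ ⟶ ⦋2⦌) (hτ : T.IsTriangle τ) : τ = 𝟙 _ := by
    have l₁ := T.lt _ _ hτ.1
    have l₂ := T.lt _ _ hτ.2.1
    have key : ∀ a b c : Fin 3, a < b → b < c → a = 0 ∧ b = 1 ∧ c = 2 := by decide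
    obtain ⟨e₀, e₁, e₂⟩ := key _ _ _ l₁ l₂
    ext v : 3
    change Fin 3 at v
    fin_cases v
    exacts [e₀, e₁, e₂]
  constructor
  · intro x x' h
    have : X.map (𝟙 ⦋2⦌).op x = X.map (𝟙 ⦋2⦌).op x' := congrFun (congrArg Subtype.val h) ⟨_, h₁⟩
    simpa using this
  · intro y
    refine ⟨y.1 ⟨_, h₁⟩, Subtype.ext (funext ?_)⟩
    rintro ⟨τ, hτ⟩
    obtain rfl := h₂ τ hτ
    change X.map (𝟙 ⦋2⦌).op _ = _
    simp

/-- Induction on the number of triangles: the simplex on the cut polygon comes from the induction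
hypothesis, and the ear is then glued on. -/
theorem isTwoSegal_of_hasEarGluing (hX : HasEarGluing X) : IsTwoSegal X := by
  suffices H : ∀ n (T : Triangulation (n + 2)), Function.Bijective (T.segalMap X) by
    intro n hn T
    obtain ⟨n, rfl⟩ := Nat.exists_eq_add_of_le' (show 2 ≤ n by omega)
    exact H n T
  intro n
  induction n with
  | zero => exact bijective_segalMap_two X
  | succ n ih =>
    intro T
    obtain ⟨i, hi⟩ := T.exists_ear (n := n + 2) (by omega)
    obtain ⟨hinj, hsurj⟩ := hX (n + 2) i (by omega)
    have hc := ih (T.cut hi)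
    constructor
    · intro w w' h
      have h' (τ) (hτ : T.IsTriangle τ) : X.map τ.op w = X.map τ.op w' :=
        congrFun (congrArg Subtype.val h) ⟨τ, hτ⟩
      refine hinj _ _ (hc.1 (Subtype.ext (funext fun τ => ?_))) (h' _ (T.isTriangle_earMap hi))
      change X.map τ.1.op (X.map _ _) = X.map τ.1.op (X.map _ _)
      rw [map_map, map_map]
      exact h' _ (T.isTriangle_comp_δ hi τ.2)
    · intro y
      obtain ⟨x, hx⟩ := hc.2 ⟨fun τ => y.1 ⟨_, T.isTriangle_comp_δ hi τ.2⟩,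
        fun τ τ' a b e => y.2 _ _ a b (by
          change SimplexCategory.δ a ≫ τ.1 ≫ _ = SimplexCategory.δ b ≫ τ'.1 ≫ _
          rw [reassoc_of% e])⟩
      have hx' (τ) (hτ : (T.cut hi).IsTriangle τ) :
          X.map τ.op x = y.1 ⟨_, T.isTriangle_comp_δ hi hτ⟩ :=
        congrFun (congrArg Subtype.val hx) ⟨τ, hτ⟩
      obtain ⟨w, h₁, h₂⟩ := hsurj x (y.1 ⟨_, T.isTriangle_earMap hi⟩) (by
        have hs : (T.cut hi).seg i.castSucc i.succ := by
          have e := mkOfSucc_δ i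
          have e₀ := congrArg (fun f => SimplexCategory.Hom.toOrderHom f 0) e
          have e₁ := congrArg (fun f => SimplexCategory.Hom.toOrderHom f 1) e
          change i.succ.castSucc.succAbove i.castSucc = i.castSucc.castSucc at e₀
          change i.succ.castSucc.succAbove i.succ = i.succ.succ at e₁
          change T.seg _ _
          rwa [e₀, e₁]
        -- The family `y` only compares triangles, so the gluing edge has to be exhibited as an edge
        -- of a triangle of the cut polygon.
        obtain ⟨τ, a, hτ, hτ₀, hτ₁⟩ := (T.cut hi).exists_side (by omega) hs
        have e : SimplexCategory.mkOfSucc i = SimplexCategory.δ a ≫ τ := by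
          ext v : 3
          change Fin 2 at v
          fin_cases v
          exacts [hτ₀.symm, hτ₁.symm]
        rw [e, ← map_map, hx' τ hτ]
        refine y.2 _ _ a 1 ?_
        change SimplexCategory.δ a ≫ τ ≫ _ = _
        rw [← mkOfSucc_δ, e, Category.assoc])
      refine ⟨w, Subtype.ext (funext ?_)⟩
      rintro ⟨τ, hτ⟩
      change X.map τ.op w = _
      rcases T.isTriangle_cases hi hτ with rfl | ⟨τ, hτ', rfl⟩
      · exact h₂
      · rw [← map_map]
        exact (congrArg _ h₁).trans (hx' τ hτ')

/-- The fan at the vertex `0`. -/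
def Triangulation.fan (n : ℕ) : Triangulation n where
  seg i j := i < j ∧ ((i : ℕ) = 0 ∨ (j : ℕ) = i + 1)
  lt _ _ h := h.1
  noncrossing i j k l h₁ h₂ := by omega
  maximal i j h hc := by
    refine ⟨h, ?_⟩
    by_contra! hne
    -- A chord `{i, j}` outside the fan is crossed by `{0, i + 1}`.
    have h₁ := (hc 0 ⟨i + 1, by omega⟩ ⟨Fin.lt_def.2 (by simp), Or.inl rfl⟩).2
    simp only [Fin.lt_def, Fin.val_zero] at *
    omega

/-- A simplicial map between 2-Segal sets which is bijective on 1- and 2-simplices is bijective on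
all higher simplices. -/
theorem bijective_app_of_twoSegal {X Y : SSet.{u}} (hX : IsTwoSegal X) (hY : IsTwoSegal Y)
    (f : X ⟶ Y) (h₁ : Function.Injective (f.app (op ⦋1⦌)))
    (h₂ : Function.Bijective (f.app (op ⦋2⦌))) (n : ℕ) (hn : 3 ≤ n) :
    Function.Bijective (f.app (op ⦋n⦌)) := by
  let T := Triangulation.fan n
  have nat {m : ℕ} (τ : ⦋m⦌ ⟶ ⦋n⦌) (x : X _⦋n⦌) :
      Y.map τ.op (f.app _ x) = f.app _ (X.map τ.op x) :=
    (NatTrans.naturality_apply f τ.op x).symm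
  constructor
  · intro x x' h
    refine (hX n hn T).1 (Subtype.ext (funext fun τ => h₂.1 ?_))
    change f.app _ (X.map τ.1.op x) = f.app _ (X.map τ.1.op x')
    rw [← nat, ← nat, h]
  · intro y
    choose z hz using fun τ : {τ : ⦋2⦌ ⟶ ⦋n⦌ // T.IsTriangle τ} => h₂.2 (Y.map τ.1.op y)
    -- The lifted triangles agree along common edges because `f` is injective on 1-simplices.
    obtain ⟨x, hx⟩ := (hX n hn T).2 ⟨z, fun τ τ' a b e => h₁ (by
      refine (naturality_δ f a (z τ)).symm.trans (Eq.trans ?_ (naturality_δ f b (z τ')))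
      rw [hz τ, hz τ']
      exact (T.segalMap Y y).2 τ τ' a b e)⟩
    refine ⟨x, (hY n hn T).1 (Subtype.ext (funext fun τ => ?_))⟩
    change Y.map τ.1.op _ = Y.map τ.1.op y
    rw [nat, ← hz τ]
    exact congrArg _ (congrFun (congrArg Subtype.val hx) τ)

/-! ### The generalized Waldhausen construction is unital 2-Segal -/

section Chain

variable {O M : Type u}

/-- The underlying set of objects of a single-sorted category, carrying the category structure. -/
def CatOn.Obj (_ : CatOn O M) : Type u := O

/-- This makes `ComposableArrows` available for building rows in `exists_chain_two`. -/
instance (C : CatOn O M) : Category C.Obj where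
  Hom x y := {f : M // C.dom f = x ∧ C.cod f = y}
  id x := ⟨C.id x, C.dom_id x, C.cod_id x⟩
  comp f g := ⟨C.comp f.1 g.1 (f.2.2.trans g.2.1.symm), (C.dom_comp _ _ _).trans f.2.1,
    (C.cod_comp _ _ _).trans g.2.2⟩
  id_comp := by
    rintro x y ⟨f, rfl, rfl⟩
    exact Subtype.ext (C.id_comp f)
  comp_id := by
    rintro x y ⟨f, rfl, rfl⟩
    exact Subtype.ext (C.comp_id f)
  assoc f g h := Subtype.ext (C.assoc _ _ _ _ _)

end Chain

variable {D : AugDblCat.{u}}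

namespace AugDblFunctor

theorem h_congr {P : Type v} [PartialOrder P] (F : AugDblFunctor (wAug P) D) {i j k i' j' k' : P}
    (hi : i = i') (hj : j = j') (hk : k = k') (hij : i ≤ j) (hjk : j ≤ k) :
    F.h i j k hij hjk = F.h i' j' k' (hi ▸ hj ▸ hij) (hj ▸ hk ▸ hjk) := by
  subst hi hj hk; rfl

theorem o_congr {P : Type v} [PartialOrder P] (F : AugDblFunctor (wAug P) D) {i j i' j' : P}
    (hi : i = i') (hj : j = j') (hij : i ≤ j) : F.o i j hij = F.o i' j' (hi ▸ hj ▸ hij) := by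
  subst hi hj; rfl

/-- A functor on `𝒲_n` is determined by the chain of horizontal morphisms in its top row. -/
theorem ext_chain (hD : D.toDbl.IsStable) {n : ℕ} {F F' : AugDblFunctor (wAug (Fin (n + 2))) D}
    (H : ∀ i : Fin (n + 1), F.h 0 i.castSucc i.succ (Fin.zero_le _) (Fin.castSucc_lt_succ).le =
      F'.h 0 i.castSucc i.succ (Fin.zero_le _) (Fin.castSucc_lt_succ).le) : F = F' := by
  have h₁ (k : Fin (n + 2)) : F.o 0 k (Fin.zero_le _) = F'.o 0 k (Fin.zero_le _) := by
    induction k using Fin.cases with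
    | zero =>
      have := congrArg D.toDbl.hor₀.dom (H 0)
      rwa [dom_h, dom_h] at this
    | succ k =>
      have := congrArg D.toDbl.hor₀.cod (H k)
      rwa [cod_h, cod_h] at this
  refine ext_row hD fun j k => ?_
  induction k using Fin.induction with
  | zero =>
    intro hj
    obtain rfl := Fin.le_zero_iff.1 hj
    exact (F.h_id 0 0 le_rfl).trans ((congrArg _ (h₁ 0)).trans (F'.h_id 0 0 le_rfl).symm)
  | succ k ih =>
    intro hj
    rcases hj.eq_or_lt with rfl | hj'
    · exact (F.h_id 0 _ (Fin.zero_le _)).trans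
        ((congrArg _ (h₁ _)).trans (F'.h_id 0 _ (Fin.zero_le _)).symm)
    · have hj'' := Fin.le_castSucc_iff.2 hj'
      have a := F.h_comp ⊥ j k.castSucc k.succ bot_le hj'' Fin.castSucc_lt_succ.le
      have b := F'.h_comp ⊥ j k.castSucc k.succ bot_le hj'' Fin.castSucc_lt_succ.le
      rw [ih hj''] at a
      refine a.unique ?_
      have e := H k
      change F.h ⊥ k.castSucc k.succ _ _ = _ at e
      rw [e]
      exact b

end AugDblFunctor

theorem exists_chain_two (hD : D.toDbl.IsStable) (f g : D.toDbl.Hor)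
    (h : D.toDbl.hor₀.cod f = D.toDbl.hor₀.dom g) (hf : D.toDbl.hor₀.dom f ∈ D.aug) :
    ∃ F : AugDblFunctor (wAug (Fin 3)) D,
      F.h 0 0 1 (by decide) (by decide) = f ∧ F.h 0 1 2 (by decide) (by decide) = g := by
  let C := D.toDbl.hor₀.Obj
  let x₀ : C := D.toDbl.hor₀.dom f
  let x₁ : C := D.toDbl.hor₀.cod f
  let x₂ : C := D.toDbl.hor₀.cod g
  let f' : x₀ ⟶ x₁ := ⟨f, rfl, rfl⟩
  let g' : x₁ ⟶ x₂ := ⟨g, h.symm, rfl⟩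
  let G := ComposableArrows.mk₂ f' g'
  obtain ⟨F, hF⟩ := exists_row (P := Fin 3) hD (fun j => G.obj j)
    (fun j k hjk => (G.map (homOfLE hjk)).1)
    (by
      rw [bot_eq_zero]
      exact hf)
    (fun j => congrArg Subtype.val (G.map_id j))
    (fun j k l hjk hkl => by
      rw [← homOfLE_comp hjk hkl, G.map_comp]
      exact ⟨_, rfl⟩)
  exact ⟨F, hF 0 1 _, hF 1 2 _⟩

/-! ### Simplices of dimension at most two of the Waldhausen construction -/

section Evaluation

variable (hD : D.toDbl.IsStable)
include hD

theorem eval_zero_injective :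
    Function.Injective fun F : AugDblFunctor (wAug (Fin 1)) D => F.o 0 0 le_rfl := by
  intro F F' h
  refine AugDblFunctor.ext_row hD fun j k hjk => ?_
  obtain rfl := Subsingleton.elim j 0
  obtain rfl := Subsingleton.elim k 0
  exact (F.h_id 0 0 le_rfl).trans ((congrArg _ h).trans (F'.h_id 0 0 le_rfl).symm)

theorem exists_eval_zero {d : D.toDbl.Ob} (hd : d ∈ D.aug) :
    ∃ F : AugDblFunctor (wAug (Fin 1)) D, F.o 0 0 le_rfl = d := by
  obtain ⟨F, hF⟩ := exists_row (P := Fin 1) hD (fun _ => d) (fun _ _ _ => D.toDbl.hor₀.id d) hd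
    (fun _ => rfl) (fun _ _ _ _ _ => .id_left (D.toDbl.hor₀.dom_id d))
  refine ⟨F, ?_⟩
  have := congrArg D.toDbl.hor₀.dom (hF 0 0 le_rfl)
  rwa [AugDblFunctor.dom_h, D.toDbl.hor₀.dom_id] at this

/-- The top row is `00 → 01 → 02`, and its first arrow is the unique horizontal morphism from the
augmentation to the source of the second. -/
theorem eval_hor_bijective : Function.Bijective fun F : AugDblFunctor (wAug (Fin 3)) D =>
    F.h 0 1 2 (by decide) (by decide) := by
  constructor
  · intro F F' h
    refine AugDblFunctor.ext_chain hD (Fin.forall_fin_two.2 ⟨D.hor_unique ?_ ?_ ?_, h⟩)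
    · have := congrArg D.toDbl.hor₀.dom h
      rw [AugDblFunctor.cod_h, AugDblFunctor.cod_h]
      rwa [AugDblFunctor.dom_h, AugDblFunctor.dom_h] at this
    · rw [AugDblFunctor.dom_h]; exact F.o_mem 0
    · rw [AugDblFunctor.dom_h]; exact F'.o_mem 0
  · intro g
    obtain ⟨f, h₁, h₂⟩ := (D.isAugmentation.hor (D.toDbl.hor₀.dom g)).exists
    obtain ⟨F, -, hF⟩ := exists_chain_two hD f g h₁ h₂
    exact ⟨F, hF⟩

theorem eval_ob_bijective : Function.Bijective fun F : AugDblFunctor (wAug (Fin 2)) D =>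
    F.o 0 1 (by decide) := by
  constructor
  · intro F F' h
    refine AugDblFunctor.ext_chain hD fun i => ?_
    obtain rfl := Fin.fin_one_eq_zero i
    refine D.hor_unique ?_ ?_ ?_
    · rw [AugDblFunctor.cod_h, AugDblFunctor.cod_h]; exact h
    · rw [AugDblFunctor.dom_h]; exact F.o_mem 0
    · rw [AugDblFunctor.dom_h]; exact F'.o_mem 0
  · intro d
    -- The 1-simplex with value `d` is found as the face on the vertices `0, 1` of the 2-simplex
    -- whose morphism `01 → 02` is the identity of `d`.
    obtain ⟨F, hF⟩ := (eval_hor_bijective hD).2 (D.toDbl.hor₀.id d)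
    refine ⟨(wMap (SimplexCategory.δ (n := 1) 2).toOrderHom).trans F, ?_⟩
    have := congrArg D.toDbl.hor₀.dom hF
    simp only [AugDblFunctor.dom_h, D.toDbl.hor₀.dom_id] at this
    exact this

/-- In the square with corners `01, 02, 11, 12` the right side determines the bottom `11 → 12` by
augmentation, and this cospan determines the top `01 → 02`, which reduces the claim to
`eval_hor_bijective`. -/
theorem eval_ver_bijective : Function.Bijective fun F : AugDblFunctor (wAug (Fin 3)) D =>
    F.v 0 1 2 (by decide) (by decide) := by
  have hsq (F : AugDblFunctor (wAug (Fin 3)) D) :=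
    F.isSq 0 1 1 2 (by decide) (by decide) (by decide)
  constructor
  · intro F F' h
    refine (eval_hor_bijective hD).1 ?_
    have e : F.h 1 1 2 (by decide) (by decide) = F'.h 1 1 2 (by decide) (by decide) := by
      refine D.hor_unique ?_ ?_ ?_
      · have := congrArg D.toDbl.ver₀.cod h
        rw [AugDblFunctor.cod_h, AugDblFunctor.cod_h]
        rwa [AugDblFunctor.cod_v, AugDblFunctor.cod_v] at this
      · rw [AugDblFunctor.dom_h]; exact F.o_mem 1
      · rw [AugDblFunctor.dom_h]; exact F'.o_mem 1
    have a := hsq F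
    rw [e, show F.v 0 1 2 _ _ = _ from h] at a
    exact (hD.unique_of_cospan a (hsq F')).2
  · intro v
    obtain ⟨b, h₁, h₂⟩ := (D.isAugmentation.hor (D.toDbl.ver₀.cod v)).exists
    obtain ⟨l, t, h⟩ := hD.exists_of_cospan h₁.symm
    obtain ⟨F, hF⟩ := (eval_hor_bijective hD).2 t
    refine ⟨F, ?_⟩
    have e : F.v 0 1 1 (by decide) le_rfl = l := by
      refine D.ver_unique ?_ ?_ ?_
      · have := congrArg D.toDbl.hor₀.dom hF
        rw [AugDblFunctor.dom_v, h.span]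
        rwa [AugDblFunctor.dom_h] at this
      · rw [AugDblFunctor.cod_v]; exact F.o_mem 1
      · rwa [h.cod_left]
    have a := hsq F
    rw [e, show F.h 0 1 2 _ _ = _ from hF] at a
    exact (hD.unique_of_span a h).1

end Evaluation

/-! ### Inserting an object into the top row -/

section Insert

variable (hD : D.toDbl.IsStable)
include hD

/-- Insertion of an object into the top row of a functor on `𝒲_n`, by factoring the
morphism between the objects with indices `i` and `i + 1`. -/
theorem exists_insert {n : ℕ} (i : Fin n) (F : AugDblFunctor (wAug (Fin (n + 1))) D)
    (t' t : D.toDbl.Hor) (ht : D.toDbl.hor₀.IsComp t' t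
      (F.h 0 i.castSucc i.succ (Fin.zero_le _) Fin.castSucc_lt_succ.le)) :
    ∃ F' : AugDblFunctor (wAug (Fin (n + 2))) D,
      (wMap (SimplexCategory.δ i.succ.castSucc).toOrderHom).trans F' = F ∧
      F'.h 0 i.castSucc.castSucc i.succ.castSucc (Fin.zero_le _)
        (Fin.castSucc_le_castSucc_iff.2 Fin.castSucc_lt_succ.le) = t' ∧
      F'.h 0 i.succ.castSucc i.succ.succ (Fin.zero_le _) Fin.castSucc_lt_succ.le = t := by
  let q : Fin (n + 2) := i.succ.castSucc
  have q_le (k : Fin (n + 1)) : q ≤ q.succAbove k ↔ i.succ ≤ k := by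
    rw [Fin.le_def, Fin.le_def, Fin.succAbove]
    simp only [q, Fin.lt_def, Fin.val_castSucc, Fin.val_succ]
    split_ifs <;> simp only [Fin.val_castSucc, Fin.val_succ]
    omega
  have le_q (k : Fin (n + 1)) : q.succAbove k ≤ q ↔ k ≤ i.castSucc := by
    rw [Fin.le_def, Fin.le_def, Fin.succAbove]
    simp only [q, Fin.lt_def, Fin.val_castSucc, Fin.val_succ]
    split_ifs <;> simp only [Fin.val_castSucc, Fin.val_succ] <;> omega
  have le_iff (j k : Fin (n + 1)) : q.succAbove j ≤ q.succAbove k ↔ j ≤ k :=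
    (Fin.strictMono_succAbove q).le_iff_le
  have hq₀ : q.succAbove 0 = 0 := Fin.succAbove_ne_zero_zero (Fin.ne_of_gt (by
    simp [q, Fin.lt_def]))
  let h₀ (j k : Fin (n + 1)) (hjk : j ≤ k) := F.h 0 j k (Fin.zero_le _) hjk
  have h₀_comp (j k l hjk hkl) : D.toDbl.hor₀.IsComp (h₀ j k hjk) (h₀ k l hkl)
      (h₀ j l (hjk.trans hkl)) := F.h_comp _ _ _ _ _ _ _
  have cod_t : D.toDbl.hor₀.cod t = F.o 0 i.succ (Fin.zero_le _) :=
    ht.cod_eq.symm.trans (F.cod_h _ _ _ _ _)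
  have dom_t' : D.toDbl.hor₀.dom t' = F.o 0 i.castSucc (Fin.zero_le _) :=
    ht.dom_eq.symm.trans (F.dom_h _ _ _ _ _)
  let x : Fin (n + 2) → D.toDbl.Ob :=
    q.insertNth (D.toDbl.hor₀.dom t) fun j => F.o 0 j (Fin.zero_le _)
  have xq : x q = D.toDbl.hor₀.dom t := Fin.insertNth_apply_same ..
  have xj (j) : x (q.succAbove j) = F.o 0 j (Fin.zero_le _) := Fin.insertNth_apply_succAbove ..
  -- Indices are either `q` or of the form `q.succAbove _`. Specifying the morphism by conditional
  -- equations and relations in all four cases avoids a dependent case distinction in its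
  -- definition.
  have ex (j k : Fin (n + 2)) (hjk : j ≤ k) : ∃ m,
      (j = q → k = q → m = D.toDbl.hor₀.id (D.toDbl.hor₀.dom t)) ∧
      (∀ k' hk', j = q → k = q.succAbove k' → D.toDbl.hor₀.IsComp t (h₀ i.succ k' hk') m) ∧
      (∀ j' hj', j = q.succAbove j' → k = q →
        D.toDbl.hor₀.IsComp (h₀ j' i.castSucc hj') t' m) ∧
      (∀ j' k' hjk', j = q.succAbove j' → k = q.succAbove k' → m = h₀ j' k' hjk') := by
    have ne (k) : q ≠ q.succAbove k := Fin.ne_succAbove q k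
    rcases Fin.eq_self_or_eq_succAbove q j with rfl | ⟨j, rfl⟩ <;>
      rcases Fin.eq_self_or_eq_succAbove q k with rfl | ⟨k, rfl⟩
    · exact ⟨_, fun _ _ => rfl, fun k _ _ h => absurd h (ne k), fun k _ h => absurd h (ne k),
        fun k _ _ h => absurd h (ne k)⟩
    · refine ⟨D.toDbl.hor₀.comp t (h₀ i.succ k ((q_le _).1 hjk))
          (cod_t.trans (F.dom_h _ _ _ _ _).symm), fun _ h => absurd h.symm (ne k),
        fun k' hk _ h => ?_, fun k _ h => absurd h (ne k), fun k _ _ h => absurd h (ne k)⟩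
      obtain rfl := Fin.succAbove_right_injective h
      exact .of_comp _
    · refine ⟨D.toDbl.hor₀.comp (h₀ j i.castSucc ((le_q _).1 hjk)) t'
          ((F.cod_h _ _ _ _ _).trans dom_t'.symm), fun h => absurd h.symm (ne j),
        fun k _ h => absurd h.symm (ne j), fun j' hj h _ => ?_,
        fun j _ _ _ h => absurd h (ne _)⟩
      obtain rfl := Fin.succAbove_right_injective h
      exact .of_comp _
    · refine ⟨h₀ j k ((le_iff _ _).1 hjk), fun h => absurd h.symm (ne j),
        fun k _ h => absurd h.symm (ne j), fun k' _ _ h => absurd h.symm (ne k),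
        fun j' k' h e₁ e₂ => ?_⟩
      obtain rfl := Fin.succAbove_right_injective e₁
      obtain rfl := Fin.succAbove_right_injective e₂
      rfl
  choose r hr using ex
  have rqq : r q q le_rfl = D.toDbl.hor₀.id (D.toDbl.hor₀.dom t) := (hr q q le_rfl).1 rfl rfl
  have rqk (k hk hk') : D.toDbl.hor₀.IsComp t (h₀ i.succ k hk') (r q (q.succAbove k) hk) :=
    (hr _ _ hk).2.1 k hk' rfl rfl
  have rjq (j hj hj') : D.toDbl.hor₀.IsComp (h₀ j i.castSucc hj') t' (r (q.succAbove j) q hj) :=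
    (hr _ _ hj).2.2.1 j hj' rfl rfl
  have rjk (j k hjk) : r (q.succAbove j) (q.succAbove k) hjk = h₀ j k ((le_iff _ _).1 hjk) :=
    (hr _ _ hjk).2.2.2 j k _ rfl rfl
  obtain ⟨F', hF'⟩ := exists_row hD x r (by
    change x 0 ∈ _
    rw [← hq₀, xj]
    exact F.o_mem 0) (by
    intro j
    rcases Fin.eq_self_or_eq_succAbove q j with rfl | ⟨j, rfl⟩
    · rw [xq, rqq]
    · rw [xj, rjk]
      exact F.h_id _ _ _) (by
    intro j k l hjk hkl
    rcases Fin.eq_self_or_eq_succAbove q j with rfl | ⟨j, rfl⟩ <;>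
      rcases Fin.eq_self_or_eq_succAbove q k with rfl | ⟨k, rfl⟩ <;>
      rcases Fin.eq_self_or_eq_succAbove q l with rfl | ⟨l, rfl⟩
    · rw [rqq]
      exact .id_left (D.toDbl.hor₀.dom_id _)
    · rw [rqq]
      exact .id_left (rqk l hkl ((q_le _).1 hkl)).dom_eq
    · exact absurd (hjk.antisymm hkl) (Fin.ne_succAbove q k)
    · have h := (le_iff _ _).1 hkl
      rw [rjk]
      exact .assoc' (rqk k hjk ((q_le _).1 hjk)) (h₀_comp i.succ k l _ h) (rqk l _ _)
    · rw [rqq]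
      refine .id_right ((rjq j hjk ((le_q _).1 hjk)).cod_eq.trans ht.adj)
    -- From an old object through the new one to an old object: reassociation brings `t'` next to
    -- `t`, whose composite is the old morphism.
    · have hj := (le_q _).1 hjk
      have hl := (q_le _).1 hkl
      rw [rjk]
      exact .assoc (.assoc' (rjq j hjk hj) ht (h₀_comp j _ _ hj Fin.castSucc_lt_succ.le))
        (rqk l hkl hl) (h₀_comp j _ _ _ hl)
    · have h := (le_iff _ _).1 hjk
      have hk := (le_q _).1 hkl
      rw [rjk]
      exact .assoc (h₀_comp j k i.castSucc h hk) (rjq k hkl hk) (rjq j _ _)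
    · rw [rjk, rjk, rjk]
      exact h₀_comp _ _ _ _ _)
  have e₁ : q.succAbove i.castSucc = i.castSucc.castSucc :=
    Fin.succAbove_of_castSucc_lt _ _ (Fin.lt_def.2 (by simp [q]))
  have e₂ : q.succAbove i.succ = i.succ.succ := Fin.succAbove_of_le_castSucc _ _ le_rfl
  refine ⟨F', AugDblFunctor.ext_row hD fun j k hjk => ?_, ?_, ?_⟩
  · refine (F'.h_congr hq₀ rfl rfl _ _).trans ((hF' _ _ ?_).trans (rjk j k ?_))
    all_goals exact (le_iff _ _).2 hjk
  · refine (F'.h_congr rfl e₁.symm rfl _ _).trans ((hF' _ _ ((le_q _).2 le_rfl)).trans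
      ((rjq _ _ le_rfl).unique ?_))
    rw [show h₀ i.castSucc i.castSucc le_rfl = _ from F.h_id _ _ _]
    exact .id_left dom_t'
  · refine (F'.h_congr rfl rfl e₂.symm _ _).trans ((hF' _ _ ((q_le _).2 le_rfl)).trans
      ((rqk _ _ le_rfl).unique ?_))
    rw [show h₀ i.succ i.succ le_rfl = _ from F.h_id _ _ _]
    exact .id_right cod_t

end Insert

/-! ### 2-Segal property and unitality of the Waldhausen construction -/

section SDot

variable {D : AugDblCat.{u}} (hD : D.toDbl.IsStable)
include hD

/-- The ear carries the factorization `ii → i(i+1) → i(i+2)` in row `i`, whereas a functor is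
determined by row `0`. Completing cospans lifts the factorization to row `0` in exactly one way. -/
theorem sDotObj_hasEarGluing : HasEarGluing (sDotObj D) := by
  intro n i _
  have e₀ : i.succ.castSucc.succAbove 0 = 0 := Fin.succAbove_ne_zero_zero (Fin.ne_of_gt (by
    simp [Fin.lt_def]))
  have e₁ : i.succ.castSucc.succAbove i.castSucc = i.castSucc.castSucc :=
    Fin.succAbove_of_castSucc_lt _ _ (Fin.lt_def.2 (by simp))
  have e₂ : i.succ.castSucc.succAbove i.succ = i.succ.succ :=
    Fin.succAbove_of_le_castSucc _ _ le_rfl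
  have hpq : i.castSucc.castSucc ≤ i.succ.castSucc :=
    Fin.castSucc_le_castSucc_iff.2 Fin.castSucc_lt_succ.le
  have hqs : i.succ.castSucc ≤ i.succ.succ := Fin.castSucc_lt_succ.le
  constructor
  · intro (F : AugDblFunctor (wAug (Fin (n + 2))) D) (F' : AugDblFunctor (wAug (Fin (n + 2))) D)
      hδ hear
    change (wMap (SimplexCategory.δ i.succ.castSucc).toOrderHom).trans F =
      (wMap (SimplexCategory.δ i.succ.castSucc).toOrderHom).trans F' at hδ
    change (wMap (earMap i).toOrderHom).trans F = (wMap (earMap i).toOrderHom).trans F' at hear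
    have hv : F.v 0 i.castSucc.castSucc i.succ.succ (Fin.zero_le _) (hpq.trans hqs) =
        F'.v 0 i.castSucc.castSucc i.succ.succ (Fin.zero_le _) (hpq.trans hqs) := by
      have := congrArg (fun G => AugDblFunctor.v G 0 i.castSucc i.succ (Fin.zero_le _)
        Fin.castSucc_lt_succ.le) hδ
      change F.v (i.succ.castSucc.succAbove 0) (i.succ.castSucc.succAbove i.castSucc)
        (i.succ.castSucc.succAbove i.succ) _ _ = F'.v (i.succ.castSucc.succAbove 0)
        (i.succ.castSucc.succAbove i.castSucc) (i.succ.castSucc.succAbove i.succ) _ _ at this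
      simpa only [e₀, e₁, e₂] using this
    have h₁ : F.h i.castSucc.castSucc i.castSucc.castSucc i.succ.castSucc le_rfl hpq =
        F'.h i.castSucc.castSucc i.castSucc.castSucc i.succ.castSucc le_rfl hpq :=
      congrArg (fun G => AugDblFunctor.h G 0 0 1 (by decide) (by decide)) hear
    have h₂ : F.h i.castSucc.castSucc i.succ.castSucc i.succ.succ hpq hqs =
        F'.h i.castSucc.castSucc i.succ.castSucc i.succ.succ hpq hqs :=
      congrArg (fun G => AugDblFunctor.h G 0 1 2 (by decide) (by decide)) hear
    -- The right side of this square avoids the index `i + 1` and is seen by the face; the bottom is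
    -- seen by the ear. Its left side becomes the right side of the next square.
    have a := F.isSq 0 i.castSucc.castSucc i.succ.castSucc i.succ.succ (Fin.zero_le _) hpq hqs
    rw [hv, h₂] at a
    obtain ⟨hv', h₃⟩ := hD.unique_of_cospan a (F'.isSq _ _ _ _ _ _ _)
    have b := F.isSq 0 i.castSucc.castSucc i.castSucc.castSucc i.succ.castSucc (Fin.zero_le _)
      le_rfl hpq
    rw [hv', h₁] at b
    have h₄ := (hD.unique_of_cospan b (F'.isSq _ _ _ _ _ _ _)).2
    refine AugDblFunctor.ext_chain hD fun m => ?_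
    by_cases c₁ : m = i.castSucc
    · subst c₁
      exact h₄
    by_cases c₂ : m = i.succ
    · subst c₂
      exact h₃
    -- The remaining arrows of the chain avoid the index `i + 1` and are seen by the face.
    obtain ⟨j, hj⟩ := (Fin.eq_self_or_eq_succAbove i.succ.castSucc m.castSucc).resolve_left
      (fun h => c₂ (Fin.castSucc_injective _ h))
    obtain ⟨k, hk⟩ := (Fin.eq_self_or_eq_succAbove i.succ.castSucc m.succ).resolve_left
      (fun h => c₁ (Fin.succ_injective _ h))
    have hjk : j ≤ k := by
      rw [← (Fin.strictMono_succAbove i.succ.castSucc).le_iff_le, ← hj, ← hk]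
      exact Fin.castSucc_lt_succ.le
    refine (F.h_congr e₀.symm hj hk _ _).trans (Eq.trans ?_ (F'.h_congr e₀.symm hj hk _ _).symm)
    exact congrArg (fun G => AugDblFunctor.h G 0 j k (Fin.zero_le _) hjk) hδ
  · intro (F : AugDblFunctor (wAug (Fin (n + 1))) D) (G : AugDblFunctor (wAug (Fin 3)) D) hFG
    have hi : i.castSucc ≤ i.succ := Fin.castSucc_lt_succ.le
    have hedge : F.h i.castSucc i.castSucc i.succ le_rfl hi = G.h 0 0 2 le_rfl (by decide) :=
      congrArg (fun E : AugDblFunctor (wAug (Fin 2)) D => E.h 0 0 1 le_rfl (by decide)) hFG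
    have hG := G.h_comp 0 0 1 2 le_rfl (by decide) (by decide)
    rw [← hedge] at hG
    obtain ⟨l, t, h₁⟩ := hD.exists_of_cospan (r := F.v 0 i.castSucc i.succ (Fin.zero_le _) hi)
      (b := G.h 0 1 2 (by decide) (by decide))
      ((F.cod_v _ _ _ _ _).trans ((F.cod_h _ _ _ _ _).symm.trans hG.cod_eq))
    obtain ⟨l', t', h₂⟩ := hD.exists_of_cospan (r := l) (b := G.h 0 0 1 (by decide) (by decide))
      (h₁.cod_left.trans hG.adj.symm)
    have ht := CatOn.IsComp.of_comp (h₂.dom_right.symm.trans h₁.span)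
    -- The two lifted squares paste to a square with the same cospan as one of `F`, so `t'` followed
    -- by `t` factors a morphism of the top row of `F`.
    obtain ⟨hl', htt⟩ := hD.unique_of_cospan (h₂.hcomp h₁ ht hG)
      (F.isSq 0 i.castSucc i.castSucc i.succ (Fin.zero_le _) le_rfl hi)
    rw [htt] at ht
    obtain ⟨F', hF', ht', ht⟩ := exists_insert hD i F t' t ht
    refine ⟨F', hF', AugDblFunctor.ext_chain (n := 1) hD ?_⟩
    have c₁ := F'.isSq 0 i.castSucc.castSucc i.castSucc.castSucc i.succ.castSucc (Fin.zero_le _)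
      le_rfl hpq
    have hv : F'.v 0 i.castSucc.castSucc i.castSucc.castSucc (Fin.zero_le _) le_rfl = l' := by
      refine D.ver_unique ?_ ?_ ?_
      · rw [c₁.span, ht', h₂.span]
      · rw [AugDblFunctor.cod_v]; exact F'.o_mem _
      · rw [hl', AugDblFunctor.cod_v]; exact F.o_mem _
    rw [hv, ht'] at c₁
    obtain ⟨d₁, d₂⟩ := hD.unique_of_span c₁ h₂
    have c₂ := F'.isSq 0 i.castSucc.castSucc i.succ.castSucc i.succ.succ (Fin.zero_le _) hpq hqs
    rw [d₁, ht] at c₂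
    exact Fin.forall_fin_two.2 ⟨d₂, (hD.unique_of_span c₂ h₁).2⟩

theorem sDotObj_isTwoSegal : IsTwoSegal (sDotObj D) :=
  isTwoSegal_of_hasEarGluing (sDotObj_hasEarGluing hD)

/-- If the edge `{i, i + 1}` of a functor on `𝒲_n` is degenerate, then the functor is degenerate. -/
theorem degenerate_of_edge {m : ℕ} (i : Fin (m + 1)) (F : AugDblFunctor (wAug (Fin (m + 2))) D)
    (h : F.h i.castSucc i.castSucc i.succ le_rfl Fin.castSucc_lt_succ.le =
      D.toDbl.hor₀.id (F.o i.castSucc i.castSucc le_rfl)) :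
    (wMap (SimplexCategory.σ i ≫ SimplexCategory.δ i.succ).toOrderHom).trans F = F := by
  -- `p` sends `i + 1` to `i` and fixes all other indices.
  let p : Fin (m + 2) →o Fin (m + 2) :=
    (SimplexCategory.σ i ≫ SimplexCategory.δ i.succ).toOrderHom
  have hp (j : Fin (m + 2)) : p j = j ∨ j = i.succ ∧ p j = i.castSucc := by
    change i.succ.succAbove (i.predAbove j) = j ∨
      j = i.succ ∧ i.succ.succAbove (i.predAbove j) = i.castSucc
    rcases Fin.eq_self_or_eq_succAbove i.succ j with rfl | ⟨j, rfl⟩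
    · right
      simp
    · left
      simp
  have hp_le (j) : p j ≤ j := by
    rcases hp j with h | ⟨rfl, h⟩
    · exact h.le
    · exact h.le.trans Fin.castSucc_lt_succ.le
  have key (j) : F.h 0 (p j) j (Fin.zero_le _) (hp_le j) =
      D.toDbl.hor₀.id (F.o 0 (p j) (Fin.zero_le _)) := by
    rcases hp j with e | ⟨rfl, e⟩
    · exact (F.h_congr rfl rfl e.symm _ _).trans (F.h_id _ _ _)
    · refine (F.h_congr rfl e rfl _ _).trans ?_
      have a := F.isSq 0 i.castSucc i.castSucc i.succ (Fin.zero_le _) le_rfl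
        Fin.castSucc_lt_succ.le
      rw [h] at a
      have a' := a.cospan.trans (D.toDbl.hor₀.cod_id _)
      -- The bottom side is an identity, so the sides agree with those of the horizontal identity
      -- square on the right side; in particular the top is an identity.
      have b := hD.unique_of_cospan a (.id_ver rfl a')
      rw [b.2, ← b.1, AugDblFunctor.dom_v]
      exact congrArg _ (F.o_congr rfl e.symm _)
  refine AugDblFunctor.ext_row hD fun j k hjk => ?_
  have hp₀ : p 0 = 0 := Fin.le_zero_iff.1 (hp_le 0)
  refine (F.h_congr hp₀ rfl rfl (p.monotone bot_le) (p.monotone hjk)).trans ?_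
  -- `0(p j) → 0k` factors through both `0(p k)` and `0j`, in each case with one factor an identity
  -- by `key`.
  have a := F.h_comp 0 (p j) (p k) k (Fin.zero_le _) (p.monotone hjk) (hp_le k)
  have b := F.h_comp 0 (p j) j k (Fin.zero_le _) (hp_le j) hjk
  rw [key] at a b
  exact (a.unique (.id_right (F.cod_h _ _ _ _ _))).symm.trans
    (b.unique (.id_left (b.adj.symm.trans (D.toDbl.hor₀.cod_id _))))

/-- Injectivity holds because `σ i` has the face `δ i.succ` as a retraction. For surjectivity that
face is the preimage, by `degenerate_of_edge`. -/
theorem sDotObj_isUnital : IsUnital (sDotObj D) := by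
  intro m _ i
  have e₁ : SimplexCategory.mkOfSucc i ≫ SimplexCategory.σ i =
      SimplexCategory.σ 0 ≫ SimplexCategory.const ⦋0⦌ ⦋m⦌ i := by
    ext v : 3
    change Fin 2 at v
    fin_cases v
    · exact Fin.predAbove_castSucc_self i
    · exact Fin.predAbove_succ_self i
  have e₂ : SimplexCategory.const ⦋0⦌ ⦋m⦌ i ≫ SimplexCategory.δ i.succ =
      SimplexCategory.δ 1 ≫ SimplexCategory.mkOfSucc i := by
    ext v : 3
    obtain rfl := Fin.fin_one_eq_zero v
    exact Fin.succAbove_succ_self i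
  rw [Limits.Types.isPullback_iff]
  refine ⟨?_, ?_, ?_⟩
  · change (sDotObj D).map _ ≫ (sDotObj D).map _ = (sDotObj D).map _ ≫ (sDotObj D).map _
    rw [← Functor.map_comp, ← Functor.map_comp, ← op_comp, ← op_comp, e₁]
  · rintro x y ⟨-, h⟩
    have := congrArg ((sDotObj D).δ i.succ) h
    rwa [SSet.δ_comp_σ_succ_apply, SSet.δ_comp_σ_succ_apply] at this
  · intro (a : AugDblFunctor (wAug (Fin 1)) D) (F : AugDblFunctor (wAug (Fin (m + 2))) D) h
    let a' : (sDotObj D) _⦋0⦌ := a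
    let F' : (sDotObj D) _⦋m + 1⦌ := F
    refine ⟨(sDotObj D).δ i.succ F', ?_, ?_⟩
    · change (sDotObj D).map _ ((sDotObj D).map _ F') = a'
      rw [map_map, e₂, ← map_map]
      refine (congrArg _ h.symm).trans ?_
      exact SSet.δ_comp_σ_succ_apply (S := sDotObj D) (0 : Fin 1) a'
    · change (sDotObj D).map _ ((sDotObj D).map _ F') = F'
      rw [map_map]
      refine degenerate_of_edge hD i F ?_
      -- By `h` the edge `{i, i + 1}` is the degeneracy of `a`, and the horizontal morphism `00 →
      -- 01` of a degenerate edge is an identity.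
      have h₁ : a.h 0 0 0 le_rfl le_rfl = _ :=
        congrArg (fun E : AugDblFunctor (wAug (Fin 2)) D => E.h 0 0 1 le_rfl (by decide)) h
      have h₂ : a.o 0 0 le_rfl = _ :=
        congrArg (fun E : AugDblFunctor (wAug (Fin 2)) D => E.o 0 0 le_rfl) h
      rw [a.h_id, h₂] at h₁
      exact h₁.symm

theorem sDotObj_unitalTwoSegal : unitalTwoSegal (sDotObj D) :=
  ⟨sDotObj_isTwoSegal hD, sDotObj_isUnital hD⟩

end SDot

/-! ### Isomorphisms of double categories -/

theorem CatOn.IsFunctor.symm {O M : Type u} {O' M' : Type v} {C : CatOn O M} {C' : CatOn O' M'}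
    {F : O ≃ O'} {G : M ≃ M'} (h : C.IsFunctor C' F G) : C'.IsFunctor C F.symm G.symm := by
  refine .of_isComp (fun f => ?_) (fun f => ?_) (fun x => ?_) ?_
  · rw [F.eq_symm_apply, ← h.dom, G.apply_symm_apply]
  · rw [F.eq_symm_apply, ← h.cod, G.apply_symm_apply]
  · rw [G.symm_apply_eq, h.id, F.apply_symm_apply]
  · rintro f g k hk
    have e : C.cod (G.symm f) = C.dom (G.symm g) := by
      apply F.injective
      rw [← h.cod, ← h.dom, G.apply_symm_apply, G.apply_symm_apply, hk.adj]
    have a := CatOn.IsComp.of_comp e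
    have b := CatOn.IsComp.map h a
    rw [G.apply_symm_apply, G.apply_symm_apply] at b
    rwa [b.unique hk |> G.eq_symm_apply.2] at a

/-- Squares correspond to spans in both double categories; injectivity on objects ensures that the
lifted sides still have a common source. -/
theorem DblFunctor.sq_bijective {C : DblCat.{v}} {D : DblCat.{u}} (hC : C.IsStable)
    (hD : D.IsStable) (F : DblFunctor C D) (ho : Function.Injective F.ob)
    (hh : Function.Bijective F.hor) (hv : Function.Bijective F.ver) :
    Function.Bijective F.sq := by
  constructor
  · intro α β h
    refine hC.sq_ext (hv.1 ?_) (hh.1 ?_)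
    · rw [← F.isFunctor_hor₁.dom, ← F.isFunctor_hor₁.dom, h]
    · rw [← F.isFunctor_ver₁.dom, ← F.isFunctor_ver₁.dom, h]
  · intro β
    obtain ⟨l, hl⟩ := hv.2 (D.hor₁.dom β)
    obtain ⟨t, ht⟩ := hh.2 (D.ver₁.dom β)
    obtain ⟨α, hα⟩ := hC.span.2 ⟨(l, t), ho (by
      rw [← F.isFunctor_ver₀.dom, ← F.isFunctor_hor₀.dom, hl, ht, D.dom_functor.dom])⟩
    have e := congrArg Subtype.val hα
    have e₁ : C.hor₁.dom α = l := congrArg Prod.fst e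
    have e₂ : C.ver₁.dom α = t := congrArg Prod.snd e
    refine ⟨α, hD.sq_ext ?_ ?_⟩
    · rw [F.isFunctor_hor₁.dom, e₁, hl]
    · rw [F.isFunctor_ver₁.dom, e₂, ht]

/-- An augmented double functor which is bijective on objects, morphisms and squares and
reflects the augmentation is an isomorphism. -/
noncomputable def AugDblCat.isoOfBijective {C D : AugDblCat.{u}} (F : C ⟶ D)
    (ho : Function.Bijective F.toFunctor.ob) (hh : Function.Bijective F.toFunctor.hor)
    (hv : Function.Bijective F.toFunctor.ver) (hs : Function.Bijective F.toFunctor.sq)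
    (ha : ∀ x, F.toFunctor.ob x ∈ D.aug → x ∈ C.aug) : C ≅ D where
  hom := F
  inv :=
    { toFunctor :=
        { ob := (Equiv.ofBijective _ ho).symm
          hor := (Equiv.ofBijective _ hh).symm
          ver := (Equiv.ofBijective _ hv).symm
          sq := (Equiv.ofBijective _ hs).symm
          isFunctor_hor₀ := CatOn.IsFunctor.symm F.toFunctor.isFunctor_hor₀
          isFunctor_ver₀ := CatOn.IsFunctor.symm F.toFunctor.isFunctor_ver₀
          isFunctor_hor₁ := CatOn.IsFunctor.symm F.toFunctor.isFunctor_hor₁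
          isFunctor_ver₁ := CatOn.IsFunctor.symm F.toFunctor.isFunctor_ver₁ }
      map_aug := fun a h => ha _ (by
        rwa [Equiv.ofBijective_apply_symm_apply F.toFunctor.ob ho]) }
  hom_inv_id := AugDblFunctor.ext (DblFunctor.ext
    (funext fun x => (Equiv.ofBijective _ ho).symm_apply_apply x)
    (funext fun x => (Equiv.ofBijective _ hh).symm_apply_apply x)
    (funext fun x => (Equiv.ofBijective _ hv).symm_apply_apply x)
    (funext fun x => (Equiv.ofBijective _ hs).symm_apply_apply x))
  inv_hom_id := AugDblFunctor.ext (DblFunctor.ext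
    (funext fun x => (Equiv.ofBijective _ ho).apply_symm_apply x)
    (funext fun x => (Equiv.ofBijective _ hh).apply_symm_apply x)
    (funext fun x => (Equiv.ofBijective _ hv).apply_symm_apply x)
    (funext fun x => (Equiv.ofBijective _ hs).apply_symm_apply x))

/-! ### The path construction of the Waldhausen construction -/

section Counit

variable {D : AugDblCat.{u}} (hD : D.toDbl.IsStable)

/-- Evaluation of functors on `𝒲₁`, `𝒲₂` and `𝒲₃` at the maximal cells. -/
noncomputable def evalDbl : DblFunctor (pathDbl (sDotObj_isTwoSegal hD)) D.toDbl :=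
  .ofIsSq hD
    (fun F : AugDblFunctor (wAug (Fin 2)) D => F.o 0 1 (by decide))
    (fun F : AugDblFunctor (wAug (Fin 3)) D => F.h 0 1 2 (by decide) (by decide))
    (fun F : AugDblFunctor (wAug (Fin 3)) D => F.v 0 1 2 (by decide) (by decide))
    (by
      refine .of_isComp (fun F : AugDblFunctor (wAug (Fin 3)) D => F.dom_h _ _ _ _ _)
        (fun F : AugDblFunctor (wAug (Fin 3)) D => F.cod_h _ _ _ _ _)
        (fun F : AugDblFunctor (wAug (Fin 2)) D => F.h_id _ _ _) ?_
      rintro f g _ ⟨h, rfl⟩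
      -- The composite is a face of the 3-simplex `w`, which is itself a functor on `𝒲₃` and
      -- preserves the composite of `01 → 02 → 03`.
      obtain ⟨w, rfl, rfl⟩ := (glue31 (sDotObj_isTwoSegal hD)).1 f g h
      rw [show (pathDbl (sDotObj_isTwoSegal hD)).hor₀.comp _ _ h = _ from
        horComp_eq (sDotObj_isTwoSegal hD) h w rfl rfl]
      exact AugDblFunctor.h_comp (P := Fin 4) w 0 1 2 3 (by decide) (by decide) (by decide))
    (by
      refine .of_isComp (fun F : AugDblFunctor (wAug (Fin 3)) D => F.dom_v _ _ _ _ _)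
        (fun F : AugDblFunctor (wAug (Fin 3)) D => F.cod_v _ _ _ _ _)
        (fun F : AugDblFunctor (wAug (Fin 2)) D => F.v_id _ _ _) ?_
      rintro f g _ ⟨h, rfl⟩
      obtain ⟨w, rfl, rfl⟩ := (glue20 (sDotObj_isTwoSegal hD)).1 f g h
      rw [show (pathDbl (sDotObj_isTwoSegal hD)).ver₀.comp _ _ h = _ from
        verComp_eq (sDotObj_isTwoSegal hD) h w rfl rfl]
      exact AugDblFunctor.v_comp (P := Fin 4) w 0 1 2 3 (by decide) (by decide) (by decide))
    (fun F : AugDblFunctor (wAug (Fin 4)) D =>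
      F.isSq 0 1 2 3 (by decide) (by decide) (by decide))

/-- A stable augmented double category as the path construction of its Waldhausen
construction. -/
noncomputable def evalIso :
    pathAugObj ⟨sDotObj D, sDotObj_unitalTwoSegal hD⟩ ≅ D :=
  AugDblCat.isoOfBijective
    ⟨evalDbl hD, by
      rintro _ ⟨F, rfl⟩
      exact AugDblFunctor.o_mem (P := Fin 1) F 0⟩
    (eval_ob_bijective hD) (eval_hor_bijective hD) (eval_ver_bijective hD)
    (DblFunctor.sq_bijective (pathDbl_isStable (sDotObj_isTwoSegal hD)) hD (evalDbl hD)
      (eval_ob_bijective hD).1 (eval_hor_bijective hD) (eval_ver_bijective hD))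
    -- An object in the augmentation is the value of a 0-simplex `G`, so the corresponding 1-simplex
    -- is the degeneracy of `G`.
    (fun F hF => by
      obtain ⟨G, hG⟩ := exists_eval_zero hD hF
      exact ⟨G, (eval_ob_bijective hD).1 hG⟩)

end Counit

/-! ### The Waldhausen construction of the path construction -/

section Unit

/-- The map `⦋1⦌ ⟶ m` with values `i ≤ j`. -/
def wEdge {m : SimplexCategory} (x : WOb (Fin (m.len + 1))) : ⦋1⦌ ⟶ m :=
  SimplexCategory.Hom.mk (a := ⦋1⦌) ⟨![x.i, x.j], by
    rw [Fin.monotone_iff_le_succ]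
    intro i
    fin_cases i
    exact x.hij⟩

/-- The map `⦋2⦌ ⟶ m` with values `i ≤ j ≤ k`. -/
def wTri {m : SimplexCategory} {i j k : Fin (m.len + 1)} (hij : i ≤ j) (hjk : j ≤ k) : ⦋2⦌ ⟶ m :=
  SimplexCategory.Hom.mk (a := ⦋2⦌) ⟨![i, j, k], by
    rw [Fin.monotone_iff_le_succ]
    intro i
    fin_cases i
    exacts [hij, hjk]⟩

/-- The map `⦋3⦌ ⟶ m` with values `i ≤ k ≤ j ≤ l`. -/
def wTet {m : SimplexCategory} {i k j l : Fin (m.len + 1)} (hik : i ≤ k) (hkj : k ≤ j)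
    (hjl : j ≤ l) : ⦋3⦌ ⟶ m :=
  SimplexCategory.Hom.mk (a := ⦋3⦌) ⟨![i, k, j, l], by
    rw [Fin.monotone_iff_le_succ]
    intro i
    fin_cases i
    exacts [hik, hkj, hjl]⟩

theorem map_congr {X : SSet.{u}} {n : ℕ} {m : SimplexCategory} {f g : ⦋n⦌ ⟶ m} (x : X.obj (op m))
    (h : ∀ v : Fin (n + 1), f.toOrderHom v = g.toOrderHom v) : X.map f.op x = X.map g.op x := by
  rw [show f = g by ext v : 3; exact h v]

variable (X : UnitalTwoSegalSet.{u})

/-- The functor `𝒲_m ⟶ 𝒫 X` given by the faces of dimension at most three of a simplex of `X`. -/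
noncomputable def facesFunctor {m : SimplexCategory} (x : X.obj.obj (op m)) :
    AugDblFunctor (wAug (Fin (m.len + 1))) (pathAugObj X) where
  toFunctor := DblFunctor.ofIsSq (C := wDbl (Fin (m.len + 1))) (pathDbl_isStable X.property.1)
    (fun z => X.obj.map (wEdge z).op x)
    (fun f => X.obj.map (wTri f.hij f.hjk).op x)
    (fun f => X.obj.map (wTri f.hik f.hkj).op x)
    (by
      refine .of_isComp (fun f => ?_) (fun f => ?_) (fun z => ?_) ?_
      · refine (map_map _ _ _).trans (map_congr _ fun v => ?_)
        fin_cases v <;> rfl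
      · refine (map_map _ _ _).trans (map_congr _ fun v => ?_)
        fin_cases v <;> rfl
      · refine Eq.trans (map_congr _ fun v => ?_) (map_map _ _ _).symm
        fin_cases v <;> rfl
      · rintro ⟨i, j, k, hij, hjk⟩ ⟨i', k', l, hij', hkl⟩ _ ⟨e, rfl⟩
        obtain ⟨rfl, rfl⟩ := WOb.mk.inj e
        -- The face of `x` on `i ≤ j ≤ k ≤ l` witnesses the composite: two of its triangles are the
        -- factors, and the third is their composite. Vertical composition below uses other faces of
        -- such a tetrahedron.
        have h₁ : X.obj.δ 3 (X.obj.map (wTet hij hjk hkl).op x) =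
            X.obj.map (wTri hij hjk).op x := by
          refine (map_map _ _ _).trans (map_congr _ fun v => ?_)
          fin_cases v <;> rfl
        have h₂ : X.obj.δ 1 (X.obj.map (wTet hij hjk hkl).op x) =
            X.obj.map (wTri hij' hkl).op x := by
          refine (map_map _ _ _).trans (map_congr _ fun v => ?_)
          fin_cases v <;> rfl
        have h₃ : X.obj.δ 2 (X.obj.map (wTet hij hjk hkl).op x) =
            X.obj.map (wTri hij (hjk.trans hkl)).op x := by
          refine (map_map _ _ _).trans (map_congr _ fun v => ?_)
          fin_cases v <;> rfl
        have h : X.obj.δ 1 (X.obj.map (wTri hij hjk).op x) =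
            X.obj.δ 2 (X.obj.map (wTri hij' hkl).op x) := by
          rw [← h₁, ← h₂]; exact face_face
        exact ⟨h, (horComp_eq X.property.1 h _ h₁ h₂).trans h₃⟩)
    (by
      refine .of_isComp (fun f => ?_) (fun f => ?_) (fun z => ?_) ?_
      · refine (map_map _ _ _).trans (map_congr _ fun v => ?_)
        fin_cases v <;> rfl
      · refine (map_map _ _ _).trans (map_congr _ fun v => ?_)
        fin_cases v <;> rfl
      · refine Eq.trans (map_congr _ fun v => ?_) (map_map _ _ _).symm
        fin_cases v <;> rfl
      · rintro ⟨i, k, j, hik, hkj⟩ ⟨k', l, j', hkl, hlj⟩ _ ⟨e, rfl⟩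
        obtain ⟨rfl, rfl⟩ := WOb.mk.inj e
        have h₁ : X.obj.δ 2 (X.obj.map (wTet hik hkl hlj).op x) =
            X.obj.map (wTri hik hkj).op x := by
          refine (map_map _ _ _).trans (map_congr _ fun v => ?_)
          fin_cases v <;> rfl
        have h₂ : X.obj.δ 0 (X.obj.map (wTet hik hkl hlj).op x) =
            X.obj.map (wTri hkl hlj).op x := by
          refine (map_map _ _ _).trans (map_congr _ fun v => ?_)
          fin_cases v <;> rfl
        have h₃ : X.obj.δ 1 (X.obj.map (wTet hik hkl hlj).op x) =
            X.obj.map (wTri (hik.trans hkl) hlj).op x := by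
          refine (map_map _ _ _).trans (map_congr _ fun v => ?_)
          fin_cases v <;> rfl
        have h : X.obj.δ 0 (X.obj.map (wTri hik hkj).op x) =
            X.obj.δ 1 (X.obj.map (wTri hkl hlj).op x) := by
          rw [← h₁, ← h₂]; exact face_face
        exact ⟨h, (verComp_eq X.property.1 h _ h₁ h₂).trans h₃⟩)
    (fun α => by
      refine ⟨(X.obj.map (wTet α.hik α.hkj α.hjl).op x : X.obj _⦋3⦌), ?_, ?_, ?_, ?_⟩ <;>
      · refine (map_map _ _ _).trans (map_congr _ fun v => ?_)
        fin_cases v <;> rfl)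
  map_aug := by
    rintro ⟨i, j, hij⟩ (h : i = j)
    subst h
    -- The edge `ii` is the degeneracy of the vertex `i`.
    refine ⟨X.obj.map (SimplexCategory.const ⦋0⦌ m i).op x, ?_⟩
    refine (map_map _ _ _).trans (map_congr _ fun v => ?_)
    fin_cases v <;> rfl

/-- The comparison of a unital 2-Segal set with the Waldhausen construction of its path
construction. -/
noncomputable def facesMap : X.obj ⟶ sDotObj (pathAugObj X) where
  app n := TypeCat.ofHom fun x => facesFunctor X (m := n.unop) x
  naturality {n n'} f := by
    ext x
    refine AugDblFunctor.ext_row (P := Fin (n'.unop.len + 1)) (pathDbl_isStable X.property.1)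
      fun j k hjk => ?_
    refine (map_map _ f.unop _).trans (map_congr _ fun v => ?_)
    fin_cases v <;> rfl

theorem map_eq_self {X : SSet.{u}} {n : ℕ} {f : ⦋n⦌ ⟶ ⦋n⦌} (x : X _⦋n⦌)
    (h : ∀ v : Fin (n + 1), f.toOrderHom v = v) : X.map f.op x = x := by
  rw [show f = 𝟙 _ by ext v : 3; exact h v]
  simp

theorem bijective_of_leftInverse {α : Type u} {β : Type v} {f : α → β} {g : β → α}
    (hg : Function.Injective g) (h : Function.LeftInverse g f) : Function.Bijective f :=
  ⟨h.injective, fun b => ⟨g b, hg (h _)⟩⟩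

/-- In degrees 1 and 2 evaluation at the maximal cell is injective and a left inverse. In degree 0
both sides are `s₀ X₀`, as `s₀` is injective. Higher degrees follow from the 2-Segal property on
both sides. -/
theorem facesMap_bijective (n : ℕ) : Function.Bijective ((facesMap X).app (op ⦋n⦌)) := by
  have hX := pathDbl_isStable X.property.1
  have h₁ : Function.Bijective ((facesMap X).app (op ⦋1⦌)) :=
    bijective_of_leftInverse (eval_ob_bijective (D := pathAugObj X) hX).1 fun x =>
      map_eq_self (X := X.obj) x fun v => by fin_cases v <;> rfl
  have h₂ : Function.Bijective ((facesMap X).app (op ⦋2⦌)) :=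
    bijective_of_leftInverse (eval_hor_bijective (D := pathAugObj X) hX).1 fun x =>
      map_eq_self (X := X.obj) x fun v => by fin_cases v <;> rfl
  match n with
  | 0 =>
    have h₀ (x : X.obj _⦋0⦌) : (facesFunctor X (m := ⦋0⦌) x).o 0 0 le_rfl =
        (X.obj.σ (0 : Fin 1) x : X.obj _⦋1⦌) :=
      map_congr (X := X.obj) x fun v => by fin_cases v <;> rfl
    constructor
    · intro x y h
      have e : X.obj.σ (0 : Fin 1) x = X.obj.σ (0 : Fin 1) y :=
        (h₀ x).symm.trans ((congrArg (fun F : AugDblFunctor (wAug (Fin 1)) (pathAugObj X) =>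
          F.o 0 0 le_rfl) h).trans (h₀ y))
      have := congrArg (X.obj.δ (1 : Fin 2)) e
      rwa [show X.obj.δ (1 : Fin 2) (X.obj.σ (0 : Fin 1) x) = x from face_deg,
        show X.obj.δ (1 : Fin 2) (X.obj.σ (0 : Fin 1) y) = y from face_deg] at this
    · intro (F : AugDblFunctor (wAug (Fin 1)) (pathAugObj X))
      obtain ⟨x, hx⟩ := F.o_mem 0
      exact ⟨x, eval_zero_injective (D := pathAugObj X) hX ((h₀ x).trans hx)⟩
  | 1 => exact h₁
  | 2 => exact h₂
  | n + 3 =>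
    exact bijective_app_of_twoSegal X.property.1 (sDotObj_isTwoSegal hX) _ h₁.1 h₂ (n + 3)
      (by omega)

theorem isIso_facesMap : IsIso (facesMap X) := by
  rw [NatTrans.isIso_iff_isIso_app]
  intro n
  rw [isIso_iff_bijective]
  exact facesMap_bijective X n.unop.len

theorem facesMap_naturality {X Y : UnitalTwoSegalSet.{u}} (f : X ⟶ Y) :
    f.hom ≫ facesMap Y = facesMap X ≫ sDot.map (pathFunctor.map f).hom := by
  ext n x
  refine AugDblFunctor.ext_row (P := Fin (n.unop.len + 1)) (pathDbl_isStable Y.property.1)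
    fun j k hjk => ?_
  exact (NatTrans.naturality_apply f.hom _ x).symm

end Unit

/-! ### The equivalences -/

/-- The Waldhausen construction, as a functor to unital 2-Segal sets. -/
abbrev sDotSt : AugStDblCat.{u} ⥤ UnitalTwoSegalSet.{u} :=
  unitalTwoSegal.lift (augStable.ι ⋙ sDot) fun D => sDotObj_unitalTwoSegal D.property

/-- Evaluation identifies 0-simplices with the elements of the augmentation, which is a singleton
here. -/
theorem sDot_reduced (D : PtStDblCat.{u}) :
    redUnitalTwoSegal (sDot.obj (ptToAug.obj D.obj)) := by
  have hD : (ptToAug.obj D.obj).toDbl.IsStable := D.property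
  refine ⟨sDotObj_unitalTwoSegal hD, ?_⟩
  obtain ⟨F, hF⟩ := exists_eval_zero hD (show D.obj.pt ∈ (ptToAug.obj D.obj).aug from rfl)
  exact ⟨⟨⟨F⟩, fun G => eval_zero_injective hD ((AugDblFunctor.o_mem (P := Fin 1) G 0).trans
    hF.symm)⟩⟩

/-- The Waldhausen construction, as a functor from pointed stable double categories to reduced
unital 2-Segal sets. -/
abbrev sDotPt : PtStDblCat.{u} ⥤ RedUnitalTwoSegalSet.{u} :=
  redUnitalTwoSegal.lift (ptStable.ι ⋙ ptToAug ⋙ sDot) sDot_reduced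

/-- The path construction is left inverse to the Waldhausen construction. -/
noncomputable def sDotPathIso : sDotSt.{u} ⋙ pathFunctor ≅ 𝟭 AugStDblCat.{u} :=
  NatIso.ofComponents (fun D => augStable.isoMk (evalIso D.property)) (by
    intro C D F
    apply ObjectProperty.hom_ext
    -- On objects and morphisms naturality holds by definition. The action of `evalDbl` on squares
    -- is obtained by choice, so there stability is used instead.
    exact AugDblFunctor.ext (DblFunctor.ext_of_isStable D.property (fun _ => rfl) (fun _ => rfl)
      (fun _ => rfl)))

/-- The path construction is right inverse to the Waldhausen construction. -/
noncomputable def pathSDotIso : 𝟭 UnitalTwoSegalSet.{u} ≅ pathFunctor ⋙ sDotSt :=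
  NatIso.ofComponents
    (fun X => unitalTwoSegal.isoMk
      (@asIso SSet.{u} _ X.obj (sDotObj (pathAugObj X)) (facesMap X) (isIso_facesMap X)))
    (fun f => ObjectProperty.hom_ext _ (facesMap_naturality f))

/-- Mapping one singleton augmentation into another means preserving the point. -/
instance : ptToAugSt.{u}.Full where
  map_surjective F :=
    ⟨ObjectProperty.homMk ⟨F.hom.toFunctor, F.hom.map_aug _ rfl⟩, rfl⟩

instance : ptToAugSt.{u}.Faithful where
  map_injective {C D F G} h := by
    apply ObjectProperty.hom_ext
    exact PtDblFunctor.ext (congrArg (fun H => H.hom.toFunctor) h)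

/-- The pointed path construction is compatible with the augmented one. -/
noncomputable def pathPtIso :
    pathPtFunctor.{u} ⋙ ptToAugSt ≅ redInclusion ⋙ pathFunctor :=
  -- The underlying double categories coincide, and the augmentations `{pt}` and `s₀ X₀` have the
  -- same elements; so the identity double functor is augmented in both directions.
  NatIso.ofComponents (fun X => augStable.isoMk
    { hom := ⟨.refl _, fun x hx => (mem_pathAug_red X x).2 hx⟩
      inv := ⟨.refl _, fun x hx => (mem_pathAug_red X x).1 hx⟩
      hom_inv_id := rfl
      inv_hom_id := rfl })
    (fun _ => rfl)

/-- The pointed Waldhausen construction is compatible with the augmented one. -/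
def sDotPtIso : ptToAugSt.{u} ⋙ sDotSt ≅ sDotPt ⋙ redInclusion := Iso.refl _

/-- The equivalence between augmented stable double categories and unital 2-Segal sets. -/
noncomputable def augEquivalence : AugStDblCat.{u} ≌ UnitalTwoSegalSet.{u} :=
  .mk sDotSt pathFunctor sDotPathIso.symm pathSDotIso.symm

/-- The equivalence between pointed stable double categories and reduced unital 2-Segal sets. -/
noncomputable def ptEquivalence : PtStDblCat.{u} ≌ RedUnitalTwoSegalSet.{u} :=
  .mk sDotPt pathPtFunctor
    -- The unit is transferred from the augmented case along the fully faithful `ptToAugSt`, and the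
    -- counit likewise along `redInclusion`.
    (Functor.fullyFaithfulCancelRight ptToAugSt
      (Functor.isoWhiskerLeft ptToAugSt sDotPathIso.symm ≪≫
        Functor.isoWhiskerRight sDotPtIso pathFunctor ≪≫
        Functor.isoWhiskerLeft sDotPt pathPtIso.symm))
    (Functor.fullyFaithfulCancelRight redInclusion
      (Functor.isoWhiskerLeft pathPtFunctor sDotPtIso.symm ≪≫
        Functor.isoWhiskerRight pathPtIso sDotSt ≪≫
        Functor.isoWhiskerLeft redInclusion pathSDotIso.symm))

end TwoSegal

theorem mainTheorem1 :
    ∃ (hS : ∀ D : TwoSegal.AugStDblCat.{u}, TwoSegal.unitalTwoSegal (TwoSegal.sDot.obj D.obj))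
      (hS' : ∀ D : TwoSegal.PtStDblCat.{u},
        TwoSegal.redUnitalTwoSegal (TwoSegal.sDot.obj (TwoSegal.ptToAug.obj D.obj))),
      (∃ e : TwoSegal.AugStDblCat.{u} ≌ TwoSegal.UnitalTwoSegalSet.{u},
        e.functor = TwoSegal.unitalTwoSegal.lift
          (TwoSegal.augStable.ι ⋙ TwoSegal.sDot) hS ∧
        e.inverse = TwoSegal.pathFunctor) ∧
      (∃ e' : TwoSegal.PtStDblCat.{u} ≌ TwoSegal.RedUnitalTwoSegalSet.{u},
        e'.functor = TwoSegal.redUnitalTwoSegal.lift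
          (TwoSegal.ptStable.ι ⋙ TwoSegal.ptToAug ⋙ TwoSegal.sDot) hS' ∧
        e'.inverse = TwoSegal.pathPtFunctor) ∧
      Nonempty
        (TwoSegal.ptToAugSt ⋙ TwoSegal.unitalTwoSegal.lift
            (TwoSegal.augStable.ι ⋙ TwoSegal.sDot) hS ≅
          TwoSegal.redUnitalTwoSegal.lift
            (TwoSegal.ptStable.ι ⋙ TwoSegal.ptToAug ⋙ TwoSegal.sDot) hS' ⋙
            TwoSegal.redInclusion) ∧
      Nonempty
        (TwoSegal.pathPtFunctor ⋙ TwoSegal.ptToAugSt ≅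
          TwoSegal.redInclusion ⋙ TwoSegal.pathFunctor) :=
  ⟨fun D => TwoSegal.sDotObj_unitalTwoSegal D.property, TwoSegal.sDot_reduced,
    -- Enforcing the triangle identities in `Equivalence.mk` changes only the unit, so functor and
    -- inverse are still the given ones by definition.
    ⟨TwoSegal.augEquivalence, rfl, rfl⟩, ⟨TwoSegal.ptEquivalence, rfl, rfl⟩,
    ⟨TwoSegal.sDotPtIso⟩, ⟨TwoSegal.pathPtIso⟩⟩
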